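/- Let $G=(V,E)$ be a finite simple undirected graph with $n$ vertices and let $T\subseteq V$ be a set of terminals with $2\le |T|\le n/3$. A set $S$ with $T\subseteq S\subseteq V$ is called $T$-connecting if the induced subgraph $G[S]$ is connected, and it is a minimal $T$-connecting set if moreover no proper subset of $S$ is $T$-connecting. Then $G$ has at most $$\binom{n-|T|}{|T|-2}\cdot 3^{(n-|T|)/3}$$ minimal $T$-connecting sets. Moreover, there is an algorithm which, given any such $G$ and $T$, lists all minimal $T$-connecting sets of $G$ in time $$O^*\!\left(\binom{n-|T|}{|T|-2}\cdot 3^{(n-|T|)/3}\right),$$ that is, in at most $p(n)\cdot\binom{n-|T|}{|T|-2}\cdot 3^{(n-|T|)/3}$ steps of a random access machine, where $p$ is a polynomial that does not depend on $G$ and $T$. -/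

import Mathlib

/-- `S` is `T`-connecting in `G`: it contains `T`, and any two vertices of `S` are joined by a path
in the induced subgraph `G[S]`. -/
def IsTConnecting {V : Type*} (G : SimpleGraph V) (T S : Finset V) : Prop :=
  T ⊆ S ∧ (G.induce (S : Set V)).Preconnected

/-- `S` is a minimal `T`-connecting set: it is `T`-connecting and no strict subset of it is. -/
def IsMinimalTConnecting {V : Type*} (G : SimpleGraph V) (T S : Finset V) : Prop :=
  IsTConnecting G T S ∧ ∀ S' : Finset V, S' ⊂ S → ¬ IsTConnecting G T S'

/-! The machine model: a successor random access machine, programmed by structured programs.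
Registers and memory cells hold natural numbers. The only arithmetic is increment and decrement, so
every number that occurs during a run is bounded by the largest number in the input and the program
plus the number of steps made; charging one unit of time for each instruction is therefore an honest
measure, with no hidden power in long numbers. -/

namespace RAM

/-- Programs. Here `x`, `y` are names of registers and `a` is the name of a memory (an infinite
random access array); a program, being a finite term, mentions only finitely many of them. -/
inductive Program : Type
  /-- do nothing -/
  | skip : Program
  /-- `x := c`, for a constant `c` written in the program -/
  | const (x c : ℕ) : Program
  /-- `x := y` -/
  | copy (x y : ℕ) : Program
  /-- `x := x + 1` -/
  | incr (x : ℕ) : Program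
  /-- `x := x - 1`, where `0 - 1 = 0` -/
  | decr (x : ℕ) : Program
  /-- `x := a[y]` -/
  | load (x a y : ℕ) : Program
  /-- `a[x] := y` -/
  | store (a x y : ℕ) : Program
  /-- append the content of register `x` to the output -/
  | write (x : ℕ) : Program
  /-- `p; q` -/
  | seq (p q : Program) : Program
  /-- `if x < y then p else q` -/
  | cond (x y : ℕ) (p q : Program) : Program
  /-- `while x < y do p` -/
  | loop (x y : ℕ) (p : Program) : Program

/-- A memory state: contents of the registers, contents of the memories, and the output tape. -/
structure Store : Type where
  reg : ℕ → ℕ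
  mem : ℕ → ℕ → ℕ
  out : List ℕ

/-- Write `v` to register `x`. -/
def Store.setReg (s : Store) (x v : ℕ) : Store :=
  { s with reg := Function.update s.reg x v }

/-- Write `v` to cell `i` of memory `a`. -/
def Store.setMem (s : Store) (a i v : ℕ) : Store :=
  { s with mem := Function.update s.mem a (Function.update (s.mem a) i v) }

/-- Append `v` to the output. -/
def Store.emit (s : Store) (v : ℕ) : Store :=
  { s with out := s.out ++ [v] }

/-- `Runs p s s' t`: program `p`, started in the state `s`, halts in the state `s'` after exactly
`t` steps. Each elementary instruction and each evaluation of a test is one step. -/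
inductive Runs : Program → Store → Store → ℕ → Prop
  | skip (s : Store) : Runs .skip s s 1
  | const (s : Store) (x c : ℕ) : Runs (.const x c) s (s.setReg x c) 1
  | copy (s : Store) (x y : ℕ) : Runs (.copy x y) s (s.setReg x (s.reg y)) 1
  | incr (s : Store) (x : ℕ) : Runs (.incr x) s (s.setReg x (s.reg x + 1)) 1
  | decr (s : Store) (x : ℕ) : Runs (.decr x) s (s.setReg x (s.reg x - 1)) 1
  | load (s : Store) (x a y : ℕ) : Runs (.load x a y) s (s.setReg x (s.mem a (s.reg y))) 1
  | store (s : Store) (a x y : ℕ) : Runs (.store a x y) s (s.setMem a (s.reg x) (s.reg y)) 1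
  | write (s : Store) (x : ℕ) : Runs (.write x) s (s.emit (s.reg x)) 1
  | seq {p q : Program} {s s' s'' : Store} {t t' : ℕ} :
      Runs p s s' t → Runs q s' s'' t' → Runs (.seq p q) s s'' (t + t')
  | cond_true {x y : ℕ} {p q : Program} {s s' : Store} {t : ℕ} :
      s.reg x < s.reg y → Runs p s s' t → Runs (.cond x y p q) s s' (t + 1)
  | cond_false {x y : ℕ} {p q : Program} {s s' : Store} {t : ℕ} :
      ¬ s.reg x < s.reg y → Runs q s s' t → Runs (.cond x y p q) s s' (t + 1)
  | loop_true {x y : ℕ} {p : Program} {s s' s'' : Store} {t t' : ℕ} :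
      s.reg x < s.reg y → Runs p s s' t → Runs (.loop x y p) s' s'' t' →
        Runs (.loop x y p) s s'' (t + t' + 1)
  | loop_false {x y : ℕ} {p : Program} {s : Store} :
      ¬ s.reg x < s.reg y → Runs (.loop x y p) s s 1

end RAM

open Classical in
/-- The initial state for an input `(G, T)` on the vertex set `{0, …, n - 1}`: register `0` holds
`n`, memory `0` holds the adjacency matrix row by row (entry `(i, j)` in cell `i * n + j`), memory
`1` holds the characteristic vector of `T`, everything else is `0`, and the output is empty. -/
noncomputable def inputStore {n : ℕ} (G : SimpleGraph (Fin n)) (T : Finset (Fin n)) :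
    RAM.Store where
  reg := fun x => if x = 0 then n else 0
  mem := fun a k =>
    if a = 0 then (if ∃ i j : Fin n, k = (i : ℕ) * n + (j : ℕ) ∧ G.Adj i j then 1 else 0)
    else if a = 1 then (if ∃ i : Fin n, k = (i : ℕ) ∧ i ∈ T then 1 else 0)
    else 0
  out := []

/-- A list of vertex sets as written on the output tape: the characteristic vectors (`n` bits each)
one after the other. -/
def encodeSets {n : ℕ} (L : List (Finset (Fin n))) : List ℕ :=
  L.flatMap fun S => List.ofFn fun i : Fin n => if i ∈ S then 1 else 0

/-- Program `P` on input `(G, T)` halts after at most `τ` steps, and its output lists every minimal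
`T`-connecting set of `G` exactly once, and nothing else. -/
def EnumeratesMinimalTConnecting (P : RAM.Program) {n : ℕ} (G : SimpleGraph (Fin n))
    (T : Finset (Fin n)) (τ : ℝ) : Prop :=
  ∃ (s : RAM.Store) (t : ℕ) (L : List (Finset (Fin n))),
    RAM.Runs P (inputStore G T) s t ∧ (t : ℝ) ≤ τ ∧
    s.out = encodeSets L ∧ L.Nodup ∧ ∀ S : Finset (Fin n), S ∈ L ↔ IsMinimalTConnecting G T S

/-!
Fix a terminal `r` as root. A set `S ⊇ T` is a minimal `T`-connecting set if and only if all its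
vertices can be reached from `r` inside `S` and every nonterminal of `S` separates some terminal
from `r` (`isMinimalTConnecting_iff`). The minimal sets are found by a search that grows a tree
from `r`: it scans the found vertices one after the other, and when `v` is scanned, every
neighbour of `v` about which nothing is decided is either selected, and becomes a child of `v`, or
rejected for good.

Two observations keep the search small. A selected nonterminal without a child would be a leaf of
a spanning tree of `S`, hence superfluous; so every scanned nonterminal needs a child. And as long
as a selected nonterminal `v` has no child, it is the only entrance to some terminal that is not
yet connected to `r`; these terminals are different for different `v`
(`SearchInv.exists_private_terminal`). Hence a node of the search tree with fewer waiting
terminals than vertices in need of a child can be discarded, and the difference `b` of the two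
numbers is a budget: every child beyond the one that a vertex needs anyway lowers `b` by one. At
the start, when the root needs a child, the budget is `|T| - 2`.

If a vertex with `d` undecided neighbours gets exactly one child, there are `d ≤ 3 ^ (d / 3)`
choices, and they settle `d` vertices. Extra children are accounted for by the binomial
coefficients: with `m` undecided vertices and budget `b` there are at most `growth m b = ∑ j ≤ b,
(m.choose j) * 3 ^ ((m - j) / 3)` outcomes (`firstGrowth_le_growth`,
`SearchStep.sum_potential_le`). For `m = n - |T|` and `b = |T| - 2`, where `|T| ≤ n / 3`, this is
at most `(m.choose b) * 3 ^ (m / 3)` (`growth_le_choose_mul_pow`). Every minimal set is output at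
exactly one leaf (`SearchStep.count_eq`), which proves the bound on their number
(`ncard_isMinimalTConnecting_le`).

For the algorithm, the number of nodes of the search tree is at most the bound for the number of
outcomes times a multiple of the depth (`SearchStep.sum_treeSize_le`). The program keeps a stack
of nodes that have not been visited. Visiting a node uses only loops from `0` to `n - 1`; such
loops form the language `RAM.Block`, in which every program has a total meaning and a polynomial
cost (`RAM.Block.runs_compile`, `RAM.Block.cost_le`). The visit replaces a node by its children as
the rules of the search prescribe (`RAM.visited_visit`), and the main loop enumerates the minimal
sets (`RAM.runs_loop`).
-/

/-! ### The counting function -/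

/-- The real number `3 ^ (1 / 3)`. -/
noncomputable def cubeRootThree : ℝ := (3 : ℝ) ^ ((1 : ℝ) / 3)

theorem cubeRootThree_pow_three : cubeRootThree ^ 3 = 3 := by
  rw [cubeRootThree, ← Real.rpow_natCast, ← Real.rpow_mul (by norm_num)]
  norm_num

theorem cubeRootThree_pos : 0 < cubeRootThree := by
  unfold cubeRootThree; positivity

theorem six_fifths_le_cubeRootThree : 6 / 5 ≤ cubeRootThree := by
  by_contra! h
  have h3 : cubeRootThree ^ 3 < (6 / 5) ^ 3 :=
    pow_lt_pow_left₀ h cubeRootThree_pos.le (by norm_num)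
  rw [cubeRootThree_pow_three] at h3
  norm_num at h3

theorem one_le_cubeRootThree : 1 ≤ cubeRootThree := by
  linarith [six_fifths_le_cubeRootThree]

theorem cubeRootThree_pow (m : ℕ) : cubeRootThree ^ m = (3 : ℝ) ^ ((m : ℝ) / 3) := by
  rw [cubeRootThree, ← Real.rpow_natCast, ← Real.rpow_mul (by norm_num)]
  congr 1
  ring

theorem pow_three_le_three_pow (d : ℕ) : d ^ 3 ≤ 3 ^ d := by
  rcases Nat.lt_or_ge d 3 with h | h
  · interval_cases d <;> norm_num
  · induction d, h using Nat.le_induction with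
    | base => norm_num
    | succ d hd ih =>
      calc (d + 1) ^ 3 ≤ 3 * d ^ 3 := by nlinarith [Nat.mul_le_mul hd hd]
        _ ≤ 3 * 3 ^ d := by omega
        _ = 3 ^ (d + 1) := by ring

/-- Choosing one of `d` vertices and thereby settling all of them multiplies the number of
outcomes by at most `3 ^ (1 / 3)` per settled vertex. -/
theorem le_cubeRootThree_pow (d : ℕ) : (d : ℝ) ≤ cubeRootThree ^ d := by
  have h : (d : ℝ) ^ 3 ≤ (cubeRootThree ^ d) ^ 3 := by
    rw [← pow_mul, mul_comm, pow_mul, cubeRootThree_pow_three]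
    exact_mod_cast pow_three_le_three_pow d
  exact le_of_pow_le_pow_left₀ (by norm_num) (pow_nonneg cubeRootThree_pos.le d) h

/-- `growth m b` bounds the number of outcomes of the search when `m` vertices are undecided and at
most `b` of them may still be selected at a cost. It is the sum of the coefficients of
`X ^ 0, …, X ^ b` in `(3 ^ (1 / 3) + X) ^ m`. -/
noncomputable def growth (m b : ℕ) : ℝ :=
  ∑ j ∈ Finset.range (b + 1), (m.choose j : ℝ) * cubeRootThree ^ (m - j)

/-- `mixedGrowth m e b` is like `growth m b`, with `e` further undecided vertices that are selected
at cost one or rejected, without a factor `3 ^ (1 / 3)`. -/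
noncomputable def mixedGrowth (m : ℕ) : ℕ → ℕ → ℝ
  | 0, b => growth m b
  | e + 1, 0 => mixedGrowth m e 0
  | e + 1, b + 1 => mixedGrowth m e (b + 1) + mixedGrowth m e b

/-- `firstGrowth m e b` is like `mixedGrowth m e b`, except that at least one of the `e` further
vertices has to be selected, and the first one is free. -/
noncomputable def firstGrowth (m e b : ℕ) : ℝ :=
  ∑ i ∈ Finset.range e, mixedGrowth m i b

theorem growth_nonneg (m b : ℕ) : 0 ≤ growth m b :=
  Finset.sum_nonneg fun _ _ => mul_nonneg (Nat.cast_nonneg _) (pow_nonneg cubeRootThree_pos.le _)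

theorem one_le_growth (m b : ℕ) : 1 ≤ growth m b := by
  have h : ((m.choose 0 : ℕ) : ℝ) * cubeRootThree ^ (m - 0) ≤ growth m b :=
    Finset.single_le_sum (f := fun j => (m.choose j : ℝ) * cubeRootThree ^ (m - j))
      (fun _ _ => mul_nonneg (Nat.cast_nonneg _) (pow_nonneg cubeRootThree_pos.le _)) (by simp)
  have h1 : (1 : ℝ) ≤ cubeRootThree ^ m := one_le_pow₀ one_le_cubeRootThree
  simp only [Nat.choose_zero_right, Nat.cast_one, one_mul, Nat.sub_zero] at h
  linarith

theorem growth_mono_right (m : ℕ) {b b' : ℕ} (h : b ≤ b') : growth m b ≤ growth m b' :=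
  Finset.sum_le_sum_of_subset_of_nonneg (Finset.range_mono (by omega)) fun _ _ _ =>
    mul_nonneg (Nat.cast_nonneg _) (pow_nonneg cubeRootThree_pos.le _)

theorem choose_mul_pow_sub (m j : ℕ) :
    (m.choose j : ℝ) * cubeRootThree ^ (m + 1 - j) =
      (m.choose j : ℝ) * (cubeRootThree * cubeRootThree ^ (m - j)) := by
  rcases Nat.lt_or_ge m j with h | h
  · simp [Nat.choose_eq_zero_of_lt h]
  · rw [← pow_succ', Nat.sub_add_comm h]

theorem growth_succ_zero (m : ℕ) : growth (m + 1) 0 = cubeRootThree * growth m 0 := by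
  simp [growth, pow_succ']

theorem growth_succ_succ (m b : ℕ) :
    growth (m + 1) (b + 1) = cubeRootThree * growth m (b + 1) + growth m b := by
  unfold growth
  rw [Finset.sum_range_succ', Finset.sum_range_succ' _ (b + 1)]
  have h : ∀ j : ℕ, ((m + 1).choose (j + 1) : ℝ) * cubeRootThree ^ (m + 1 - (j + 1)) =
      cubeRootThree * ((m.choose (j + 1) : ℝ) * cubeRootThree ^ (m - (j + 1))) +
        (m.choose j : ℝ) * cubeRootThree ^ (m - j) := by
    intro j
    have h2 := choose_mul_pow_sub m (j + 1)
    rw [Nat.choose_succ_succ]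
    push_cast
    rw [Nat.add_sub_add_right] at h2
    simp only [Nat.succ_eq_add_one]
    linear_combination h2
  simp only [h, Finset.sum_add_distrib, ← Finset.mul_sum, mul_add]
  simp only [Nat.choose_zero_right, Nat.cast_one, one_mul, Nat.sub_zero, pow_succ']
  ring

/-- Splitting `e` vertices off the `m + e` undecided ones. -/
theorem growth_add (m e b : ℕ) :
    growth (m + e) b =
      ∑ k ∈ Finset.range (b + 1),
        (e.choose k : ℝ) * cubeRootThree ^ (e - k) * growth m (b - k) := by
  induction e generalizing b with
  | zero =>
    rw [Finset.sum_eq_single_of_mem 0 (by simp)]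
    · simp
    · intro j _ hj
      obtain ⟨j, rfl⟩ := Nat.exists_eq_succ_of_ne_zero hj
      simp
  | succ e ih =>
    rw [← Nat.add_assoc]
    cases b with
    | zero => rw [growth_succ_zero, ih]; simp [pow_succ', mul_assoc]
    | succ b =>
      rw [growth_succ_succ, ih, ih, Finset.sum_range_succ', Finset.sum_range_succ' _ (b + 1)]
      have h : ∀ j : ℕ, ((e + 1).choose (j + 1) : ℝ) * cubeRootThree ^ (e + 1 - (j + 1)) *
            growth m (b + 1 - (j + 1)) =
          cubeRootThree * ((e.choose (j + 1) : ℝ) * cubeRootThree ^ (e - (j + 1)) *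
            growth m (b + 1 - (j + 1))) +
            (e.choose j : ℝ) * cubeRootThree ^ (e - j) * growth m (b - j) := by
        intro j
        have h2 := choose_mul_pow_sub e (j + 1)
        rw [Nat.choose_succ_succ]
        push_cast
        rw [Nat.add_sub_add_right] at h2
        simp only [Nat.succ_eq_add_one]
        linear_combination (growth m (b - j)) * h2
      simp only [h, Finset.sum_add_distrib, ← Finset.mul_sum, mul_add]
      simp only [Nat.choose_zero_right, Nat.cast_one, one_mul, Nat.sub_zero, pow_succ']
      ring

theorem mixedGrowth_eq_sum (m e b : ℕ) :
    mixedGrowth m e b = ∑ k ∈ Finset.range (b + 1), (e.choose k : ℝ) * growth m (b - k) := by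
  induction e generalizing b with
  | zero =>
    rw [Finset.sum_eq_single_of_mem 0 (by simp)]
    · simp [mixedGrowth]
    · intro j _ hj
      obtain ⟨j, rfl⟩ := Nat.exists_eq_succ_of_ne_zero hj
      simp
  | succ e ih =>
    cases b with
    | zero => simp [mixedGrowth, ih]
    | succ b =>
      rw [mixedGrowth, ih, ih, Finset.sum_range_succ', Finset.sum_range_succ' _ (b + 1)]
      simp only [Nat.choose_succ_succ, Nat.cast_add, add_mul, Finset.sum_add_distrib,
        Nat.add_sub_add_right, Nat.choose_zero_right]
      ring

theorem one_le_mixedGrowth (m e b : ℕ) : 1 ≤ mixedGrowth m e b := by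
  induction e generalizing b with
  | zero => exact one_le_growth m b
  | succ e ih =>
    cases b with
    | zero => exact ih 0
    | succ b => rw [mixedGrowth]; linarith [ih (b + 1), ih b]

theorem mixedGrowth_mono_right (m e : ℕ) {b b' : ℕ} (h : b ≤ b') :
    mixedGrowth m e b ≤ mixedGrowth m e b' := by
  induction e generalizing b b' with
  | zero => exact growth_mono_right m h
  | succ e ih =>
    rcases b with _ | b <;> rcases b' with _ | b'
    · exact le_rfl
    · rw [mixedGrowth, mixedGrowth]
      linarith [ih (Nat.zero_le (b' + 1)), one_le_mixedGrowth m e b']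
    · omega
    · rw [mixedGrowth, mixedGrowth]
      linarith [ih h, ih (Nat.le_of_succ_le_succ h)]

theorem mixedGrowth_le_growth (m e b : ℕ) : mixedGrowth m e b ≤ growth (m + e) b := by
  rw [mixedGrowth_eq_sum, growth_add]
  refine Finset.sum_le_sum fun k _ => mul_le_mul_of_nonneg_right ?_ (growth_nonneg _ _)
  exact le_mul_of_one_le_right (Nat.cast_nonneg _) (one_le_pow₀ one_le_cubeRootThree)

theorem sum_range_choose_right (e k : ℕ) :
    ∑ i ∈ Finset.range e, i.choose k = e.choose (k + 1) := by
  induction e with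
  | zero => simp
  | succ e ih => rw [Finset.sum_range_succ, ih, Nat.choose_succ_succ, Nat.add_comm]

/-- The one place where the base `3 ^ (1 / 3)` is needed: a vertex with `e` undecided neighbours
at least one of which is selected. -/
theorem firstGrowth_le_growth (m e b : ℕ) : firstGrowth m e b ≤ growth (m + e) b := by
  unfold firstGrowth
  simp only [mixedGrowth_eq_sum]
  rw [Finset.sum_comm, growth_add]
  refine Finset.sum_le_sum fun k _ => ?_
  rw [← Finset.sum_mul]
  refine mul_le_mul_of_nonneg_right ?_ (growth_nonneg _ _)
  have h1 : ∑ i ∈ Finset.range e, i.choose k = e.choose (k + 1) := sum_range_choose_right e k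
  have h2 : e.choose (k + 1) ≤ e.choose k * (e - k) := by
    calc e.choose (k + 1) ≤ e.choose (k + 1) * (k + 1) := Nat.le_mul_of_pos_right _ (by omega)
      _ = _ := Nat.choose_succ_right_eq e k
  calc (∑ i ∈ Finset.range e, (i.choose k : ℝ)) = (e.choose (k + 1) : ℝ) := by
        rw [← h1]; push_cast; rfl
    _ ≤ (e.choose k : ℝ) * ((e - k : ℕ) : ℝ) := by exact_mod_cast h2
    _ ≤ _ := mul_le_mul_of_nonneg_left (le_cubeRootThree_pow _) (Nat.cast_nonneg _)

theorem firstGrowth_succ (m e b : ℕ) :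
    firstGrowth m (e + 1) b = firstGrowth m e b + mixedGrowth m e b :=
  Finset.sum_range_succ _ _

theorem firstGrowth_nonneg (m e b : ℕ) : 0 ≤ firstGrowth m e b :=
  Finset.sum_nonneg fun _ _ => zero_le_one.trans (one_le_mixedGrowth _ _ _)

/-- When `k` is well below `m / 2`, the last term dominates the sum `growth m k`. -/
theorem growth_le_choose_mul_pow {m k : ℕ} (h : 2 * k + 4 ≤ m) :
    growth m k ≤ (m.choose k : ℝ) * cubeRootThree ^ m := by
  induction k with
  | zero => simp [growth]
  | succ k ih =>
    have hrec : growth m (k + 1) =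
        growth m k + (m.choose (k + 1) : ℝ) * cubeRootThree ^ (m - (k + 1)) :=
      Finset.sum_range_succ _ _
    have ih := ih (by omega)
    have hm : (m.choose (k + 1) : ℝ) * (k + 1) = (m.choose k : ℝ) * ((m - k : ℕ) : ℝ) := by
      exact_mod_cast Nat.choose_succ_right_eq m k
    have hk : (k : ℝ) + 6 ≤ ((m - k : ℕ) : ℝ) := by
      have : k + 6 ≤ m - k := by omega
      exact_mod_cast this
    have hpow : cubeRootThree ^ m = cubeRootThree ^ (k + 1) * cubeRootThree ^ (m - (k + 1)) := by
      rw [← pow_add]; congr 1; omega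
    -- Bernoulli's inequality for `(6 / 5) ^ (k + 1)`
    have hb : ((k : ℝ) + 6) / 5 ≤ cubeRootThree ^ (k + 1) := by
      have h1 : 1 + ((k + 1 : ℕ) : ℝ) * (1 / 5) ≤ (1 + 1 / 5 : ℝ) ^ (k + 1) :=
        one_add_mul_le_pow (by norm_num) _
      have h2 : (1 + 1 / 5 : ℝ) ^ (k + 1) ≤ cubeRootThree ^ (k + 1) :=
        pow_le_pow_left₀ (by norm_num) (by linarith [six_fifths_le_cubeRootThree]) _
      push_cast at h1
      linarith
    set C := (m.choose k : ℝ)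
    set C' := (m.choose (k + 1) : ℝ)
    set p := cubeRootThree ^ (m - (k + 1))
    set q := cubeRootThree ^ (k + 1)
    have hp : 0 < p := pow_pos cubeRootThree_pos _
    have hC' : 0 ≤ C' := Nat.cast_nonneg _
    have hC : 0 ≤ C := Nat.cast_nonneg _
    have hCC : C * (k + 6) ≤ C' * (k + 1) := by
      rw [hm]; exact mul_le_mul_of_nonneg_left hk hC
    have hq : 0 ≤ q := (pow_pos cubeRootThree_pos _).le
    rw [hrec]
    rw [hpow] at ih ⊢
    have hk6 : (0 : ℝ) < k + 6 := by positivity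
    have key : C * q * (k + 6) + C' * (k + 6) ≤ C' * q * (k + 6) := by
      have e1 : C * (k + 6) * q ≤ C' * (k + 1) * q := mul_le_mul_of_nonneg_right hCC hq
      have e2 : C' * ((k + 6) / 5) ≤ C' * q := mul_le_mul_of_nonneg_left hb hC'
      nlinarith
    have key2 : C * q + C' ≤ C' * q := by
      have : (C * q + C') * (k + 6) ≤ (C' * q) * (k + 6) := by linarith
      exact le_of_mul_le_mul_right this hk6
    calc growth m k + C' * p ≤ C * (q * p) + C' * p := by linarith
      _ = (C * q + C') * p := by ring
      _ ≤ (C' * q) * p := mul_le_mul_of_nonneg_right key2 hp.le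
      _ = _ := by ring

/-! ### Reachability inside a vertex set -/

/-- `Reaches G X a b`: there is a walk from `a` to `b` in `G` all of whose vertices after the
starting vertex `a` satisfy `X`. -/
def Reaches {V : Type*} (G : SimpleGraph V) (X : V → Prop) : V → V → Prop :=
  Relation.ReflTransGen fun x y => G.Adj x y ∧ X y

section Reachability

variable {V : Type*} {G : SimpleGraph V} {X Y : V → Prop} {a b c : V}

theorem Reaches.refl (G : SimpleGraph V) (X : V → Prop) (a : V) : Reaches G X a a :=
  Relation.ReflTransGen.refl

theorem Reaches.trans (h : Reaches G X a b) (h' : Reaches G X b c) : Reaches G X a c :=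
  Relation.ReflTransGen.trans h h'

theorem Reaches.mono (hXY : ∀ v, X v → Y v) (h : Reaches G X a b) : Reaches G Y a b := by
  induction h with
  | refl => exact Relation.ReflTransGen.refl
  | tail _ h ih => exact ih.tail ⟨h.1, hXY _ h.2⟩

theorem Reaches.tail (h : Reaches G X a b) (hbc : G.Adj b c) (hc : X c) : Reaches G X a c :=
  Relation.ReflTransGen.tail h ⟨hbc, hc⟩

theorem Reaches.target (ha : X a) (h : Reaches G X a b) : X b := by
  induction h with
  | refl => exact ha
  | tail _ h _ => exact h.2

theorem induce_preconnected_iff {S : Finset V} {r : V} (hr : r ∈ S) :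
    (G.induce (S : Set V)).Preconnected ↔ ∀ v ∈ S, Reaches G (· ∈ S) r v := by
  constructor
  · intro h v hv
    have h1 := h ⟨r, hr⟩ ⟨v, hv⟩
    rw [SimpleGraph.reachable_iff_reflTransGen] at h1
    have key : ∀ w : (S : Set V), Relation.ReflTransGen (G.induce (S : Set V)).Adj ⟨r, hr⟩ w →
        Reaches G (· ∈ S) r w := by
      intro w hw
      induction hw with
      | refl => exact Relation.ReflTransGen.refl
      | @tail b c _ h ih => exact Reaches.tail ih (SimpleGraph.induce_adj.1 h) c.2
    exact key _ h1
  · intro h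
    have key : ∀ v, ∀ hv : Reaches G (· ∈ S) r v, ∀ hvS : v ∈ S,
        (G.induce (S : Set V)).Reachable ⟨r, hr⟩ ⟨v, hvS⟩ := by
      intro v hv
      induction hv with
      | refl => intro _; exact SimpleGraph.Reachable.refl _
      | @tail b c hb h ih =>
        intro hc
        have hbS : b ∈ S := Reaches.target (X := (· ∈ S)) hr hb
        have hadj : (G.induce (S : Set V)).Adj ⟨b, hbS⟩ ⟨c, hc⟩ := h.1
        exact (ih hbS).trans hadj.reachable
    intro x y
    exact (key x (h x x.2) x.2).symm.trans (key y (h y y.2) y.2)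

/-- A `T`-connecting set is minimal if and only if the removal of any single nonterminal separates
some terminal from the terminal `r`. -/
theorem isMinimalTConnecting_iff [DecidableEq V] {T S : Finset V} {r : V} (hr : r ∈ T) :
    IsMinimalTConnecting G T S ↔ T ⊆ S ∧ (∀ v ∈ S, Reaches G (· ∈ S) r v) ∧
      ∀ v ∈ S, v ∉ T → ¬ ∀ t ∈ T, Reaches G (fun x => x ∈ S ∧ x ≠ v) r t := by
  classical
  constructor
  · rintro ⟨⟨hTS, hconn⟩, hmin⟩
    refine ⟨hTS, (induce_preconnected_iff (hTS hr)).1 hconn, ?_⟩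
    intro v hvS hvT h
    have hrv : r ∈ S ∧ r ≠ v := ⟨hTS hr, fun e => hvT (e ▸ hr)⟩
    set S' := S.filter fun w => Reaches G (fun x => x ∈ S ∧ x ≠ v) r w with hS'
    have hmem : ∀ w, w ∈ S' ↔ Reaches G (fun x => x ∈ S ∧ x ≠ v) r w := by
      intro w
      rw [hS', Finset.mem_filter]
      exact ⟨And.right, fun hw => ⟨(Reaches.target (X := fun x => x ∈ S ∧ x ≠ v) hrv hw).1, hw⟩⟩
    refine hmin S' ?_ ⟨fun t ht => (hmem t).2 (h t ht), ?_⟩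
    · refine Finset.ssubset_iff_subset_ne.2 ⟨Finset.filter_subset _ _, fun e => ?_⟩
      have hv : v ∈ S' := e ▸ hvS
      exact (Reaches.target (X := fun x => x ∈ S ∧ x ≠ v) hrv ((hmem v).1 hv)).2 rfl
    · rw [induce_preconnected_iff ((hmem r).2 (Reaches.refl _ _ _))]
      intro w hw
      have hw := (hmem w).1 hw
      induction hw with
      | refl => exact Reaches.refl _ _ _
      | @tail b c hb h ih =>
        exact (ih ((hmem b).2 hb)).tail h.1 ((hmem c).2 (hb.tail h))
  · rintro ⟨hTS, hconn, hmin⟩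
    refine ⟨⟨hTS, (induce_preconnected_iff (hTS hr)).2 hconn⟩, ?_⟩
    rintro S' hS' ⟨hTS', hconn'⟩
    obtain ⟨v, hvS, hvS'⟩ := Finset.exists_of_ssubset hS'
    refine hmin v hvS (fun hvT => hvS' (hTS' hvT)) fun t ht => ?_
    exact ((induce_preconnected_iff (hTS' hr)).1 hconn' t (hTS' ht)).mono
      fun x hx => ⟨hS'.subset hx, fun e => hvS' (e ▸ hx)⟩

end Reachability

/-! ### The search tree -/

/-- The labels that the search gives to vertices. The labels from `pending` on are those of the
vertices that are already known to be connected to the root. -/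
inductive Status : Type
  /-- a nonterminal about which nothing is decided -/
  | free
  /-- a nonterminal that was rejected -/
  | excluded
  /-- a terminal that is not yet connected to the root -/
  | waiting
  /-- a selected nonterminal whose neighbours have not been scanned -/
  | pending
  /-- a terminal connected to the root whose neighbours have not been scanned -/
  | met
  /-- the vertex being scanned, which still needs a child -/
  | seeking
  /-- the vertex being scanned, which needs no further child -/
  | served
  /-- a vertex all of whose neighbours have been decided -/
  | done
  deriving DecidableEq

/-- The label of a vertex connected to the root. -/
def Status.Found : Status → Prop
  | free | excluded | waiting => False
  | _ => True

/-- The label of a vertex that still needs a child in the search tree, since otherwise it would be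
superfluous in the selected set. -/
def Status.Needy : Status → Prop
  | pending | seeking => True
  | _ => False

/-- The label of the vertex being scanned. -/
def Status.Active : Status → Prop
  | seeking | served => True
  | _ => False

instance : DecidablePred Status.Found := fun s => by
  cases s <;> unfold Status.Found <;> infer_instance

instance : DecidablePred Status.Needy := fun s => by
  cases s <;> unfold Status.Needy <;> infer_instance

instance : DecidablePred Status.Active := fun s => by
  cases s <;> unfold Status.Active <;> infer_instance

/-- An upper bound for the number of times that the label of a vertex can still change. -/
def Status.rank : Status → ℕ
  | free => 4
  | waiting | pending => 3
  | met | seeking => 2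
  | served => 1
  | excluded | done => 0

set_option linter.unusedSectionVars false

section Search

variable {V : Type*} [Fintype V] [DecidableEq V]

/-- The vertices connected to the root. -/
def foundSet (σ : V → Status) : Finset V := Finset.univ.filter fun v => (σ v).Found

/-- The terminals that are not yet connected to the root. -/
abbrev waitingSet (σ : V → Status) : Finset V := Finset.univ.filter fun v => σ v = .waiting

/-- The vertices in need of a child. -/
abbrev needySet (σ : V → Status) : Finset V := Finset.univ.filter fun v => (σ v).Needy

/-- One node of the search tree. `SearchStep G T r σ cs out` says that the node labelled `σ` may
have the list of children `cs` and may contribute the list `out` to the enumeration. The scan of a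
vertex `v` connects all terminals next to `v` first and then decides the undecided neighbours of `v`
one by one. A node is given up when fewer terminals wait than vertices need a child. -/
inductive SearchStep (G : SimpleGraph V) (T : Finset V) (r : V) (σ : V → Status) :
    List (V → Status) → List (Finset V) → Prop
  | hopeless : (waitingSet σ).card < (needySet σ).card → SearchStep G T r σ [] []
  | meet (v u : V) : (needySet σ).card ≤ (waitingSet σ).card →
      (σ v).Active → G.Adj v u → σ u = .waiting →
      SearchStep G T r σ [Function.update (Function.update σ u .met) v .served] []
  | branch (v u : V) : (needySet σ).card ≤ (waitingSet σ).card →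
      (σ v).Active → (∀ w, G.Adj v w → σ w ≠ .waiting) → G.Adj v u → σ u = .free →
      SearchStep G T r σ [Function.update (Function.update σ u .pending) v .served,
        Function.update σ u .excluded] []
  | stuck (v : V) : σ v = .seeking → (∀ w, G.Adj v w → σ w ≠ .waiting ∧ σ w ≠ .free) →
      SearchStep G T r σ [] []
  | close (v : V) : (needySet σ).card ≤ (waitingSet σ).card →
      σ v = .served → (∀ w, G.Adj v w → σ w ≠ .waiting ∧ σ w ≠ .free) →
      SearchStep G T r σ [Function.update σ v .done] []
  | scanPending (v : V) : (needySet σ).card ≤ (waitingSet σ).card →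
      (∀ w, ¬ (σ w).Active) → σ v = .pending →
      SearchStep G T r σ [Function.update σ v .seeking] []
  | scanMet (v : V) : (needySet σ).card ≤ (waitingSet σ).card →
      (∀ w, ¬ (σ w).Active) → σ v = .met →
      SearchStep G T r σ [Function.update σ v .served] []
  | unreachable (v : V) : (∀ w, (σ w).Found → σ w = .done) → σ v = .waiting →
      SearchStep G T r σ [] []
  | reject (v : V) : (∀ w, (σ w).Found → σ w = .done) → (∀ w, σ w ≠ .waiting) →
      σ v = .done → v ∉ T → (∀ t ∈ T, Reaches G (fun x => x ∈ foundSet σ ∧ x ≠ v) r t) →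
      SearchStep G T r σ [] []
  | accept : (∀ w, (σ w).Found → σ w = .done) → (∀ w, σ w ≠ .waiting) →
      (∀ v, σ v = .done → v ∉ T →
        ¬ ∀ t ∈ T, Reaches G (fun x => x ∈ foundSet σ ∧ x ≠ v) r t) →
      SearchStep G T r σ [] [foundSet σ]

/-- The invariant of the search. By `needy_conn`, removing a vertex in need of a child does not
disconnect the found vertices. The root is in need of a child only as long as it is the only found
vertex. -/
structure SearchInv (G : SimpleGraph V) (T : Finset V) (r : V) (σ : V → Status) : Prop where
  root : (σ r).Found
  terminal : ∀ v ∈ T, (σ v).Found ∨ σ v = .waiting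
  waiting : ∀ v, σ v = .waiting → v ∈ T
  needy_notMem : ∀ v, (σ v).Needy → v ≠ r → v ∉ T
  needy_root : (σ r).Needy → ∀ v, (σ v).Found → v = r
  conn : ∀ v, (σ v).Found → Reaches G (fun x => (σ x).Found) r v
  needy_conn : ∀ v, (σ v).Needy → v ≠ r → ∀ w, (σ w).Found → w ≠ v →
    Reaches G (fun x => (σ x).Found ∧ x ≠ v) r w
  active_unique : ∀ v w, (σ v).Active → (σ w).Active → v = w
  done : ∀ v, σ v = .done → ∀ u, G.Adj v u → σ u ≠ .waiting ∧ σ u ≠ .free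

/-- `S` agrees with the decisions recorded in `σ`. -/
def Agrees (σ : V → Status) (S : Finset V) : Prop :=
  ∀ v, ((σ v).Found → v ∈ S) ∧ (σ v = .excluded → v ∉ S)

variable {G : SimpleGraph V} {T : Finset V} {r : V} {σ : V → Status}

theorem Status.Needy.found {s : Status} (h : s.Needy) : s.Found := by
  cases s <;> simp_all [Status.Found, Status.Needy]

theorem Status.Active.found {s : Status} (h : s.Active) : s.Found := by
  cases s <;> simp_all [Status.Found, Status.Active]

/-- Relabelling without changing the set of found vertices. -/
theorem SearchInv.relabel (h : SearchInv G T r σ) {σ' : V → Status}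
    (hfound : ∀ v, (σ' v).Found ↔ (σ v).Found)
    (hwaiting : ∀ v, σ' v = .waiting ↔ σ v = .waiting)
    (hneedy : ∀ v, (σ' v).Needy → (σ v).Needy)
    (hactive : ∀ v w, (σ' v).Active → (σ' w).Active → v = w)
    (hdone : ∀ v, σ' v = .done → ∀ u, G.Adj v u → σ' u ≠ .waiting ∧ σ' u ≠ .free) :
    SearchInv G T r σ' where
  root := (hfound r).2 h.root
  terminal v hv := by rw [hfound, hwaiting]; exact h.terminal v hv
  waiting v hv := h.waiting v ((hwaiting v).1 hv)
  needy_notMem v hv := h.needy_notMem v (hneedy v hv)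
  needy_root hr v hv := h.needy_root (hneedy r hr) v ((hfound v).1 hv)
  conn v hv := by simp only [hfound]; exact h.conn v ((hfound v).1 hv)
  needy_conn v hv hvr w hw hwv := by
    simp only [hfound]; exact h.needy_conn v (hneedy v hv) hvr w ((hfound w).1 hw) hwv
  active_unique := hactive
  done := hdone

/-- Attaching a new vertex `u` to the vertex `v` being scanned. -/
theorem SearchInv.attach (h : SearchInv G T r σ) {v u : V} {s : Status} (hv : (σ v).Active)
    (hvu : G.Adj v u) (hu : σ u = .waiting ∧ s = .met ∨ σ u = .free ∧ s = .pending) :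
    SearchInv G T r (Function.update (Function.update σ u s) v .served) := by
  have huv : u ≠ v := hvu.ne'
  have hnf : ¬ (σ u).Found := by
    rcases hu with hu | hu <;> simp [hu, Status.Found]
  have hsf : s.Found := by
    rcases hu with hu | hu <;> simp [hu, Status.Found]
  have hur : u ≠ r := fun e => hnf (e ▸ h.root)
  have hvf := hv.found
  set σ' := Function.update (Function.update σ u s) v .served with hσ'
  have e1 : σ' v = .served := by simp [hσ']
  have e2 : σ' u = s := by simp [hσ', huv]
  have e3 : ∀ w, w ≠ u → w ≠ v → σ' w = σ w := by intro w h1 h2; simp [hσ', h1, h2]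
  have hfound : ∀ w, (σ' w).Found ↔ (σ w).Found ∨ w = u := by
    intro w
    rcases eq_or_ne w v with rfl | hwv
    · simp only [e1, hvf, true_or, iff_true]; trivial
    rcases eq_or_ne w u with rfl | hwu
    · simp [e2, hsf]
    · simp [e3 w hwu hwv, hwu]
  have hneedy : ∀ w, (σ' w).Needy → w ≠ v ∧ ((σ w).Needy ∧ w ≠ u ∨ w = u ∧ s = .pending) := by
    intro w hw
    rcases eq_or_ne w v with rfl | hwv
    · simp [e1, Status.Needy] at hw
    rcases eq_or_ne w u with rfl | hwu
    · rw [e2] at hw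
      rcases hu with hu | hu
      · simp [hu, Status.Needy] at hw
      · exact ⟨hwv, Or.inr ⟨rfl, hu.2⟩⟩
    · rw [e3 w hwu hwv] at hw; exact ⟨hwv, Or.inl ⟨hw, hwu⟩⟩
  have hwaiting : ∀ w, σ' w = .waiting → σ w = .waiting := by
    intro w hw
    rcases eq_or_ne w v with rfl | hwv
    · simp [e1] at hw
    rcases eq_or_ne w u with rfl | hwu
    · rw [e2] at hw; rw [hw] at hsf; exact hsf.elim
    · rwa [e3 w hwu hwv] at hw
  have hconn : ∀ w, (σ' w).Found → Reaches G (fun x => (σ' x).Found) r w := by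
    have h1 : ∀ w, (σ w).Found → Reaches G (fun x => (σ' x).Found) r w := fun w hw =>
      (h.conn w hw).mono fun x hx => (hfound x).2 (Or.inl hx)
    intro w hw
    rcases (hfound w).1 hw with hw | rfl
    · exact h1 w hw
    · exact (h1 v hvf).tail hvu ((hfound w).2 (Or.inr rfl))
  refine ⟨(hfound r).2 (Or.inl h.root), ?_, ?_, ?_, ?_, hconn, ?_, ?_, ?_⟩
  · intro w hw
    rcases h.terminal w hw with h1 | h1
    · exact Or.inl ((hfound w).2 (Or.inl h1))
    · rcases eq_or_ne w u with rfl | hwu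
      · exact Or.inl ((hfound w).2 (Or.inr rfl))
      · refine Or.inr ?_
        rw [e3 w hwu]
        · exact h1
        · rintro rfl; rw [h1] at hvf; exact hvf
  · exact fun w hw => h.waiting w (hwaiting w hw)
  · intro w hw hwr
    obtain ⟨-, h1 | ⟨rfl, rfl⟩⟩ := hneedy w hw
    · exact h.needy_notMem w h1.1 hwr
    · intro hT
      rcases h.terminal w hT with h2 | h2
      · exact hnf h2
      · rcases hu with hu | hu
        · exact absurd hu.2 (by simp)
        · rw [hu.1] at h2; exact absurd h2 (by simp)
  · intro hr
    obtain ⟨hrv, h1 | h1⟩ := hneedy r hr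
    · exact absurd (h.needy_root h1.1 v hvf).symm hrv
    · exact absurd h1.1.symm hur
  · intro w hw hwr x hx hxw
    obtain ⟨hwv, h1 | ⟨rfl, rfl⟩⟩ := hneedy w hw
    · have h2 : ∀ y, (σ y).Found → y ≠ w →
          Reaches G (fun x => (σ' x).Found ∧ x ≠ w) r y := fun y hy hyw =>
        (h.needy_conn w h1.1 hwr y hy hyw).mono fun z hz => ⟨(hfound z).2 (Or.inl hz.1), hz.2⟩
      rcases (hfound x).1 hx with hx | rfl
      · exact h2 x hx hxw
      · exact (h2 v hvf hwv.symm).tail hvu ⟨(hfound x).2 (Or.inr rfl), hxw⟩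
    · have hx : (σ x).Found := ((hfound x).1 hx).resolve_right hxw
      refine (h.conn x hx).mono fun z hz => ⟨(hfound z).2 (Or.inl hz), ?_⟩
      rintro rfl
      exact hnf hz
  · have hact : ∀ w, (σ' w).Active → w = v := by
      intro w hw
      rcases eq_or_ne w v with rfl | hwv
      · rfl
      rcases eq_or_ne w u with rfl | hwu
      · rw [e2] at hw
        rcases hu with hu | hu <;> simp [hu, Status.Active] at hw
      · rw [e3 w hwu hwv] at hw; exact h.active_unique w v hw hv
    intro w x hw hx
    rw [hact w hw, hact x hx]
  · intro w hw x hwx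
    have hwv : w ≠ v := by rintro rfl; simp [e1] at hw
    have hwu : w ≠ u := by
      rintro rfl
      rw [e2] at hw
      rcases hu with hu | hu <;> simp [hu] at hw
    rw [e3 w hwu hwv] at hw
    rcases eq_or_ne x v with rfl | hxv
    · simp [e1]
    rcases eq_or_ne x u with rfl | hxu
    · rw [e2]; rcases hu with hu | hu <;> simp [hu]
    · rw [e3 x hxu hxv]; exact h.done w hw x hwx

theorem SearchInv.exclude (h : SearchInv G T r σ) {u : V} (hu : σ u = .free) :
    SearchInv G T r (Function.update σ u .excluded) := by
  have e : ∀ w, w ≠ u → Function.update σ u .excluded w = σ w := fun w hw => by simp [hw]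
  have e0 : Function.update σ u .excluded u = .excluded := by simp
  refine h.relabel ?_ ?_ ?_ ?_ ?_
  · intro w; rcases eq_or_ne w u with rfl | hw
    · simp [hu, Status.Found]
    · rw [e w hw]
  · intro w; rcases eq_or_ne w u with rfl | hw
    · simp [hu]
    · rw [e w hw]
  · intro w; rcases eq_or_ne w u with rfl | hw
    · simp [Status.Needy]
    · rw [e w hw]; exact id
  · have : ∀ w, (Function.update σ u .excluded w).Active → (σ w).Active := by
      intro w; rcases eq_or_ne w u with rfl | hw
      · simp [Status.Active]
      · rw [e w hw]; exact id
    exact fun v w hv hw => h.active_unique v w (this v hv) (this w hw)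
  · intro v hv w hvw
    rcases eq_or_ne w u with rfl | hw
    · simp
    rw [e w hw]
    refine h.done v ?_ w hvw
    rcases eq_or_ne v u with rfl | hv'
    · simp at hv
    · rwa [e v hv'] at hv

theorem SearchInv.scan (h : SearchInv G T r σ) {v : V} {s : Status} (hσ : ∀ w, ¬ (σ w).Active)
    (hv : σ v = .pending ∧ s = .seeking ∨ σ v = .met ∧ s = .served) :
    SearchInv G T r (Function.update σ v s) := by
  have e : ∀ w, w ≠ v → Function.update σ v s w = σ w := fun w hw => by simp [hw]
  refine h.relabel ?_ ?_ ?_ ?_ ?_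
  · intro w; rcases eq_or_ne w v with rfl | hw
    · rcases hv with hv | hv <;> simp [hv, Status.Found]
    · rw [e w hw]
  · intro w; rcases eq_or_ne w v with rfl | hw
    · rcases hv with hv | hv <;> simp [hv]
    · rw [e w hw]
  · intro w; rcases eq_or_ne w v with rfl | hw
    · rcases hv with hv | hv <;> simp [hv, Status.Needy]
    · rw [e w hw]; exact id
  · have : ∀ w, (Function.update σ v s w).Active → w = v := by
      intro w; rcases eq_or_ne w v with rfl | hw
      · simp
      · rw [e w hw]; exact fun h => (hσ w h).elim
    exact fun x w hx hw => (this x hx).trans (this w hw).symm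
  · intro x hx w hxw
    have hxv : x ≠ v := by
      rintro rfl
      rcases hv with hv | hv <;> simp [hv] at hx
    rw [e x hxv] at hx
    rcases eq_or_ne w v with rfl | hw
    · rcases hv with hv | hv <;> simp [hv]
    · rw [e w hw]; exact h.done x hx w hxw

theorem SearchInv.close (h : SearchInv G T r σ) {v : V} (hv : σ v = .served)
    (hw : ∀ w, G.Adj v w → σ w ≠ .waiting ∧ σ w ≠ .free) :
    SearchInv G T r (Function.update σ v .done) := by
  have e : ∀ w, w ≠ v → Function.update σ v .done w = σ w := fun w hw => by simp [hw]
  refine h.relabel ?_ ?_ ?_ ?_ ?_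
  · intro w; rcases eq_or_ne w v with rfl | hw
    · simp [hv, Status.Found]
    · rw [e w hw]
  · intro w; rcases eq_or_ne w v with rfl | hw
    · simp [hv]
    · rw [e w hw]
  · intro w; rcases eq_or_ne w v with rfl | hw
    · simp [Status.Needy]
    · rw [e w hw]; exact id
  · have : ∀ w, (Function.update σ v .done w).Active → (σ w).Active := by
      intro w; rcases eq_or_ne w v with rfl | hw
      · simp [Status.Active]
      · rw [e w hw]; exact id
    exact fun x w hx hw => h.active_unique x w (this x hx) (this w hw)
  · intro x hx w hxw
    rcases eq_or_ne w v with rfl | hwv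
    · simp
    rw [e w hwv]
    rcases eq_or_ne x v with rfl | hxv
    · exact hw w hxw
    · rw [e x hxv] at hx; exact h.done x hx w hxw

theorem SearchStep.searchInv {cs : List (V → Status)} {out : List (Finset V)}
    (hs : SearchStep G T r σ cs out) (h : SearchInv G T r σ) : ∀ c ∈ cs, SearchInv G T r c := by
  cases hs with
  | meet v u _ hv hvu hu =>
    simpa using h.attach hv hvu (Or.inl ⟨hu, rfl⟩)
  | branch v u _ hv hw hvu hu =>
    simpa using ⟨h.attach hv hvu (Or.inr ⟨hu, rfl⟩), h.exclude hu⟩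
  | close v _ hv hw => simpa using h.close hv hw
  | scanPending v _ hn hv => simpa using h.scan hn (Or.inl ⟨hv, rfl⟩)
  | scanMet v _ hn hv => simpa using h.scan hn (Or.inr ⟨hv, rfl⟩)
  | _ => simp

/-! ### No minimal set is lost -/

/-- The last found vertex `x` on a walk from the root to a waiting terminal `t`. -/
theorem SearchInv.exists_last_found (h : SearchInv G T r σ) {S : Finset V}
    (hS : ∀ v ∈ S, Reaches G (· ∈ S) r v) {t : V} (htS : t ∈ S) (ht : ¬ (σ t).Found) :
    ∃ x, (σ x).Found ∧ Reaches G (fun y => y ∈ S ∧ ¬ (σ y).Found) x t := by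
  have key : ∀ y, Reaches G (· ∈ S) y t →
      (∃ x, (σ x).Found ∧ Reaches G (fun y => y ∈ S ∧ ¬ (σ y).Found) x t) ∨
        ¬ (σ y).Found ∧ Reaches G (fun y => y ∈ S ∧ ¬ (σ y).Found) y t := by
    intro y hy
    induction hy using Relation.ReflTransGen.head_induction_on with
    | refl => exact Or.inr ⟨ht, Reaches.refl _ _ _⟩
    | @head a c hac hc ih =>
      rcases ih with ih | ⟨ih1, ih2⟩
      · exact Or.inl ih
      have h1 : Reaches G (fun y => y ∈ S ∧ ¬ (σ y).Found) a t :=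
        Relation.ReflTransGen.head ⟨hac.1, hac.2, ih1⟩ ih2
      by_cases ha : (σ a).Found
      · exact Or.inl ⟨a, ha, h1⟩
      · exact Or.inr ⟨ha, h1⟩
  rcases key r (hS t htS) with h1 | h1
  · exact h1
  · exact absurd h.root h1.1

/-- A vertex `v` in need of a child is the only entrance to some waiting terminal: otherwise all
terminals could be reached without `v`, and the selected set would not be minimal. -/
theorem SearchInv.exists_private_terminal (h : SearchInv G T r σ) (hr : r ∈ T) (hT : 2 ≤ T.card)
    {S : Finset V} (hS : IsMinimalTConnecting G T S) (hσS : Agrees σ S) {v : V}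
    (hv : (σ v).Needy) :
    ∃ t, σ t = .waiting ∧ ∀ x, (σ x).Found →
      Reaches G (fun y => y ∈ S ∧ ¬ (σ y).Found) x t → x = v := by
  obtain ⟨hTS, hconn, hmin⟩ := (isMinimalTConnecting_iff hr).1 hS
  rcases eq_or_ne v r with rfl | hvr
  · obtain ⟨t, ht, htv⟩ := Finset.exists_mem_ne hT v
    refine ⟨t, (h.terminal t ht).resolve_left fun hf => htv (h.needy_root hv t hf), ?_⟩
    exact fun x hx _ => h.needy_root hv x hx
  · by_contra! hcon
    refine hmin v ((hσS v).1 hv.found) (h.needy_notMem v hv hvr) fun t ht => ?_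
    have hD : ∀ w, (σ w).Found → w ≠ v → Reaches G (fun x => x ∈ S ∧ x ≠ v) r w := fun w hw hwv =>
      (h.needy_conn v hv hvr w hw hwv).mono fun x hx => ⟨(hσS x).1 hx.1, hx.2⟩
    rcases h.terminal t ht with hf | hw
    · exact hD t hf fun e => h.needy_notMem v hv hvr (e ▸ ht)
    · obtain ⟨x, hxf, hxt, hxv⟩ := hcon t hw
      refine (hD x hxf hxv).trans (hxt.mono fun y hy => ⟨hy.1, ?_⟩)
      rintro rfl
      exact hy.2 hv.found

theorem SearchInv.card_needy_le (h : SearchInv G T r σ) (hr : r ∈ T) (hT : 2 ≤ T.card)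
    {S : Finset V} (hS : IsMinimalTConnecting G T S) (hσS : Agrees σ S) :
    (needySet σ).card ≤ (waitingSet σ).card := by
  classical
  obtain ⟨hTS, hconn, hmin⟩ := (isMinimalTConnecting_iff hr).1 hS
  have hp := fun (v : V) (hv : (σ v).Needy) => h.exists_private_terminal hr hT hS hσS hv
  choose! f hf using hp
  refine Finset.card_le_card_of_injOn f ?_ ?_
  · intro v hv
    simp only [Finset.coe_filter, Finset.mem_univ, true_and, Set.mem_ofPred_eq] at hv ⊢
    exact (hf v hv).1
  · intro v hv w hw hvw
    simp only [Finset.coe_filter, Finset.mem_univ, true_and, Set.mem_ofPred_eq] at hv hw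
    have ht := (hf v hv).1
    obtain ⟨x, hx, hxt⟩ := h.exists_last_found hconn (hTS (h.waiting _ ht))
      (by rw [ht]; exact id)
    rw [← (hf v hv).2 x hx hxt, (hf w hw).2 x hx (hvw ▸ hxt)]

theorem SearchInv.not_stuck (h : SearchInv G T r σ) (hr : r ∈ T) (hT : 2 ≤ T.card)
    {S : Finset V} (hS : IsMinimalTConnecting G T S) (hσS : Agrees σ S) {v : V}
    (hv : σ v = .seeking) : ∃ w, G.Adj v w ∧ (σ w = .waiting ∨ σ w = .free) := by
  obtain ⟨hTS, hconn, hmin⟩ := (isMinimalTConnecting_iff hr).1 hS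
  obtain ⟨t, ht, hx⟩ := h.exists_private_terminal hr hT hS hσS (v := v) (by simp [hv, Status.Needy])
  have hnf : ¬ (σ t).Found := by rw [ht]; exact id
  obtain ⟨x, hxf, hxt⟩ := h.exists_last_found hconn (hTS (h.waiting _ ht)) hnf
  obtain rfl := hx x hxf hxt
  rcases Relation.ReflTransGen.cases_head hxt with rfl | ⟨w, hw, -⟩
  · exact absurd hxf hnf
  · refine ⟨w, hw.1, ?_⟩
    have h1 : ¬ (σ w).Found := hw.2.2
    have h2 : σ w ≠ .excluded := fun e => (hσS w).2 e hw.2.1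
    revert h1 h2
    cases σ w <;> simp [Status.Found]

theorem SearchInv.no_waiting (h : SearchInv G T r σ) (hr : r ∈ T)
    {S : Finset V} (hS : IsMinimalTConnecting G T S) (hσS : Agrees σ S)
    (hdone : ∀ w, (σ w).Found → σ w = .done) (t : V) : σ t ≠ .waiting := by
  intro ht
  obtain ⟨hTS, hconn, hmin⟩ := (isMinimalTConnecting_iff hr).1 hS
  have hnf : ¬ (σ t).Found := by rw [ht]; exact id
  obtain ⟨x, hxf, hxt⟩ := h.exists_last_found hconn (hTS (h.waiting _ ht)) hnf
  rcases Relation.ReflTransGen.cases_head hxt with rfl | ⟨w, hw, -⟩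
  · exact hnf hxf
  · have h1 : ¬ (σ w).Found := hw.2.2
    have h2 : σ w ≠ .excluded := fun e => (hσS w).2 e hw.2.1
    have h3 := h.done x (hdone x hxf) w hw.1
    revert h1 h2 h3
    cases σ w <;> simp [Status.Found]

theorem mem_foundSet {v : V} : v ∈ foundSet σ ↔ (σ v).Found := by simp [foundSet]

/-- At the end of the search the found vertices form a `T`-connecting set. -/
theorem SearchInv.foundSet_isTConnecting (h : SearchInv G T r σ)
    (hw : ∀ w, σ w ≠ .waiting) : IsTConnecting G T (foundSet σ) := by
  have hTS : T ⊆ foundSet σ := fun t ht =>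
    mem_foundSet.2 ((h.terminal t ht).resolve_right (hw t))
  refine ⟨hTS, (induce_preconnected_iff (mem_foundSet.2 h.root)).2 fun v hv => ?_⟩
  simp only [mem_foundSet]
  exact h.conn v (mem_foundSet.1 hv)

theorem SearchInv.eq_foundSet (h : SearchInv G T r σ)
    {S : Finset V} (hS : IsMinimalTConnecting G T S) (hσS : Agrees σ S)
    (hw : ∀ w, σ w ≠ .waiting) : S = foundSet σ := by
  have hsub : foundSet σ ⊆ S := fun v hv => (hσS v).1 (mem_foundSet.1 hv)
  by_contra hne
  exact hS.2 _ (Finset.ssubset_iff_subset_ne.2 ⟨hsub, fun e => hne e.symm⟩)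
    (h.foundSet_isTConnecting hw)

theorem foundSet_agrees : Agrees σ (foundSet σ) := by
  intro v
  rw [mem_foundSet]
  exact ⟨id, fun h => by rw [h]; exact id⟩

theorem agrees_update {S : Finset V} (hσS : ∀ v, v ∈ T → v ∈ S) (u : V) {s : Status}
    (hu : (σ u).Found ∨ σ u = .waiting ∧ u ∈ T) (hs : s.Found) :
    Agrees (Function.update σ u s) S ↔ Agrees σ S := by
  have hu' : σ u ≠ .excluded := by
    rcases hu with hu | hu
    · intro e; rw [e] at hu; exact hu
    · simp [hu.1]
  have hs' : s ≠ .excluded := by rintro rfl; exact hs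
  constructor
  · intro h v
    rcases eq_or_ne v u with rfl | hv
    · have := h v
      simp only [Function.update_self] at this
      exact ⟨fun _ => this.1 hs, fun e => absurd e hu'⟩
    · simpa [hv] using h v
  · intro h v
    rcases eq_or_ne v u with rfl | hv
    · simp only [Function.update_self]
      refine ⟨fun _ => ?_, fun e => absurd e hs'⟩
      rcases hu with hu | hu
      · exact (h v).1 hu
      · exact hσS v hu.2
    · simpa [hv] using h v

theorem agrees_update_found {S : Finset V} {u : V} {s : Status} (hu : σ u = .free)
    (hs : s.Found) : Agrees (Function.update σ u s) S ↔ Agrees σ S ∧ u ∈ S := by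
  have hs' : s ≠ .excluded := by rintro rfl; exact hs
  constructor
  · intro h
    have h0 := h u
    simp only [Function.update_self] at h0
    refine ⟨fun v => ?_, h0.1 hs⟩
    rcases eq_or_ne v u with rfl | hv
    · simp [hu, Status.Found]
    · simpa [hv] using h v
  · rintro ⟨h, huS⟩ v
    rcases eq_or_ne v u with rfl | hv
    · simp [huS, hs']
    · simpa [hv] using h v

theorem agrees_update_excluded {S : Finset V} {u : V} (hu : σ u = .free) :
    Agrees (Function.update σ u .excluded) S ↔ Agrees σ S ∧ u ∉ S := by
  constructor
  · intro h
    have h0 := h u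
    simp only [Function.update_self] at h0
    refine ⟨fun v => ?_, h0.2 trivial⟩
    rcases eq_or_ne v u with rfl | hv
    · simp [hu, Status.Found]
    · simpa [hv] using h v
  · rintro ⟨h, huS⟩ v
    rcases eq_or_ne v u with rfl | hv
    · simp [huS, Status.Found]
    · simpa [hv] using h v

open Classical in
/-- Every minimal set that agrees with a node is either output there or agrees with exactly one
child. -/
theorem SearchStep.count_eq {cs : List (V → Status)} {out : List (Finset V)}
    (hs : SearchStep G T r σ cs out) (h : SearchInv G T r σ) (hr : r ∈ T) (hT : 2 ≤ T.card)
    {S : Finset V} (hS : IsMinimalTConnecting G T S) :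
    out.count S + cs.countP (fun c => Agrees c S) = if Agrees σ S then 1 else 0 := by
  have hTS : ∀ v, v ∈ T → v ∈ S := fun v hv => hS.1.1 hv
  cases hs with
  | hopeless hlt =>
    have : ¬ Agrees σ S := fun hσ => absurd (h.card_needy_le hr hT hS hσ) (by omega)
    simp [this]
  | meet v u _ hv hvu hu =>
    rw [List.countP_singleton]
    have huv : u ≠ v := hvu.ne'
    have : Agrees (Function.update (Function.update σ u .met) v .served) S ↔ Agrees σ S := by
      rw [agrees_update (s := .served) hTS v
        (by rw [Function.update_of_ne huv.symm]; exact Or.inl hv.found)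
        trivial, agrees_update (s := .met) hTS u (Or.inr ⟨hu, h.waiting u hu⟩) trivial]
    simp [this]
  | branch v u _ hv hw hvu hu =>
    have huv : u ≠ v := hvu.ne'
    have h1 : Agrees (Function.update (Function.update σ u .pending) v .served) S ↔
        Agrees σ S ∧ u ∈ S := by
      rw [agrees_update (s := .served) hTS v
        (by rw [Function.update_of_ne huv.symm]; exact Or.inl hv.found)
        trivial, agrees_update_found (s := .pending) hu trivial]
    have h2 := agrees_update_excluded (S := S) hu
    by_cases hA : Agrees σ S <;> by_cases huS : u ∈ S <;>
      simp [h1, h2, hA, huS]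
  | stuck v hv hw =>
    have : ¬ Agrees σ S := fun hσ => by
      obtain ⟨w, hvw, h1⟩ := h.not_stuck hr hT hS hσ hv
      have := hw w hvw
      tauto
    simp [this]
  | close v _ hv hw =>
    rw [List.countP_singleton]
    have := agrees_update (σ := σ) (s := .done) hTS v (Or.inl (by rw [hv]; trivial)) trivial
    simp [this]
  | scanPending v _ hn hv =>
    rw [List.countP_singleton]
    have := agrees_update (σ := σ) (s := .seeking) hTS v (Or.inl (by rw [hv]; trivial)) trivial
    simp [this]
  | scanMet v _ hn hv =>
    rw [List.countP_singleton]
    have := agrees_update (σ := σ) (s := .served) hTS v (Or.inl (by rw [hv]; trivial)) trivial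
    simp [this]
  | unreachable v hd hv =>
    have : ¬ Agrees σ S := fun hσ => h.no_waiting hr hS hσ hd v hv
    simp [this]
  | reject v hd hw hv hvT hreach =>
    have : ¬ Agrees σ S := fun hσ => by
      obtain rfl := h.eq_foundSet hS hσ hw
      refine ((isMinimalTConnecting_iff hr).1 hS).2.2 v (mem_foundSet.2 ?_) hvT hreach
      rw [hv]; trivial
    simp [this]
  | accept hd hw hmin =>
    by_cases hσ : Agrees σ S
    · obtain rfl := h.eq_foundSet hS hσ hw
      simp [hσ]
    · have : foundSet σ ≠ S := by
        rintro rfl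
        exact hσ foundSet_agrees
      simp [hσ, this]

theorem SearchStep.isMinimal_of_mem {cs : List (V → Status)} {out : List (Finset V)}
    (hs : SearchStep G T r σ cs out) (h : SearchInv G T r σ) (hr : r ∈ T)
    {S : Finset V} (hS : S ∈ out) : IsMinimalTConnecting G T S := by
  cases hs with
  | accept hd hw hmin =>
    obtain rfl : S = foundSet σ := by simpa using hS
    have hc := h.foundSet_isTConnecting hw
    refine (isMinimalTConnecting_iff hr).2
      ⟨hc.1, (induce_preconnected_iff (hc.1 hr)).1 hc.2, fun v hv => ?_⟩
    exact hmin v (hd v (mem_foundSet.1 hv))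
  | _ => simp at hS

end Search

/-! ### The size of the search tree -/

section Size

variable {V : Type*} [Fintype V] [DecidableEq V]

/-- The undecided vertices next to the vertex being scanned. -/
noncomputable def nearFree (G : SimpleGraph V) (σ : V → Status) : Finset V :=
  open Classical in Finset.univ.filter fun u => σ u = .free ∧ ∃ v, (σ v).Active ∧ G.Adj v u

/-- The undecided vertices that are not next to the vertex being scanned. -/
noncomputable def farFree (G : SimpleGraph V) (σ : V → Status) : Finset V :=
  open Classical in Finset.univ.filter fun u => σ u = .free ∧ ¬ ∃ v, (σ v).Active ∧ G.Adj v u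

/-- The vertex being scanned needs a child, and this has to be an undecided neighbour. -/
def Hungry (G : SimpleGraph V) (σ : V → Status) : Prop :=
  ∃ v, σ v = .seeking ∧ ∀ w, G.Adj v w → σ w ≠ .waiting

open Classical in
/-- An upper bound for the number of sets that are output below a node. The surplus of waiting
terminals over vertices in need of a child is the number of further vertices that can be selected
in addition to the one child that each vertex needs anyway. The bound is smaller when the vertex
being scanned must select one of its undecided neighbours, and `0` at a dead end. -/
noncomputable def potential (G : SimpleGraph V) (σ : V → Status) : ℝ :=
  let w := (waitingSet σ).card
  let k := (needySet σ).card
  if w < k then 0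
  else if Hungry G σ then firstGrowth (farFree G σ).card (nearFree G σ).card (w - k)
  else mixedGrowth (farFree G σ).card (nearFree G σ).card (w - k)

/-- An upper bound for the depth of the search tree below a node. -/
def depthBound (σ : V → Status) : ℕ := ∑ v, (σ v).rank

variable {G : SimpleGraph V} {T : Finset V} {r : V} {σ : V → Status}

theorem potential_nonneg : 0 ≤ potential G σ := by
  unfold potential
  dsimp only
  split_ifs
  · exact le_rfl
  · exact firstGrowth_nonneg _ _ _
  · exact zero_le_one.trans (one_le_mixedGrowth _ _ _)

theorem potential_le_mixedGrowth {b f e : ℕ}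
    (hb : (waitingSet σ).card ≤ (needySet σ).card + b)
    (hf : (farFree G σ).card = f) (he : (nearFree G σ).card = e) (hh : ¬ Hungry G σ) :
    potential G σ ≤ mixedGrowth f e b := by
  unfold potential
  dsimp only
  rw [hf, he, if_neg hh]
  split_ifs
  · exact zero_le_one.trans (one_le_mixedGrowth _ _ _)
  · exact mixedGrowth_mono_right _ _ (by omega)

theorem potential_le_growth {b m : ℕ}
    (hb : (waitingSet σ).card ≤ (needySet σ).card + b)
    (hm : (farFree G σ).card + (nearFree G σ).card = m) :
    potential G σ ≤ growth m b := by
  unfold potential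
  dsimp only
  subst hm
  split_ifs
  · exact growth_nonneg _ _
  · exact (firstGrowth_le_growth _ _ _).trans (growth_mono_right _ (by omega))
  · exact (mixedGrowth_le_growth _ _ _).trans (growth_mono_right _ (by omega))

theorem potential_eq_mixedGrowth (hb : (needySet σ).card ≤ (waitingSet σ).card)
    (hh : ¬ Hungry G σ) :
    potential G σ = mixedGrowth (farFree G σ).card (nearFree G σ).card
      ((waitingSet σ).card - (needySet σ).card) := by
  unfold potential
  dsimp only
  rw [if_neg hh, if_neg (by omega)]

theorem potential_eq_firstGrowth (hb : (needySet σ).card ≤ (waitingSet σ).card) (hh : Hungry G σ) :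
    potential G σ = firstGrowth (farFree G σ).card (nearFree G σ).card
      ((waitingSet σ).card - (needySet σ).card) := by
  unfold potential
  dsimp only
  rw [if_pos hh, if_neg (by omega)]

theorem mem_nearFree {u : V} :
    u ∈ nearFree G σ ↔ σ u = .free ∧ ∃ v, (σ v).Active ∧ G.Adj v u := by simp [nearFree]

theorem mem_farFree {u : V} :
    u ∈ farFree G σ ↔ σ u = .free ∧ ¬ ∃ v, (σ v).Active ∧ G.Adj v u := by simp [farFree]

theorem nearFree_eq_empty (h : ∀ w, ¬ (σ w).Active) : nearFree G σ = ∅ := by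
  ext u; simp [mem_nearFree, h]

theorem farFree_eq (h : ∀ w, ¬ (σ w).Active) :
    farFree G σ = Finset.univ.filter fun u => σ u = .free := by
  ext u; simp [mem_farFree, h]

theorem card_farFree_add_card_nearFree : (farFree G σ).card + (nearFree G σ).card =
    (Finset.univ.filter fun u => σ u = .free).card := by
  rw [← Finset.card_union_of_disjoint]
  · congr 1
    ext u
    simp only [Finset.mem_union, mem_nearFree, mem_farFree, Finset.mem_filter, Finset.mem_univ,
      true_and]
    tauto
  · rw [Finset.disjoint_left]
    intro u h1 h2
    exact (mem_farFree.1 h1).2 (mem_nearFree.1 h2).2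

theorem not_hungry_of_not_active (h : ∀ w, ¬ (σ w).Active) : ¬ Hungry G σ := by
  rintro ⟨v, hv, -⟩
  exact h v (by rw [hv]; trivial)

theorem potential_meet_le (h : SearchInv G T r σ) {v u : V}
    (hle : (needySet σ).card ≤ (waitingSet σ).card)
    (hv : (σ v).Active) (hvu : G.Adj v u) (hu : σ u = .waiting) :
    potential G (Function.update (Function.update σ u .met) v .served) ≤ potential G σ ∧
      1 ≤ potential G σ := by
  have hh : ¬ Hungry G σ := by
    rintro ⟨x, hx, hw⟩
    obtain rfl := h.active_unique x v (by rw [hx]; trivial) hv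
    exact hw u hvu hu
  rw [potential_eq_mixedGrowth hle hh]
  refine ⟨?_, one_le_mixedGrowth _ _ _⟩
  have hvw : σ v ≠ .waiting := fun e => by rw [e] at hv; exact hv
  have hvf : σ v ≠ .free := fun e => by rw [e] at hv; exact hv
  have huv : u ≠ v := hvu.ne'
  set σ' := Function.update (Function.update σ u .met) v .served with hσ'
  have e1 : σ' v = .served := by simp [hσ']
  have e2 : σ' u = .met := by simp [hσ', huv]
  have e3 : ∀ w, w ≠ u → w ≠ v → σ' w = σ w := by intro w h1 h2; simp [hσ', h1, h2]
  have hact : ∀ w, (σ' w).Active ↔ (σ w).Active := by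
    intro w
    rcases eq_or_ne w v with rfl | hwv
    · simp only [e1, hv, iff_true]; trivial
    rcases eq_or_ne w u with rfl | hwu
    · simp [e2, hu, Status.Active]
    · rw [e3 w hwu hwv]
  have hfree : ∀ w, σ' w = .free ↔ σ w = .free := by
    intro w
    rcases eq_or_ne w v with rfl | hwv
    · simp [e1, hvf]
    rcases eq_or_ne w u with rfl | hwu
    · simp [e2, hu]
    · rw [e3 w hwu hwv]
  have hwait : (waitingSet σ') =
      (waitingSet σ).erase u := by
    ext w
    simp only [Finset.mem_erase, Finset.mem_filter, Finset.mem_univ, true_and]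
    rcases eq_or_ne w v with rfl | hwv
    · simp [e1, hvw]
    rcases eq_or_ne w u with rfl | hwu
    · simp [e2]
    · simp [e3 w hwu hwv, hwu]
  have hneedy : (needySet σ') =
      (needySet σ).erase v := by
    ext w
    simp only [Finset.mem_erase, Finset.mem_filter, Finset.mem_univ, true_and]
    rcases eq_or_ne w v with rfl | hwv
    · simp [e1, Status.Needy]
    rcases eq_or_ne w u with rfl | hwu
    · simp [e2, hu, Status.Needy]
    · simp [e3 w hwu hwv, hwv]
  refine potential_le_mixedGrowth ?_ ?_ ?_ ?_
  · rw [hwait, hneedy, Finset.card_erase_of_mem (by simp [hu])]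
    have := Finset.pred_card_le_card_erase
      (s := needySet σ) (a := v)
    omega
  · congr 1; ext w; simp only [mem_farFree, hact, hfree]
  · congr 1; ext w; simp only [mem_nearFree, hact, hfree]
  · rintro ⟨x, hx, -⟩
    obtain rfl := h.active_unique x v ((hact x).1 (by rw [hx]; trivial)) hv
    rw [e1] at hx; cases hx

theorem potential_branch_le (h : SearchInv G T r σ) {v u : V}
    (hle : (needySet σ).card ≤ (waitingSet σ).card)
    (hv : (σ v).Active) (hw : ∀ w, G.Adj v w → σ w ≠ .waiting) (hvu : G.Adj v u)
    (hu : σ u = .free) :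
    potential G (Function.update (Function.update σ u .pending) v .served) +
      potential G (Function.update σ u .excluded) ≤ potential G σ ∧ 1 ≤ potential G σ := by
  have hvw : σ v ≠ .waiting := fun e => by rw [e] at hv; exact hv
  have hvf : σ v ≠ .free := fun e => by rw [e] at hv; exact hv
  have huv : u ≠ v := hvu.ne'
  have hunear : u ∈ nearFree G σ := mem_nearFree.2 ⟨hu, v, hv, hvu⟩
  obtain ⟨e, he⟩ : ∃ e, (nearFree G σ).card = e + 1 :=
    ⟨_, (Nat.succ_pred_eq_of_pos (Finset.card_pos.2 ⟨u, hunear⟩)).symm⟩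
  have hee : ((nearFree G σ).erase u).card = e := by
    rw [Finset.card_erase_of_mem hunear, he]; rfl
  set σ₁ := Function.update (Function.update σ u .pending) v .served with hσ₁
  set σ₂ := Function.update σ u .excluded with hσ₂
  have e1 : σ₁ v = .served := by simp [hσ₁]
  have e2 : σ₁ u = .pending := by simp [hσ₁, huv]
  have e3 : ∀ w, w ≠ u → w ≠ v → σ₁ w = σ w := by intro w h1 h2; simp [hσ₁, h1, h2]
  have e4 : σ₂ u = .excluded := by simp [hσ₂]
  have e5 : ∀ w, w ≠ u → σ₂ w = σ w := by intro w h1; simp [hσ₂, h1]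
  have hact₁ : ∀ w, (σ₁ w).Active ↔ (σ w).Active := by
    intro w
    rcases eq_or_ne w v with rfl | hwv
    · simp only [e1, hv, iff_true]; trivial
    rcases eq_or_ne w u with rfl | hwu
    · simp [e2, hu, Status.Active]
    · rw [e3 w hwu hwv]
  have hact₂ : ∀ w, (σ₂ w).Active ↔ (σ w).Active := by
    intro w
    rcases eq_or_ne w u with rfl | hwu
    · simp [e4, hu, Status.Active]
    · rw [e5 w hwu]
  have hfree₁ : ∀ w, σ₁ w = .free ↔ σ w = .free ∧ w ≠ u := by
    intro w
    rcases eq_or_ne w v with rfl | hwv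
    · simp [e1, hvf]
    rcases eq_or_ne w u with rfl | hwu
    · simp [e2]
    · simp [e3 w hwu hwv, hwu]
  have hfree₂ : ∀ w, σ₂ w = .free ↔ σ w = .free ∧ w ≠ u := by
    intro w
    rcases eq_or_ne w u with rfl | hwu
    · simp [e4]
    · simp [e5 w hwu, hwu]
  have hwait₁ : (waitingSet σ₁) =
      waitingSet σ := by
    ext w
    simp only [Finset.mem_filter, Finset.mem_univ, true_and]
    rcases eq_or_ne w v with rfl | hwv
    · simp [e1, hvw]
    rcases eq_or_ne w u with rfl | hwu
    · simp [e2, hu]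
    · simp [e3 w hwu hwv]
  have hwait₂ : ∀ w, σ₂ w = .waiting ↔ σ w = .waiting := by
    intro w
    rcases eq_or_ne w u with rfl | hwu
    · simp [e4, hu]
    · simp [e5 w hwu]
  have hneedy₁ : (needySet σ₁) =
      insert u ((needySet σ).erase v) := by
    ext w
    simp only [Finset.mem_insert, Finset.mem_erase, Finset.mem_filter, Finset.mem_univ, true_and]
    rcases eq_or_ne w v with rfl | hwv
    · simp [e1, Status.Needy, huv.symm]
    rcases eq_or_ne w u with rfl | hwu
    · simp [e2, Status.Needy]
    · simp [e3 w hwu hwv, hwv, hwu]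
  have hneedy₂ : ∀ w, (σ₂ w).Needy ↔ (σ w).Needy := by
    intro w
    rcases eq_or_ne w u with rfl | hwu
    · simp [e4, hu, Status.Needy]
    · simp [e5 w hwu]
  have hW₂ : waitingSet σ₂ = waitingSet σ := by simp only [waitingSet, hwait₂]
  have hN₂ : needySet σ₂ = needySet σ := by simp only [needySet, hneedy₂]
  have hnear₁ : nearFree G σ₁ = (nearFree G σ).erase u := by
    ext w; simp only [mem_nearFree, Finset.mem_erase, hact₁, hfree₁]; tauto
  have hnear₂ : nearFree G σ₂ = (nearFree G σ).erase u := by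
    ext w; simp only [mem_nearFree, Finset.mem_erase, hact₂, hfree₂]; tauto
  have hfar : ∀ w, w ∈ farFree G σ → w ≠ u := by
    rintro w hw rfl
    exact (mem_farFree.1 hw).2 ⟨v, hv, hvu⟩
  have hfar₁ : farFree G σ₁ = farFree G σ := by
    ext w
    have := hfar w
    simp only [mem_farFree, hact₁, hfree₁] at this ⊢; tauto
  have hfar₂ : farFree G σ₂ = farFree G σ := by
    ext w
    have := hfar w
    simp only [mem_farFree, hact₂, hfree₂] at this ⊢; tauto
  have hcard₁ : (needySet σ₁).card =
      ((needySet σ).erase v).card + 1 := by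
    rw [hneedy₁, Finset.card_insert_of_notMem]
    intro hmem
    have h1 := (Finset.mem_filter.1 (Finset.mem_of_mem_erase hmem)).2
    rw [hu] at h1
    exact h1
  have hh₁ : ¬ Hungry G σ₁ := by
    rintro ⟨x, hx, -⟩
    obtain rfl := h.active_unique x v ((hact₁ x).1 (by rw [hx]; trivial)) hv
    rw [e1] at hx; cases hx
  by_cases hs : σ v = .seeking
  · have hh : Hungry G σ := ⟨v, hs, hw⟩
    have hh₂ : Hungry G σ₂ := ⟨v, by rw [e5 v huv.symm, hs], fun w hvw hww =>
      hw w hvw ((hwait₂ w).1 hww)⟩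
    have hmem : v ∈ needySet σ :=
      Finset.mem_filter.2 ⟨Finset.mem_univ _, by rw [hs]; trivial⟩
    rw [potential_eq_firstGrowth hle hh,
      potential_eq_firstGrowth (by rw [hW₂, hN₂]; exact hle) hh₂]
    rw [hW₂, hN₂, hfar₂, hnear₂, hee, he, firstGrowth_succ]
    constructor
    · rw [add_comm]
      refine add_le_add_right (potential_le_mixedGrowth ?_ (by rw [hfar₁]) (by rw [hnear₁, hee])
        hh₁) _
      rw [hwait₁, hcard₁, Finset.card_erase_add_one hmem]
      omega
    · have := one_le_mixedGrowth (farFree G σ).card e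
        ((waitingSet σ).card - (needySet σ).card)
      linarith [firstGrowth_nonneg (farFree G σ).card e
        ((waitingSet σ).card - (needySet σ).card)]
  · have hh : ¬ Hungry G σ := by
      rintro ⟨x, hx, -⟩
      obtain rfl := h.active_unique x v (by rw [hx]; trivial) hv
      exact hs hx
    have hh₂ : ¬ Hungry G σ₂ := by
      rintro ⟨x, hx, -⟩
      obtain rfl := h.active_unique x v ((hact₂ x).1 (by rw [hx]; trivial)) hv
      rw [e5 x huv.symm] at hx
      exact hs hx
    have hmem : v ∉ needySet σ := by
      intro hmem
      have h1 := (Finset.mem_filter.1 hmem).2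
      revert h1 hv hs
      cases σ v <;> simp [Status.Needy, Status.Active]
    rw [Finset.erase_eq_of_notMem hmem] at hcard₁
    rw [potential_eq_mixedGrowth hle hh]
    refine ⟨?_, one_le_mixedGrowth _ _ _⟩
    rw [potential_eq_mixedGrowth (by rw [hW₂, hN₂]; exact hle) hh₂]
    rw [hW₂, hN₂, hfar₂, hnear₂, hee, he]
    rcases Nat.eq_zero_or_eq_succ_pred ((waitingSet σ).card - (needySet σ).card) with hb | hb
    · -- with no budget left, a further child of `v` makes the node a dead end
      have h0 : potential G σ₁ = 0 := by
        unfold potential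
        dsimp only
        rw [if_pos]
        rw [hwait₁, hcard₁]
        omega
      rw [h0, hb, mixedGrowth, zero_add]
    · have hle₁ := potential_le_mixedGrowth (G := G) (σ := σ₁)
        (b := ((waitingSet σ).card - (needySet σ).card).pred)
        (by rw [hwait₁, hcard₁]; omega) (by rw [hfar₁]) (by rw [hnear₁, hee]) hh₁
      generalize (waitingSet σ).card -
        (needySet σ).card = b at hb hle₁ ⊢
      rw [Nat.succ_eq_add_one] at hb
      generalize b.pred = b' at hb hle₁
      subst hb
      rw [mixedGrowth]
      linarith

theorem potential_close_le (h : SearchInv G T r σ) {v : V}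
    (hle : (needySet σ).card ≤ (waitingSet σ).card)
    (hv : σ v = .served) (hw : ∀ w, G.Adj v w → σ w ≠ .waiting ∧ σ w ≠ .free) :
    potential G (Function.update σ v .done) ≤ potential G σ ∧ 1 ≤ potential G σ := by
  have hva : (σ v).Active := by rw [hv]; trivial
  have hh : ¬ Hungry G σ := by
    rintro ⟨x, hx, -⟩
    obtain rfl := h.active_unique x v (by rw [hx]; trivial) hva
    rw [hv] at hx; cases hx
  have hnear : nearFree G σ = ∅ := by
    refine Finset.eq_empty_of_forall_notMem fun u hu => ?_
    obtain ⟨huf, x, hx, hxu⟩ := mem_nearFree.1 hu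
    obtain rfl := h.active_unique x v hx hva
    exact (hw u hxu).2 huf
  rw [potential_eq_mixedGrowth hle hh]
  refine ⟨?_, one_le_mixedGrowth _ _ _⟩
  have e3 : ∀ w, w ≠ v → Function.update σ v .done w = σ w := by intro w h1; simp [h1]
  have hact : ∀ w, ¬ (Function.update σ v .done w).Active := by
    intro w
    rcases eq_or_ne w v with rfl | hwv
    · simp [Status.Active]
    · rw [e3 w hwv]; exact fun hw => hwv (h.active_unique w v hw hva)
  have hpred : ∀ p : Status → Prop, (p .done ↔ p .served) →
      ∀ w, p (Function.update σ v .done w) ↔ p (σ w) := by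
    intro p hp w
    rcases eq_or_ne w v with rfl | hwv
    · simp [hv, hp]
    · rw [e3 w hwv]
  have hwait := hpred (· = .waiting) (by simp)
  have hneedy := hpred Status.Needy (by simp [Status.Needy])
  have hfree := hpred (· = .free) (by simp)
  refine potential_le_mixedGrowth ?_ ?_ ?_ (not_hungry_of_not_active hact)
  · simp only [waitingSet, needySet, hwait, hneedy] at hle ⊢; omega
  · have := card_farFree_add_card_nearFree (G := G) (σ := σ)
    rw [hnear, Finset.card_empty, add_zero] at this
    rw [farFree_eq hact, this]
    simp only [hfree]
  · rw [hnear, nearFree_eq_empty hact]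

theorem potential_scan_le {v : V} {s : Status}
    (hle : (needySet σ).card ≤ (waitingSet σ).card)
    (hn : ∀ w, ¬ (σ w).Active) (hv : σ v = .pending ∧ s = .seeking ∨ σ v = .met ∧ s = .served) :
    potential G (Function.update σ v s) ≤ potential G σ ∧ 1 ≤ potential G σ := by
  rw [potential_eq_mixedGrowth hle (not_hungry_of_not_active hn)]
  refine ⟨?_, one_le_mixedGrowth _ _ _⟩
  have hpred : ∀ p : Status → Prop, (p (σ v) ↔ p s) →
      ∀ w, p (Function.update σ v s w) ↔ p (σ w) := by
    intro p hp w
    rcases eq_or_ne w v with rfl | hwv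
    · simp [hp]
    · simp [hwv]
  have hwait := hpred (· = .waiting) (by rcases hv with hv | hv <;> simp [hv])
  have hneedy := hpred Status.Needy (by rcases hv with hv | hv <;> simp [hv, Status.Needy])
  have hfree := hpred (· = .free) (by rcases hv with hv | hv <;> simp [hv])
  rw [nearFree_eq_empty hn, Finset.card_empty, mixedGrowth, farFree_eq hn]
  refine potential_le_growth ?_ ?_
  · simp only [waitingSet, needySet, hwait, hneedy] at hle ⊢; omega
  · rw [card_farFree_add_card_nearFree]; simp only [hfree]

/-- The potential is distributed among the children and the output of a node. -/
theorem SearchStep.sum_potential_le {cs : List (V → Status)} {out : List (Finset V)}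
    (hs : SearchStep G T r σ cs out) (h : SearchInv G T r σ) :
    (out.length : ℝ) + (cs.map (potential G)).sum ≤ potential G σ ∧
      (cs ≠ [] → 1 ≤ potential G σ) := by
  cases hs with
  | hopeless _ => simpa using potential_nonneg
  | meet v u hle hv hvu hu =>
    have := potential_meet_le h hle hv hvu hu
    simpa using this
  | branch v u hle hv hw hvu hu =>
    have := potential_branch_le h hle hv hw hvu hu
    simpa using this
  | stuck v _ _ => simpa using potential_nonneg
  | close v hle hv hw =>
    have := potential_close_le h hle hv hw
    simpa using this
  | scanPending v hle hn hv =>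
    have := potential_scan_le (G := G) hle hn (Or.inl ⟨hv, rfl⟩)
    simpa using this
  | scanMet v hle hn hv =>
    have := potential_scan_le (G := G) hle hn (Or.inr ⟨hv, rfl⟩)
    simpa using this
  | unreachable v _ _ => simpa using potential_nonneg
  | reject v _ _ _ _ _ => simpa using potential_nonneg
  | accept hd hw hmin =>
    have hneedy : ∀ w, ¬ (σ w).Needy := fun w hw => by
      have := hd w hw.found
      rw [this] at hw; exact hw
    have hact : ∀ w, ¬ (σ w).Active := fun w hw => by
      have := hd w hw.found
      rw [this] at hw; exact hw
    rw [potential_eq_mixedGrowth (by simp [needySet, hneedy]) (not_hungry_of_not_active hact)]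
    simpa using one_le_mixedGrowth _ _ _

theorem depthBound_lt {σ' : V → Status} (hle : ∀ v, (σ' v).rank ≤ (σ v).rank)
    {u : V} (hu : (σ' u).rank < (σ u).rank) : depthBound σ' < depthBound σ :=
  Finset.sum_lt_sum (fun v _ => hle v) ⟨u, Finset.mem_univ u, hu⟩

theorem depthBound_update_lt {u : V} {s : Status} (hu : s.rank < (σ u).rank) :
    depthBound (Function.update σ u s) < depthBound σ := by
  refine depthBound_lt (fun v => ?_) (u := u) (by simpa using hu)
  rcases eq_or_ne v u with rfl | hv
  · simpa using hu.le
  · simp [hv]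

theorem depthBound_attach_lt {v u : V} {s : Status} (huv : u ≠ v) (hv : (σ v).Active)
    (hu : s.rank < (σ u).rank) :
    depthBound (Function.update (Function.update σ u s) v .served) < depthBound σ := by
  refine depthBound_lt (fun w => ?_) (u := u) (by simpa [huv] using hu)
  rcases eq_or_ne w v with rfl | hwv
  · revert hv
    cases hσ : σ w <;> simp [Status.rank, Status.Active]
  rcases eq_or_ne w u with rfl | hwu
  · simpa [hwv] using hu.le
  · simp [hwv, hwu]

theorem SearchStep.depthBound_lt {cs : List (V → Status)} {out : List (Finset V)}
    (hs : SearchStep G T r σ cs out) : ∀ c ∈ cs, depthBound c < depthBound σ := by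
  cases hs with
  | meet v u _ hv hvu hu =>
    simpa using depthBound_attach_lt hvu.ne' hv (by rw [hu]; simp [Status.rank])
  | branch v u _ hv hw hvu hu =>
    simpa using ⟨depthBound_attach_lt hvu.ne' hv (by rw [hu]; simp [Status.rank]),
      depthBound_update_lt (by rw [hu]; simp [Status.rank])⟩
  | close v _ hv hw => simpa using depthBound_update_lt (by rw [hv]; simp [Status.rank])
  | scanPending v _ hn hv => simpa using depthBound_update_lt (by rw [hv]; simp [Status.rank])
  | scanMet v _ hn hv => simpa using depthBound_update_lt (by rw [hv]; simp [Status.rank])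
  | _ => simp

theorem SearchStep.length_le_two {cs : List (V → Status)} {out : List (Finset V)}
    (hs : SearchStep G T r σ cs out) : cs.length ≤ 2 := by
  cases hs <;> simp

/-- An upper bound for the number of nodes of the search tree below a node. -/
noncomputable def treeSize (G : SimpleGraph V) (σ : V → Status) : ℝ :=
  3 * depthBound σ * potential G σ + 1

theorem one_le_treeSize : 1 ≤ treeSize G σ := by
  unfold treeSize
  have := potential_nonneg (G := G) (σ := σ)
  have : 0 ≤ 3 * (depthBound σ : ℝ) * potential G σ := by positivity
  linarith

theorem SearchStep.sum_treeSize_le {cs : List (V → Status)} {out : List (Finset V)}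
    (hs : SearchStep G T r σ cs out) (h : SearchInv G T r σ) :
    (cs.map (treeSize G)).sum + 1 ≤ treeSize G σ := by
  rcases eq_or_ne cs [] with rfl | hne
  · simpa using one_le_treeSize
  have hd := hs.depthBound_lt
  have hlen := hs.length_le_two
  obtain ⟨hsum, hone⟩ := hs.sum_potential_le h
  have hone := hone hne
  have hpos : 0 < depthBound σ := by
    obtain ⟨c, hc⟩ := List.exists_mem_of_ne_nil _ hne
    exact Nat.zero_lt_of_lt (hd c hc)
  obtain ⟨d, hdd⟩ := Nat.exists_eq_succ_of_ne_zero hpos.ne'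
  have hbound : ∀ l : List (V → Status), (∀ c ∈ l, depthBound c < depthBound σ) →
      (l.map (treeSize G)).sum ≤ 3 * d * (l.map (potential G)).sum + l.length := by
    intro l hl
    induction l with
    | nil => simp
    | cons c l ih =>
      have h1 := ih fun c' hc' => hl c' (List.mem_cons_of_mem _ hc')
      have h2 : depthBound c ≤ d := by have := hl c List.mem_cons_self; omega
      have h3 : (depthBound c : ℝ) * potential G c ≤ d * potential G c :=
        mul_le_mul_of_nonneg_right (by exact_mod_cast h2) potential_nonneg
      simp only [List.map_cons, List.sum_cons, List.length_cons]
      push_cast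
      rw [treeSize]
      linarith
  have h1 := hbound cs hd
  have h2 : (cs.length : ℝ) ≤ 2 := by exact_mod_cast hlen
  have h3 : (0 : ℝ) ≤ out.length := Nat.cast_nonneg _
  have h4 : 3 * (d : ℝ) * (cs.map (potential G)).sum ≤ 3 * d * potential G σ :=
    mul_le_mul_of_nonneg_left (by linarith) (by positivity)
  rw [treeSize, hdd]
  push_cast
  linarith

/-! ### The number of minimal sets -/

/-- The search never gets into a situation that is not covered by a rule. -/
theorem exists_searchStep (G : SimpleGraph V) (T : Finset V) (r : V) (σ : V → Status) :
    ∃ cs out, SearchStep G T r σ cs out := by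
  by_cases hle : (needySet σ).card ≤ (waitingSet σ).card
  swap
  · exact ⟨_, _, .hopeless (not_le.1 hle)⟩
  by_cases hact : ∃ v, (σ v).Active
  · obtain ⟨v, hv⟩ := hact
    by_cases h1 : ∃ u, G.Adj v u ∧ σ u = .waiting
    · obtain ⟨u, hvu, hu⟩ := h1
      exact ⟨_, _, .meet v u hle hv hvu hu⟩
    by_cases h2 : ∃ u, G.Adj v u ∧ σ u = .free
    · obtain ⟨u, hvu, hu⟩ := h2
      exact ⟨_, _, .branch v u hle hv (fun w hw e => h1 ⟨w, hw, e⟩) hvu hu⟩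
    have h3 : ∀ w, G.Adj v w → σ w ≠ .waiting ∧ σ w ≠ .free := fun w hw =>
      ⟨fun e => h1 ⟨w, hw, e⟩, fun e => h2 ⟨w, hw, e⟩⟩
    cases hσ : σ v with
    | seeking => exact ⟨_, _, .stuck v hσ h3⟩
    | served => exact ⟨_, _, .close v hle hσ h3⟩
    | _ => rw [hσ] at hv; exact hv.elim
  push Not at hact
  by_cases h1 : ∃ v, σ v = .pending
  · obtain ⟨v, hv⟩ := h1
    exact ⟨_, _, .scanPending v hle hact hv⟩
  by_cases h2 : ∃ v, σ v = .met
  · obtain ⟨v, hv⟩ := h2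
    exact ⟨_, _, .scanMet v hle hact hv⟩
  have hd : ∀ w, (σ w).Found → σ w = .done := by
    push Not at h1 h2
    intro w
    have := hact w
    have := h1 w
    have := h2 w
    cases hσ : σ w <;> simp_all [Status.Found, Status.Active]
  by_cases h3 : ∃ v, σ v = .waiting
  · obtain ⟨v, hv⟩ := h3
    exact ⟨_, _, .unreachable v hd hv⟩
  push Not at h3
  by_cases h4 : ∃ v, σ v = .done ∧ v ∉ T ∧
      ∀ t ∈ T, Reaches G (fun x => x ∈ foundSet σ ∧ x ≠ v) r t
  · obtain ⟨v, hv, hvT, h⟩ := h4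
    exact ⟨_, _, .reject v hd h3 hv hvT h⟩
  · exact ⟨_, _, .accept hd h3 fun v hv hvT h => h4 ⟨v, hv, hvT, h⟩⟩

open Classical in
/-- The number of minimal sets that agree with a node is at most its potential. -/
theorem SearchInv.card_agrees_le (h : SearchInv G T r σ) (hr : r ∈ T) (hT : 2 ≤ T.card) :
    ((Finset.univ.filter fun S => IsMinimalTConnecting G T S ∧ Agrees σ S).card : ℝ) ≤
      potential G σ := by
  generalize hd : depthBound σ = d
  induction d using Nat.strong_induction_on generalizing σ with
  | _ d ih =>
    subst hd
    obtain ⟨cs, out, hs⟩ := exists_searchStep G T r σ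
    refine le_trans ?_ (hs.sum_potential_le h).1
    have hcs : ∀ l : List (V → Status), (∀ c ∈ l, SearchInv G T r c ∧ depthBound c < depthBound σ) →
        ∑ S ∈ Finset.univ.filter (fun S => IsMinimalTConnecting G T S),
          (l.countP (fun c => Agrees c S) : ℝ) ≤ (l.map (potential G)).sum := by
      intro l hl
      induction l with
      | nil => simp
      | cons c l ihl =>
        have h1 := ihl fun c' hc' => hl c' (List.mem_cons_of_mem _ hc')
        obtain ⟨h2, h3⟩ := hl c List.mem_cons_self
        have h4 := ih _ h3 h2 rfl
        rw [← Finset.filter_filter, Finset.card_filter] at h4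
        simp only [List.countP_cons, List.map_cons, List.sum_cons, Nat.cast_add,
          Finset.sum_add_distrib]
        push_cast at h4 ⊢
        simp only [decide_eq_true_eq]
        linarith
    have hout : ∑ S ∈ Finset.univ.filter (fun S => IsMinimalTConnecting G T S),
        (out.count S : ℝ) ≤ out.length := by
      cases hs with
      | accept =>
        rw [← Nat.cast_sum, Nat.cast_le]
        simp only [List.count_singleton, beq_iff_eq, Finset.sum_ite_eq, List.length_singleton]
        split_ifs <;> simp
      | _ => simp
    rw [← Finset.filter_filter, Finset.card_filter]
    push_cast
    calc _ = ∑ S ∈ Finset.univ.filter (fun S => IsMinimalTConnecting G T S),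
          ((out.count S : ℝ) + (cs.countP (fun c => Agrees c S) : ℝ)) := by
          refine Finset.sum_congr rfl fun S hS => ?_
          have := hs.count_eq h hr hT (Finset.mem_filter.1 hS).2
          rw [← Nat.cast_add]
          rw [show out.count S + cs.countP (fun c => Agrees c S) = _ from this]
          push_cast; rfl
      _ ≤ _ := by
          rw [Finset.sum_add_distrib]
          exact add_le_add hout (hcs cs fun c hc => ⟨hs.searchInv h c hc, hs.depthBound_lt c hc⟩)

/-- The root of the search tree. -/
def initialStatus (T : Finset V) (r : V) (v : V) : Status :=
  if v = r then .seeking else if v ∈ T then .waiting else .free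

theorem initialStatus_found {v : V} : (initialStatus T r v).Found ↔ v = r := by
  unfold initialStatus
  split_ifs <;> simp_all [Status.Found]

theorem initialStatus_needy {v : V} : (initialStatus T r v).Needy ↔ v = r := by
  unfold initialStatus
  split_ifs <;> simp_all [Status.Needy]

theorem initialStatus_active {v : V} : (initialStatus T r v).Active ↔ v = r := by
  unfold initialStatus
  split_ifs <;> simp_all [Status.Active]

theorem initialStatus_waiting {v : V} : initialStatus T r v = .waiting ↔ v ≠ r ∧ v ∈ T := by
  unfold initialStatus
  split_ifs <;> simp_all

theorem initialStatus_free {v : V} : initialStatus T r v = .free ↔ v ≠ r ∧ v ∉ T := by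
  unfold initialStatus
  split_ifs <;> simp_all

theorem searchInv_initialStatus : SearchInv G T r (initialStatus T r) where
  root := initialStatus_found.2 rfl
  terminal v hv := by
    rw [initialStatus_found, initialStatus_waiting]; tauto
  waiting v hv := (initialStatus_waiting.1 hv).2
  needy_notMem v hv hvr := absurd (initialStatus_needy.1 hv) hvr
  needy_root _ v hv := initialStatus_found.1 hv
  conn v hv := by rw [initialStatus_found.1 hv]; exact Reaches.refl _ _ _
  needy_conn v hv hvr := absurd (initialStatus_needy.1 hv) hvr
  active_unique v w hv hw := (initialStatus_active.1 hv).trans (initialStatus_active.1 hw).symm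
  done v hv := by
    unfold initialStatus at hv
    split_ifs at hv

theorem agrees_initialStatus (hr : r ∈ T) {S : Finset V} (hS : IsMinimalTConnecting G T S) :
    Agrees (initialStatus T r) S := by
  intro v
  rw [initialStatus_found]
  refine ⟨fun e => e ▸ hS.1.1 hr, fun h => ?_⟩
  unfold initialStatus at h
  split_ifs at h

theorem potential_initialStatus_le (hr : r ∈ T) :
    potential G (initialStatus T r) ≤ growth (Fintype.card V - T.card) (T.card - 2) := by
  have hw : waitingSet (initialStatus T r) = T.erase r := by
    ext v; simp [initialStatus_waiting]
  have hn : needySet (initialStatus T r) = {r} := by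
    ext v; simp [initialStatus_needy]
  have hf : (Finset.univ.filter fun v => initialStatus T r v = .free) = Tᶜ := by
    ext v
    simp only [initialStatus_free, Finset.mem_filter, Finset.mem_univ, true_and,
      Finset.mem_compl, and_iff_right_iff_imp]
    rintro h rfl
    exact h hr
  refine potential_le_growth ?_ ?_
  · rw [hw, hn, Finset.card_erase_of_mem hr, Finset.card_singleton]; omega
  · rw [card_farFree_add_card_nearFree, hf, Finset.card_compl]

theorem potential_initialStatus_le_choose (hr : r ∈ T) (hT : 2 ≤ T.card)
    (hTn : 3 * T.card ≤ Fintype.card V) :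
    potential G (initialStatus T r) ≤ ((Fintype.card V - T.card).choose (T.card - 2) : ℝ) *
      (3 : ℝ) ^ (((Fintype.card V : ℝ) - (T.card : ℝ)) / 3) := by
  refine (potential_initialStatus_le hr).trans ?_
  have h := growth_le_choose_mul_pow (m := Fintype.card V - T.card) (k := T.card - 2) (by omega)
  rwa [cubeRootThree_pow, Nat.cast_sub (by omega)] at h

theorem ncard_isMinimalTConnecting_le (G : SimpleGraph V) (T : Finset V) (hT : 2 ≤ T.card)
    (hTn : 3 * T.card ≤ Fintype.card V) :
    (({S : Finset V | IsMinimalTConnecting G T S}.ncard : ℕ) : ℝ) ≤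
      ((Fintype.card V - T.card).choose (T.card - 2) : ℝ) *
        (3 : ℝ) ^ (((Fintype.card V : ℝ) - (T.card : ℝ)) / 3) := by
  classical
  obtain ⟨r, hr⟩ : T.Nonempty := Finset.card_pos.1 (by omega)
  refine le_trans ?_ (potential_initialStatus_le_choose (G := G) hr hT hTn)
  refine le_trans ?_ ((searchInv_initialStatus (G := G) (T := T) (r := r)).card_agrees_le hr hT)
  rw [← Set.ncard_coe_finset]
  exact_mod_cast Set.ncard_le_ncard (fun S hS => by
    simpa using ⟨hS, agrees_initialStatus hr hS⟩) (Finset.finite_toSet _)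

end Size

/-! ### Programs with bounded loops -/

namespace RAM

@[simp] theorem Store.setReg_reg (s : Store) (x v y : ℕ) :
    (s.setReg x v).reg y = if y = x then v else s.reg y := by
  simp [Store.setReg, Function.update_apply]

@[simp] theorem Store.setReg_mem (s : Store) (x v : ℕ) : (s.setReg x v).mem = s.mem := rfl

@[simp] theorem Store.setReg_out (s : Store) (x v : ℕ) : (s.setReg x v).out = s.out := rfl

@[simp] theorem Store.setMem_reg (s : Store) (a i v : ℕ) : (s.setMem a i v).reg = s.reg := rfl

@[simp] theorem Store.setMem_mem_self (s : Store) (a i v : ℕ) :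
    (s.setMem a i v).mem a = Function.update (s.mem a) i v := by
  simp [Store.setMem]

theorem Store.setMem_mem_of_ne (s : Store) {a b : ℕ} (i v : ℕ) (h : b ≠ a) :
    (s.setMem a i v).mem b = s.mem b := by
  simp [Store.setMem, h]

@[simp] theorem Store.emit_out (s : Store) (v : ℕ) : (s.emit v).out = s.out ++ [v] := rfl

/-- Programs whose loops run through the numbers below the content of register `0`. They always
halt, and their effect is a function on stores. -/
inductive Block : Type
  | skip : Block
  | const (x c : ℕ) : Block
  | copy (x y : ℕ) : Block
  | incr (x : ℕ) : Block
  | decr (x : ℕ) : Block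
  | load (x a y : ℕ) : Block
  | store (a x y : ℕ) : Block
  | write (x : ℕ) : Block
  | seq (p q : Block) : Block
  | cond (x y : ℕ) (p q : Block) : Block
  /-- run `p` with register `x` set to `0, 1, …` up to but not including the content of
  register `0` -/
  | each (x : ℕ) (p : Block) : Block

local infixr:60 " ;; " => Block.seq

namespace Block

/-- The program that a block stands for. -/
def compile : Block → Program
  | skip => .skip
  | const x c => .const x c
  | copy x y => .copy x y
  | incr x => .incr x
  | decr x => .decr x
  | load x a y => .load x a y
  | store a x y => .store a x y
  | write x => .write x
  | seq p q => .seq p.compile q.compile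
  | cond x y p q => .cond x y p.compile q.compile
  | each x p => .seq (.const x 0) (.loop x 0 (.seq p.compile (.incr x)))

/-- The effect of a block. The counter `x` of a loop is reset from the number of the round, which
agrees with the compiled program when the body does not write to `x`. -/
def denote : Block → Store → Store
  | skip, s => s
  | const x c, s => s.setReg x c
  | copy x y, s => s.setReg x (s.reg y)
  | incr x, s => s.setReg x (s.reg x + 1)
  | decr x, s => s.setReg x (s.reg x - 1)
  | load x a y, s => s.setReg x (s.mem a (s.reg y))
  | store a x y, s => s.setMem a (s.reg x) (s.reg y)
  | write x, s => s.emit (s.reg x)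
  | seq p q, s => q.denote (p.denote s)
  | cond x y p q, s => if s.reg x < s.reg y then p.denote s else q.denote s
  | each x p, s =>
    ((List.range (s.reg 0)).foldl (fun s i => p.denote (s.setReg x i)) s).setReg x (s.reg 0)

/-- The registers that a block may change. -/
def writes : Block → List ℕ
  | const x _ | copy x _ | incr x | decr x | load x _ _ => [x]
  | seq p q | cond _ _ p q => p.writes ++ q.writes
  | each x p => x :: p.writes
  | skip | store _ _ _ | write _ => []

/-- The memories that a block may change. -/
def memWrites : Block → List ℕ
  | store a _ _ => [a]
  | seq p q | cond _ _ p q => p.memWrites ++ q.memWrites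
  | each _ p => p.memWrites
  | _ => []

/-- The block writes nothing to the output. -/
def Silent : Block → Bool
  | write _ => false
  | seq p q | cond _ _ p q => p.Silent && q.Silent
  | each _ p => p.Silent
  | _ => true

/-- No loop body changes its counter. -/
def Safe : Block → Bool
  | seq p q | cond _ _ p q => p.Safe && q.Safe
  | each x p => x ∉ p.writes && p.Safe
  | _ => true

/-- An upper bound for the number of steps when register `0` holds `n`. -/
def cost (n : ℕ) : Block → ℕ
  | seq p q => p.cost n + q.cost n
  | cond _ _ p q => p.cost n + q.cost n + 1
  | each _ p => 2 + n * (p.cost n + 2)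
  | _ => 1

/-- The stores that differ from `s` only where `p` may change something. -/
structure Frame (p : Block) (s s' : Store) : Prop where
  reg : ∀ x, x ∉ p.writes → s'.reg x = s.reg x
  mem : ∀ a, a ∉ p.memWrites → s'.mem a = s.mem a
  out : p.Silent = true → s'.out = s.out

theorem Frame.refl (p : Block) (s : Store) : Frame p s s :=
  ⟨fun _ _ => rfl, fun _ _ => rfl, fun _ => rfl⟩

theorem Frame.trans {p : Block} {s s' s'' : Store} (h : Frame p s s') (h' : Frame p s' s'') :
    Frame p s s'' :=
  ⟨fun x hx => (h'.reg x hx).trans (h.reg x hx), fun a ha => (h'.mem a ha).trans (h.mem a ha),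
    fun ho => (h'.out ho).trans (h.out ho)⟩

theorem Frame.seq_left {p q : Block} {s s' : Store} (h : Frame p s s') : Frame (p.seq q) s s' :=
  ⟨fun x hx => h.reg x (by simp [writes] at hx; tauto),
    fun a ha => h.mem a (by simp [memWrites] at ha; tauto),
    fun ho => h.out (by simp [Silent] at ho; tauto)⟩

theorem Frame.seq_right {p q : Block} {s s' : Store} (h : Frame q s s') : Frame (p.seq q) s s' :=
  ⟨fun x hx => h.reg x (by simp [writes] at hx; tauto),
    fun a ha => h.mem a (by simp [memWrites] at ha; tauto),
    fun ho => h.out (by simp [Silent] at ho; tauto)⟩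

theorem Frame.body {p : Block} {x : ℕ} {s s' : Store} (h : Frame p s s') :
    Frame (p.each x) s s' :=
  ⟨fun y hy => h.reg y (by simp [writes] at hy; tauto), h.mem, h.out⟩

theorem Frame.setReg {p : Block} {x v : ℕ} (s : Store) (hx : x ∈ p.writes) :
    Frame p s (s.setReg x v) := by
  refine ⟨fun y hy => ?_, fun _ _ => rfl, fun _ => rfl⟩
  have : y ≠ x := fun e => hy (e ▸ hx)
  simp [this]

theorem frame (p : Block) (s : Store) : Frame p s (p.denote s) := by
  induction p generalizing s with
  | skip => exact Frame.refl _ _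
  | const x c => exact Frame.setReg s (by simp [writes])
  | copy x y => exact Frame.setReg s (by simp [writes])
  | incr x => exact Frame.setReg s (by simp [writes])
  | decr x => exact Frame.setReg s (by simp [writes])
  | load x a y => exact Frame.setReg s (by simp [writes])
  | store a x y =>
    refine ⟨fun _ _ => rfl, fun b hb => ?_, fun _ => rfl⟩
    exact Store.setMem_mem_of_ne _ _ _ (by simpa [memWrites] using hb)
  | write x => exact ⟨fun _ _ => rfl, fun _ _ => rfl, fun h => by simp [Silent] at h⟩
  | seq p q ihp ihq => exact (ihp s).seq_left.trans (ihq _).seq_right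
  | cond x y p q ihp ihq =>
    have h1 : Frame (p.seq q) s ((cond x y p q).denote s) := by
      rw [denote]
      split_ifs
      · exact (ihp s).seq_left
      · exact (ihq s).seq_right
    exact ⟨h1.reg, h1.mem, h1.out⟩
  | each x p ih =>
    rw [denote]
    refine Frame.trans ?_ (Frame.setReg _ (by simp [writes]))
    generalize List.range (s.reg 0) = l
    induction l generalizing s with
    | nil => exact Frame.refl _ _
    | cons i l ihl =>
      rw [List.foldl_cons]
      exact ((Frame.setReg s (by simp [writes])).trans (ih _).body).trans (ihl _)

/-- Loop invariants. -/
theorem denote_each {p : Block} {x : ℕ} {s : Store} (I : ℕ → Store → Prop) (h0 : I 0 s)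
    (hstep : ∀ i < s.reg 0, ∀ s', Frame (p.each x) s s' → I i s' →
      I (i + 1) (p.denote (s'.setReg x i))) :
    ∃ s', Frame (p.each x) s s' ∧ I (s.reg 0) s' ∧
      (p.each x).denote s = s'.setReg x (s.reg 0) := by
  have key : ∀ k ≤ s.reg 0, ∃ s', Frame (p.each x) s s' ∧ I k s' ∧
      (List.range k).foldl (fun s i => p.denote (s.setReg x i)) s = s' := by
    intro k hk
    induction k with
    | zero => exact ⟨s, Frame.refl _ _, h0, rfl⟩
    | succ k ih =>
      obtain ⟨s', h1, h2, h3⟩ := ih (by omega)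
      refine ⟨p.denote (s'.setReg x k), ?_, hstep k (by omega) s' h1 h2, ?_⟩
      · exact h1.trans ((Frame.setReg s' (by simp [writes])).trans (frame p _).body)
      · rw [List.range_succ, List.foldl_append, h3]; rfl
  obtain ⟨s', h1, h2, h3⟩ := key _ le_rfl
  exact ⟨s', h1, h2, by rw [denote, h3]⟩

theorem runs_compile {p : Block} (hp : p.Safe = true) (h0 : 0 ∉ p.writes) (s : Store) :
    ∃ t ≤ p.cost (s.reg 0), Runs p.compile s (p.denote s) t := by
  induction p generalizing s with
  | skip => exact ⟨1, le_rfl, .skip s⟩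
  | const x c => exact ⟨1, le_rfl, .const s x c⟩
  | copy x y => exact ⟨1, le_rfl, .copy s x y⟩
  | incr x => exact ⟨1, le_rfl, .incr s x⟩
  | decr x => exact ⟨1, le_rfl, .decr s x⟩
  | load x a y => exact ⟨1, le_rfl, .load s x a y⟩
  | store a x y => exact ⟨1, le_rfl, .store s a x y⟩
  | write x => exact ⟨1, le_rfl, .write s x⟩
  | seq p q ihp ihq =>
    simp only [Safe, Bool.and_eq_true] at hp
    simp only [writes, List.mem_append, not_or] at h0
    obtain ⟨t, ht, hr⟩ := ihp hp.1 h0.1 s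
    obtain ⟨t', ht', hr'⟩ := ihq hp.2 h0.2 (p.denote s)
    rw [(frame p s).reg 0 h0.1] at ht'
    exact ⟨t + t', by simp only [cost]; omega, .seq hr hr'⟩
  | cond x y p q ihp ihq =>
    simp only [Safe, Bool.and_eq_true] at hp
    simp only [writes, List.mem_append, not_or] at h0
    by_cases h : s.reg x < s.reg y
    · obtain ⟨t, ht, hr⟩ := ihp hp.1 h0.1 s
      refine ⟨t + 1, by simp only [cost]; omega, ?_⟩
      rw [denote, if_pos h]
      exact .cond_true h hr
    · obtain ⟨t, ht, hr⟩ := ihq hp.2 h0.2 s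
      refine ⟨t + 1, by simp only [cost]; omega, ?_⟩
      rw [denote, if_neg h]
      exact .cond_false h hr
  | each x p ih =>
    simp only [Safe, Bool.and_eq_true, decide_eq_true_eq] at hp
    simp only [writes, List.mem_cons, not_or] at h0
    obtain ⟨hx, hp⟩ := hp
    obtain ⟨hx0, h0⟩ := h0
    set n := s.reg 0 with hn
    set F : ℕ → Store := fun k =>
      (List.range k).foldl (fun s i => p.denote (s.setReg x i)) s with hF
    have hsucc : ∀ k, F (k + 1) = p.denote ((F k).setReg x k) := by
      intro k
      simp only [hF, List.range_succ, List.foldl_append, List.foldl_cons, List.foldl_nil]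
    have hreg : ∀ k, (F k).reg 0 = n := by
      intro k
      induction k with
      | zero => rfl
      | succ k ih => rw [hsucc, (frame p _).reg 0 h0, Store.setReg_reg, if_neg hx0, ih]
    have key : ∀ j k, k + j = n → ∃ t ≤ j * (p.cost n + 2) + 1,
        Runs (.loop x 0 (.seq p.compile (.incr x))) ((F k).setReg x k) ((F n).setReg x n) t := by
      intro j
      induction j with
      | zero =>
        rintro k rfl
        refine ⟨1, by omega, .loop_false ?_⟩
        simp [hreg, hx0]
      | succ j ihj =>
        intro k hk
        obtain ⟨t, ht, hr⟩ := ih hp h0 ((F k).setReg x k)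
        obtain ⟨t', ht', hr'⟩ := ihj (k + 1) (by omega)
        rw [Store.setReg_reg, if_neg hx0, hreg] at ht
        rw [← hsucc] at hr
        have hxk : (F (k + 1)).reg x = k := by
          rw [hsucc, (frame p _).reg x hx]; simp
        have hi := Runs.incr (F (k + 1)) x
        rw [hxk] at hi
        refine ⟨t + 1 + t' + 1, ?_, .loop_true ?_ (.seq hr hi) hr'⟩
        · rw [Nat.succ_mul]; omega
        · simp only [Store.setReg_reg, if_true, if_neg hx0, hreg]; omega
    obtain ⟨t, ht, hr⟩ := key n 0 (by omega)
    refine ⟨1 + t, by simp only [cost]; omega, ?_⟩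
    rw [denote]
    exact .seq (.const s x 0) hr

theorem cost_le (p : Block) : ∃ c d : ℕ, ∀ n, p.cost n ≤ c * (n + 1) ^ d := by
  have hone : ∃ c d : ℕ, ∀ n, 1 ≤ c * (n + 1) ^ d := ⟨1, 0, fun n => by simp⟩
  have hadd : ∀ p q : Block, (∃ c d : ℕ, ∀ n, p.cost n ≤ c * (n + 1) ^ d) →
      (∃ c d : ℕ, ∀ n, q.cost n ≤ c * (n + 1) ^ d) →
      ∃ c d : ℕ, ∀ n, p.cost n + q.cost n + 1 ≤ c * (n + 1) ^ d := by
    rintro p q ⟨c, d, h⟩ ⟨c', d', h'⟩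
    refine ⟨c + c' + 1, d + d', fun n => ?_⟩
    have h1 : (n + 1) ^ d ≤ (n + 1) ^ (d + d') := Nat.pow_le_pow_right (by omega) (by omega)
    have h2 : (n + 1) ^ d' ≤ (n + 1) ^ (d + d') := Nat.pow_le_pow_right (by omega) (by omega)
    have h3 : 1 ≤ (n + 1) ^ (d + d') := Nat.one_le_pow _ _ (by omega)
    have h4 := (h n).trans (Nat.mul_le_mul_left c h1)
    have h5 := (h' n).trans (Nat.mul_le_mul_left c' h2)
    rw [Nat.add_mul, Nat.add_mul]
    omega
  induction p with
  | seq p q ihp ihq =>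
    obtain ⟨c, d, h⟩ := hadd p q ihp ihq
    exact ⟨c, d, fun n => by have := h n; simp only [cost]; omega⟩
  | cond x y p q ihp ihq => exact hadd p q ihp ihq
  | each x p ih =>
    obtain ⟨c, d, h⟩ := ih
    refine ⟨c + 4, d + 1, fun n => ?_⟩
    have h3 : 1 ≤ (n + 1) ^ d := Nat.one_le_pow _ _ (by omega)
    have h4 := Nat.mul_le_mul_left (n + 1) (h n)
    have h5 := Nat.mul_le_mul_left (n + 1) h3
    have h6 : (c + 4) * (n + 1) ^ (d + 1) =
        (n + 1) * (c * (n + 1) ^ d) + 4 * ((n + 1) * (n + 1) ^ d) := by ring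
    have h7 : n * (p.cost n + 2) ≤ (n + 1) * p.cost n + 2 * (n + 1) := by nlinarith
    simp only [cost]
    rw [h6]
    omega
  | _ => exact hone

end Block
/-! ### Searching and counting -/

namespace Block

/-- Register `12` becomes `1` if it agrees with register `c`, and `0` otherwise. -/
def eqTest (c : ℕ) : Block :=
  cond 12 c (const 12 0) (cond c 12 (const 12 0) (const 12 1))

/-- Search for the number `x` of a vertex such that `test` makes register `12` positive. Register
`f` receives the last such number, or `n` if there is none. -/
def search (x f : ℕ) (test : Block) : Block :=
  copy f 0 ;; each x (test ;; cond 8 12 (copy f x) skip)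

/-- Increase register `f` by the number of vertices for which `test` makes register `12`
positive. -/
def count (x f : ℕ) (test : Block) : Block :=
  each x (test ;; cond 8 12 (incr f) skip)

theorem denote_eqTest (c : ℕ) (s : Store) :
    ((eqTest c).denote s).reg 12 = if s.reg 12 = s.reg c then 1 else 0 := by
  simp only [eqTest, denote]
  rcases lt_trichotomy (s.reg 12) (s.reg c) with h | h | h
  · rw [if_pos h, if_neg h.ne]; simp
  · rw [if_neg (by omega), if_neg (by omega), if_pos h]; simp
  · rw [if_neg (by omega), if_pos h, if_neg (by omega)]; simp

theorem denote_search {x f n : ℕ} {test : Block} {s : Store} {P : Fin n → Prop}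
    (K : (ℕ → ℕ → ℕ) → Prop) (hn : s.reg 0 = n) (h8 : s.reg 8 = 0) (hK : K s.mem)
    (hw : ([0, 8, x, f].all fun y => !test.writes.contains y) = true)
    (hd : [0, 8, 12, x, f].Nodup)
    (htest : ∀ (i : Fin n) (s' : Store), Frame (search x f test) s s' → K s'.mem →
      s'.reg x = i → K (test.denote s').mem ∧ (0 < (test.denote s').reg 12 ↔ P i)) :
    K ((search x f test).denote s).mem ∧
      ((((search x f test).denote s).reg f = n ∧ ∀ i, ¬ P i) ∨
        ∃ i : Fin n, ((search x f test).denote s).reg f = i ∧ P i) := by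
  have hwr : ∀ y ∈ [0, 8, x, f], y ∉ test.writes := by simpa using hw
  simp only [List.nodup_cons, List.mem_cons, List.not_mem_nil, or_false, not_or,
    not_false_eq_true, List.nodup_nil, and_true] at hd
  obtain ⟨⟨-, -, h0x, h0f⟩, ⟨-, h8x, h8f⟩, ⟨h12x, h12f⟩, hxf⟩ := hd
  set s₁ := s.setReg f (s.reg 0) with hs₁
  have hs₁n : s₁.reg 0 = n := by simp [hs₁, hn]
  have hF₁ : Frame (search x f test) s s₁ := (frame (copy f 0) s).seq_left
  obtain ⟨s₂, hF, hI, hEq⟩ := denote_each (p := test ;; cond 8 12 (copy f x) skip) (x := x)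
    (s := s₁) (fun k s' => K s'.mem ∧ ((s'.reg f = n ∧ ∀ i : Fin n, (i : ℕ) < k → ¬ P i) ∨
      ∃ i : Fin n, s'.reg f = i ∧ P i)) ⟨hK, Or.inl ⟨by simp [hs₁, hn], by simp⟩⟩ (by
      rintro k hk s' hs' ⟨hK', hI⟩
      have hFs' : Frame (search x f test) s (s'.setReg x k) :=
        hF₁.trans (hs'.trans (Frame.setReg s' (by simp [writes]))).seq_right
      rw [hs₁n] at hk
      obtain ⟨hK'', ht⟩ := htest ⟨k, hk⟩ (s'.setReg x k) hFs' hK' (by simp)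
      have hft := frame test (s'.setReg x k)
      have r8 : (test.denote (s'.setReg x k)).reg 8 = 0 := by
        rw [hft.reg 8 (hwr 8 (by simp)), hFs'.reg 8, h8]
        have := hwr 8 (by simp)
        simp [search, writes, h8x, h8f, this]
      have rx : (test.denote (s'.setReg x k)).reg x = k := by
        rw [hft.reg x (hwr x (by simp))]; simp
      have rf : (test.denote (s'.setReg x k)).reg f = s'.reg f := by
        rw [hft.reg f (hwr f (by simp))]; simp [Ne.symm hxf]
      simp only [denote, r8]
      split_ifs with hc
      · refine ⟨hK'', Or.inr ⟨⟨k, hk⟩, by simp [rx], ht.1 hc⟩⟩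
      · refine ⟨hK'', ?_⟩
        rw [rf]
        rcases hI with ⟨h1, h2⟩ | h1
        · refine Or.inl ⟨h1, fun i hi => ?_⟩
          rcases Nat.lt_succ_iff_lt_or_eq.1 hi with hi | hi
          · exact h2 i hi
          · have : i = ⟨k, hk⟩ := Fin.ext hi
            rw [this]; exact fun hP => hc (ht.2 hP)
        · exact Or.inr h1)
  have hEq' : (search x f test).denote s = s₂.setReg x (s₁.reg 0) := hEq
  rw [hEq', hs₁n] at *
  refine ⟨hI.1, ?_⟩
  simp only [Store.setReg_reg, if_neg (Ne.symm hxf)]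
  rcases hI.2 with ⟨h1, h2⟩ | h1
  · exact Or.inl ⟨h1, fun i => h2 i i.2⟩
  · exact Or.inr h1

theorem denote_count {x f n : ℕ} {test : Block} {s : Store} {P : Fin n → Prop} [DecidablePred P]
    (hn : s.reg 0 = n) (h8 : s.reg 8 = 0)
    (hw : ([0, 8, x, f].all fun y => !test.writes.contains y) = true)
    (hd : [0, 8, 12, x, f].Nodup)
    (htest : ∀ (i : Fin n) (s' : Store), Frame (count x f test) s s' →
      s'.reg x = i → (0 < (test.denote s').reg 12 ↔ P i)) :
    ((count x f test).denote s).reg f = s.reg f + (Finset.univ.filter P).card := by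
  have hwr : ∀ y ∈ [0, 8, x, f], y ∉ test.writes := by simpa using hw
  simp only [List.nodup_cons, List.mem_cons, List.not_mem_nil, or_false, not_or,
    not_false_eq_true, List.nodup_nil, and_true] at hd
  obtain ⟨⟨-, -, h0x, h0f⟩, ⟨-, h8x, h8f⟩, ⟨h12x, h12f⟩, hxf⟩ := hd
  obtain ⟨s₂, hF, hI, hEq⟩ := denote_each (p := test ;; cond 8 12 (incr f) skip) (x := x)
    (s := s) (fun k s' => s'.reg f = s.reg f +
      (Finset.univ.filter fun i : Fin n => (i : ℕ) < k ∧ P i).card) (by simp) (by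
      intro k hk s' hs' hI
      have hFs' : Frame (count x f test) s (s'.setReg x k) :=
        hs'.trans (Frame.setReg s' (by simp [writes]))
      rw [hn] at hk
      have ht := htest ⟨k, hk⟩ (s'.setReg x k) hFs' (by simp)
      have hft := frame test (s'.setReg x k)
      have r8 : (test.denote (s'.setReg x k)).reg 8 = 0 := by
        rw [hft.reg 8 (hwr 8 (by simp)), hFs'.reg 8, h8]
        have := hwr 8 (by simp)
        simp [count, writes, h8x, h8f, this]
      have rf : (test.denote (s'.setReg x k)).reg f = s'.reg f := by
        rw [hft.reg f (hwr f (by simp))]; simp [Ne.symm hxf]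
      simp only [denote, r8]
      split_ifs with hc
      · have : (Finset.univ.filter fun i : Fin n => (i : ℕ) < k + 1 ∧ P i) =
            insert ⟨k, hk⟩ (Finset.univ.filter fun i : Fin n => (i : ℕ) < k ∧ P i) := by
          ext i
          simp only [Finset.mem_insert, Finset.mem_filter, Finset.mem_univ, true_and,
            Nat.lt_succ_iff_lt_or_eq, Fin.ext_iff]
          constructor
          · tauto
          · rintro (h | h)
            · have : i = ⟨k, hk⟩ := Fin.ext h
              exact ⟨Or.inr h, this ▸ ht.1 hc⟩
            · tauto
        rw [this, Finset.card_insert_of_notMem (by simp)]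
        simp only [Store.setReg_reg, if_true, rf, hI]
        omega
      · rw [rf, hI]
        congr 2
        ext i
        simp only [Finset.mem_filter, Finset.mem_univ, true_and, Nat.lt_succ_iff_lt_or_eq]
        constructor
        · tauto
        · rintro ⟨h | h, hP⟩
          · exact ⟨h, hP⟩
          · have : i = ⟨k, hk⟩ := Fin.ext h
            exact absurd (ht.2 (this ▸ hP)) hc)
  have hEq' : (count x f test).denote s = s₂.setReg x (s.reg 0) := hEq
  rw [hEq', Store.setReg_reg, if_neg (Ne.symm hxf), hI, hn]
  simp

end Block

/-! ### The memory layout of the program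

Register `0` holds the number `n` of vertices and register `8` holds `0`; registers `1` to `7`
hold the codes of the labels, and register `9` holds the root. The stack of nodes of the search
tree that have not been visited is in memory `2`, where each node takes up `n` cells, and register
`10` points to its end. The current node is in memory `3`, and memory `4` holds marks of vertices.
Registers from `11` on are auxiliary: `11`, `14`, `15`, `21`, `22` and `23` are counters of loops,
`12` receives the results of tests, `13` is an address, `16` holds the vertex being scanned, and
`17` to `20` and `24` hold results of searches and counts.-/

end RAM

/-- The number that represents a label in the memory of the machine. -/
def Status.code : Status → ℕ
  | free => 0
  | excluded => 1
  | waiting => 2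
  | pending => 3
  | met => 4
  | seeking => 5
  | served => 6
  | done => 7

/-- The register that permanently holds the code of a label. -/
def Status.register : Status → ℕ
  | free => 8
  | s => s.code

theorem Status.code_injective : Function.Injective Status.code := by
  intro a b h
  cases a <;> cases b <;> first | rfl | (simp [Status.code] at h)

namespace RAM

local infixr:60 " ;; " => Block.seq

/-- The part of the store that never changes after the initialization. -/
structure Env {n : ℕ} (G : SimpleGraph (Fin n)) (T : Finset (Fin n)) (r : Fin n) (s : Store) :
    Prop where
  size : s.reg 0 = n
  label : ∀ c : Status, s.reg c.register = c.code
  root : s.reg 9 = r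
  adj : s.mem 0 = (inputStore G T).mem 0
  terminal : s.mem 1 = (inputStore G T).mem 1

/-- Memory `3` holds the node `σ`. -/
def Holds {n : ℕ} (s : Store) (σ : Fin n → Status) : Prop :=
  ∀ i : Fin n, s.mem 3 i = (σ i).code

/-- The cells of `m` below `top` contain the nodes of a list, its first element on top. -/
def OnStack {n : ℕ} (m : ℕ → ℕ) : ℕ → List (Fin n → Status) → Prop
  | top, [] => top = 0
  | top, σ :: l => ∃ top', top = top' + n ∧ (∀ i : Fin n, m (top' + i) = (σ i).code) ∧
      OnStack m top' l

/-- The block leaves alone what belongs to `Env`. -/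
def Block.Local (p : Block) : Bool :=
  p.writes.all (10 ≤ ·) && p.memWrites.all (2 ≤ ·)

section Layout

variable {n : ℕ} {G : SimpleGraph (Fin n)} {T : Finset (Fin n)} {r : Fin n} {s s' : Store}
  {σ : Fin n → Status} {l : List (Fin n → Status)}

theorem Env.zero (h : Env G T r s) : s.reg 8 = 0 := h.label .free

theorem Env.one (h : Env G T r s) : s.reg 1 = 1 := h.label .excluded

theorem Env.of_frame {p : Block} (h : Env G T r s) (hf : p.Frame s s')
    (hp : p.Local = true := by rfl) : Env G T r s' := by
  simp only [Block.Local, Bool.and_eq_true, List.all_eq_true, decide_eq_true_eq] at hp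
  have hreg : ∀ x < 10, s'.reg x = s.reg x := fun x hx =>
    hf.reg x fun hm => absurd (hp.1 x hm) (by omega)
  have hmem : ∀ a < 2, s'.mem a = s.mem a := fun a ha =>
    hf.mem a fun hm => absurd (hp.2 a hm) (by omega)
  refine ⟨by rw [hreg 0 (by omega), h.size], fun c => ?_, by rw [hreg 9 (by omega), h.root],
    by rw [hmem 0 (by omega), h.adj], by rw [hmem 1 (by omega), h.terminal]⟩
  rw [hreg _ (by cases c <;> decide), h.label]

theorem Env.denote {p : Block} (h : Env G T r s) (hp : p.Local = true := by rfl) :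
    Env G T r (p.denote s) :=
  h.of_frame (Block.frame p s) hp

theorem inputStore_terminal (G : SimpleGraph (Fin n)) (T : Finset (Fin n)) (i : Fin n) :
    (inputStore G T).mem 1 i = if i ∈ T then 1 else 0 := by
  simp only [inputStore]
  norm_num
  congr 1
  rw [eq_iff_iff]
  constructor
  · rintro ⟨j, hj, hjT⟩
    rwa [Fin.ext hj]
  · exact fun hi => ⟨i, rfl, hi⟩

theorem Env.terminal_apply (h : Env G T r s) (i : Fin n) :
    s.mem 1 i = if i ∈ T then 1 else 0 := by
  rw [h.terminal, inputStore_terminal]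

open Classical in
theorem Env.adj_apply (h : Env G T r s) (i j : Fin n) :
    s.mem 0 (i * n + j) = if G.Adj i j then 1 else 0 := by
  rw [h.adj]
  simp only [inputStore, if_true]
  congr 1
  rw [eq_iff_iff]
  constructor
  · rintro ⟨i', j', he, hij⟩
    have hn : 0 < n := i.pos
    have hmod : ∀ a b : Fin n, ((a : ℕ) * n + b) % n = b ∧ ((a : ℕ) * n + b) / n = a := by
      intro a b
      constructor
      · rw [Nat.mul_comm, Nat.mul_add_mod, Nat.mod_eq_of_lt b.2]
      · rw [Nat.mul_comm, Nat.mul_add_div hn, Nat.div_eq_of_lt b.2, Nat.add_zero]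
    have h1 : i = i' := Fin.ext (by rw [← (hmod i j).2, he, (hmod i' j').2])
    have h2 : j = j' := Fin.ext (by rw [← (hmod i j).1, he, (hmod i' j').1])
    rwa [h1, h2]
  · exact fun hij => ⟨i, j, rfl, hij⟩

theorem OnStack.congr {m m' : ℕ → ℕ} {top : ℕ} (h : OnStack m top l)
    (hm : ∀ j < top, m' j = m j) : OnStack m' top l := by
  induction l generalizing top with
  | nil => exact h
  | cons σ l ih =>
    obtain ⟨top', rfl, h1, h2⟩ := h
    exact ⟨top', rfl, fun i => by rw [hm _ (by omega), h1], ih h2 fun j hj => hm j (by omega)⟩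

theorem Holds.setMem {u : Fin n} (h : Holds s σ) (c : Status) :
    Holds (s.setMem 3 u c.code) (Function.update σ u c) := by
  intro i
  rw [Store.setMem_mem_self]
  rcases eq_or_ne i u with rfl | hi
  · simp
  · rw [Function.update_of_ne hi, Function.update_of_ne (fun e => hi (Fin.ext e)), h i]

theorem Holds.of_mem_eq (h : Holds s σ) (hm : s'.mem 3 = s.mem 3) : Holds s' σ := fun i => by
  rw [hm, h i]

end Layout

/-! ### The parts of the program -/

namespace Block

/-- Register `12` becomes `1` if the vertices in registers `v` and `u` are adjacent, and `0`
otherwise. The address `v * n + u` is computed by counting. -/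
def adjTest (v u : ℕ) : Block :=
  const 13 0 ;; each 14 (cond 14 v (each 15 (incr 13)) skip) ;;
    each 14 (cond 14 u (incr 13) skip) ;; load 12 0 13

/-- Test whether the vertex in register `x` has the label `c`. -/
def hasLabel (x : ℕ) (c : Status) : Block := load 12 3 x ;; eqTest c.register

/-- Test whether the vertex in register `11` has the label `c` and is next to the vertex being
scanned. -/
def nextWithLabel (c : Status) : Block := hasLabel 11 c ;; cond 8 12 (adjTest 16 11) skip

/-- Give the label `c` to the vertex in register `x`. -/
def setLabel (x : ℕ) (c : Status) : Block := store 3 x c.register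

/-- Put the current node on the stack. -/
def push : Block := each 11 (load 12 3 11 ;; store 2 10 12 ;; incr 10)

/-- Take the current node from the stack. -/
def pop : Block :=
  each 11 (decr 10) ;; copy 13 10 ;; each 11 (load 12 2 13 ;; store 3 11 12 ;; incr 13)

end Block

section Parts

open Block

variable {n : ℕ} {G : SimpleGraph (Fin n)} {T : Finset (Fin n)} {r : Fin n} {s s' : Store}
  {σ : Fin n → Status} {l : List (Fin n → Status)}

open Classical in
theorem denote_adjTest (h : Env G T r s) {v u : ℕ} (hv : v ∉ [13, 14, 15]) (hu : u ∉ [13, 14, 15])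
    {i j : Fin n} (hi : s.reg v = i) (hj : s.reg u = j) :
    ((adjTest v u).denote s).reg 12 = if G.Adj i j then 1 else 0 := by
  simp only [List.mem_cons, List.not_mem_nil, or_false, not_or] at hv hu
  obtain ⟨hv3, hv4, hv5⟩ := hv
  obtain ⟨hu3, hu4, hu5⟩ := hu
  have hin := i.2
  have hjn := j.2
  have inner : ∀ s : Store, s.reg 0 = n →
      ((each 15 (incr 13)).denote s).reg 13 = s.reg 13 + n := by
    intro s hs
    obtain ⟨s', hF, hI, hEq⟩ := denote_each (p := incr 13) (x := 15) (s := s)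
      (fun k s' => s'.reg 13 = s.reg 13 + k) (by simp) (by
        intro k _ s' _ hI
        simp only [Block.denote, Store.setReg_reg]
        simp [hI]; omega)
    rw [hEq]; simp [hI, hs]
  set s₁ := (const 13 0).denote s with hs₁
  have h1r : ∀ x, x ≠ 13 → s₁.reg x = s.reg x := by intro x hx; simp [hs₁, Block.denote, hx]
  obtain ⟨s₂, hF₂, hI₂, hEq₂⟩ := denote_each (p := cond 14 v (each 15 (incr 13)) skip) (x := 14)
    (s := s₁) (fun k s' => s'.reg 13 = min k i * n) (by simp [hs₁, Block.denote]) (by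
      intro k hk s' hF hI
      have hv' : (s'.setReg 14 k).reg v = i := by
        rw [Store.setReg_reg, if_neg hv4, hF.reg v (by simp [writes]; tauto), h1r v hv3, hi]
      have h0' : (s'.setReg 14 k).reg 0 = n := by
        rw [Store.setReg_reg, if_neg (by omega), hF.reg 0 (by simp [writes]), h1r 0 (by omega),
          h.size]
      rw [denote, hv']
      simp only [Store.setReg_reg, if_true]
      split_ifs with hc
      · rw [inner _ h0']
        simp only [Store.setReg_reg]
        rw [if_neg (by omega), hI, Nat.min_eq_left hc.le, Nat.min_eq_left hc, Nat.succ_mul]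
      · simp only [denote, Store.setReg_reg]
        rw [if_neg (by omega), hI, Nat.min_eq_right (by omega), Nat.min_eq_right (by omega)])
  have hs₁0 : s₁.reg 0 = n := by rw [h1r 0 (by omega), h.size]
  set s₃ := (each 14 (cond 14 v (each 15 (incr 13)) skip)).denote s₁ with hs₃
  have h3r : ∀ x, x ≠ 13 → x ≠ 14 → x ≠ 15 → s₃.reg x = s.reg x := by
    intro x h13 h14 h15
    rw [hs₃, (frame _ _).reg x (by simp [writes]; tauto), h1r x h13]
  have h3 : s₃.reg 13 = i * n := by
    rw [hEq₂]
    simp only [Store.setReg_reg]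
    rw [if_neg (by omega), hI₂, hs₁0, Nat.min_eq_right hin.le]
  obtain ⟨s₄, hF₄, hI₄, hEq₄⟩ := denote_each (p := cond 14 u (incr 13) skip) (x := 14)
    (s := s₃) (fun k s' => s'.reg 13 = i * n + min k j) (by simp [h3]) (by
      intro k hk s' hF hI
      have hu' : (s'.setReg 14 k).reg u = j := by
        rw [Store.setReg_reg, if_neg hu4, hF.reg u (by simp [writes]; tauto), h3r u hu3 hu4 hu5,
          hj]
      rw [denote, hu']
      simp only [Store.setReg_reg, if_true]
      split_ifs with hc
      · simp only [denote, Store.setReg_reg]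
        simp only [if_true]
        rw [if_neg (by omega), hI, Nat.min_eq_left hc.le, Nat.min_eq_left hc, Nat.add_assoc]
      · simp only [denote, Store.setReg_reg]
        rw [if_neg (by omega), hI, Nat.min_eq_right (by omega), Nat.min_eq_right (by omega)])
  have hfin : (adjTest v u).denote s = (load 12 0 13).denote
      ((each 14 (cond 14 u (incr 13) skip)).denote s₃) := rfl
  have hs₃0 : s₃.reg 0 = n := by rw [h3r 0 (by omega) (by omega) (by omega), h.size]
  have h4m : s₄.mem 0 = s.mem 0 := by
    rw [hF₄.mem 0 (by simp [memWrites]), hs₃, (frame _ _).mem 0 (by simp [memWrites])]; rfl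
  rw [hfin, hEq₄]
  simp only [denote, Store.setReg_reg, Store.setReg_mem, if_true]
  rw [if_neg (by omega), hI₄, hs₃0, Nat.min_eq_right hjn.le, h4m, h.adj_apply]

theorem denote_hasLabel (h : Env G T r s) (hσ : Holds s σ) {x : ℕ} {i : Fin n} (hi : s.reg x = i)
    (c : Status) : ((hasLabel x c).denote s).reg 12 = if σ i = c then 1 else 0 := by
  rw [hasLabel, denote, denote_eqTest]
  have hc : c.register ≠ 12 := by cases c <;> decide
  simp only [denote, Store.setReg_reg, if_true, if_neg hc, hi, hσ i, h.label,
    Status.code_injective.eq_iff]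

theorem denote_nextWithLabel (h : Env G T r s) (hσ : Holds s σ) {v i : Fin n} (hv : s.reg 16 = v)
    (hi : s.reg 11 = i) (c : Status) :
    0 < ((nextWithLabel c).denote s).reg 12 ↔ G.Adj v i ∧ σ i = c := by
  have h1 := denote_hasLabel h hσ hi c
  have hF := frame (hasLabel 11 c) s
  have hE : Env G T r ((hasLabel 11 c).denote s) := h.denote
  have h16 : ((hasLabel 11 c).denote s).reg 16 = v := by
    rw [hF.reg 16 (by simp [hasLabel, eqTest, writes]), hv]
  have h11 : ((hasLabel 11 c).denote s).reg 11 = i := by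
    rw [hF.reg 11 (by simp [hasLabel, eqTest, writes]), hi]
  rw [nextWithLabel, denote, denote, hE.zero, h1]
  by_cases hc : σ i = c
  · rw [if_pos hc, if_pos (by omega), denote_adjTest hE (by decide) (by decide) h16 h11]
    by_cases ha : G.Adj v i <;> simp [ha, hc]
  · rw [if_neg hc, if_neg (by omega), denote, h1, if_neg hc]
    simp [hc]

theorem denote_setLabel (h : Env G T r s) {x : ℕ} {u : Fin n} (hu : s.reg x = u) (c : Status) :
    (setLabel x c).denote s = s.setMem 3 u c.code := by
  rw [setLabel, denote, hu, h.label]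

theorem OnStack.push (h : Env G T r s) (hσ : Holds s σ) (hl : OnStack (s.mem 2) (s.reg 10) l) :
    OnStack ((push.denote s).mem 2) ((push.denote s).reg 10) (σ :: l) := by
  obtain ⟨s', hF, hI, hEq⟩ := denote_each (p := load 12 3 11 ;; store 2 10 12 ;; incr 10)
    (x := 11) (s := s) (fun k s' => s'.reg 10 = s.reg 10 + k ∧
      (∀ j < s.reg 10, s'.mem 2 j = s.mem 2 j) ∧
      ∀ j < k, s'.mem 2 (s.reg 10 + j) = s.mem 3 j) (by simp) (by
      rintro k hk s' hF ⟨h1, h2, h3⟩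
      have hm : s'.mem 3 = s.mem 3 := hF.mem 3 (by simp [memWrites])
      simp only [denote, Store.setReg_reg, Store.setReg_mem, Store.setMem_reg,
        Store.setMem_mem_self]
      norm_num
      refine ⟨by omega, fun j hj => ?_, fun j hj => ?_⟩
      · rw [Function.update_of_ne (by omega), h2 j hj]
      · rcases Nat.lt_or_eq_of_le hj with hj | rfl
        · rw [Function.update_of_ne (by omega), h3 j hj]
        · rw [h1, Function.update_self, hm])
  have hEq' : Block.push.denote s = s'.setReg 11 (s.reg 0) := hEq
  rw [hEq', h.size] at *
  obtain ⟨h1, h2, h3⟩ := hI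
  simp only [Store.setReg_reg, Store.setReg_mem]
  refine ⟨s.reg 10, by simp [h1], fun i => ?_, hl.congr h2⟩
  rw [h3 i i.2, hσ i]

theorem denote_pop (h : Env G T r s) (hl : OnStack (s.mem 2) (s.reg 10) (σ :: l)) :
    Holds (pop.denote s) σ ∧ OnStack ((pop.denote s).mem 2) ((pop.denote s).reg 10) l := by
  obtain ⟨top, htop, hσ, hl⟩ := hl
  obtain ⟨s₁, hF₁, hI₁, hEq₁⟩ := denote_each (p := decr 10) (x := 11) (s := s)
    (fun k s' => s'.reg 10 = s.reg 10 - k) (by simp) (by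
      intro k hk s' hF hI
      simp only [denote, Store.setReg_reg]
      norm_num
      omega)
  set s₂ := (copy 13 10).denote ((each 11 (decr 10)).denote s) with hs₂
  have h2E : Env G T r s₂ := (h.denote (p := each 11 (decr 10))).denote
  have h10 : s₂.reg 10 = top := by
    rw [hs₂, hEq₁]
    simp only [denote, Store.setReg_reg]
    norm_num
    rw [hI₁, htop, h.size]; omega
  have h13 : s₂.reg 13 = top := by
    rw [← h10]
    simp [hs₂, denote]
  have hm2 : s₂.mem 2 = s.mem 2 := by
    rw [hs₂, (frame _ _).mem 2 (by simp [memWrites]), (frame _ _).mem 2 (by simp [memWrites])]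
  obtain ⟨s₃, hF₃, hI₃, hEq₃⟩ := denote_each (p := load 12 2 13 ;; store 3 11 12 ;; incr 13)
    (x := 11) (s := s₂) (fun k s' => s'.reg 13 = top + k ∧
      ∀ j < k, s'.mem 3 j = s.mem 2 (top + j)) (by simp [h13]) (by
      rintro k hk s' hF ⟨h1, h2⟩
      have hm : s'.mem 2 = s.mem 2 := by rw [hF.mem 2 (by simp [memWrites]), hm2]
      simp only [denote, Store.setReg_reg, Store.setReg_mem, Store.setMem_reg,
        Store.setMem_mem_self]
      norm_num
      refine ⟨by omega, fun j hj => ?_⟩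
      rcases Nat.lt_or_eq_of_le hj with hj | rfl
      · rw [Function.update_of_ne (by omega), h2 j hj]
      · rw [Function.update_self, hm, h1])
  have hEq' : Block.pop.denote s = s₃.setReg 11 (s₂.reg 0) := hEq₃
  rw [hEq']
  rw [h2E.size] at hI₃ ⊢
  refine ⟨fun i => ?_, ?_⟩
  · rw [Store.setReg_mem, hI₃.2 i i.2, hσ i]
  · simp only [Store.setReg_reg, Store.setReg_mem]
    norm_num
    rw [hF₃.reg 10 (by simp [writes]), hF₃.mem 2 (by simp [memWrites]), h10, hm2]
    exact hl

end Parts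

/-! ### The test for minimality -/

namespace Block

/-- Mark the vertex in register `11` if the one in register `23` is marked and adjacent to it, and
the vertex in register `11` is labelled `done`. -/
def relax : Block :=
  load 12 4 23 ;; cond 8 12 (hasLabel 11 .done ;; cond 8 12 (adjTest 23 11 ;;
    cond 8 12 (store 4 11 1) skip) skip) skip

/-- Mark the vertices that can be reached from the root through vertices labelled `done`. -/
def spread : Block :=
  each 11 (store 4 11 8) ;; store 4 9 1 ;; each 22 (each 23 (each 11 relax))

/-- Test whether the vertex in register `11` is a terminal without a mark. -/
def missed : Block := load 12 4 11 ;; cond 8 12 (const 12 0) (load 12 1 11)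

/-- Test whether all terminals can be reached from the root through vertices labelled `done` other
than the one in register `21`. -/
def avoidable : Block :=
  setLabel 21 .excluded ;; spread ;; search 11 24 missed ;; setLabel 21 .done ;;
    cond 24 0 (const 12 0) (const 12 1)

/-- Test whether the vertex in register `21` is a nonterminal labelled `done` which is not needed to
connect the terminals. -/
def superfluous : Block :=
  hasLabel 21 .done ;; cond 8 12 (load 12 1 21 ;; cond 8 12 (const 12 0) avoidable) skip

end Block

section Minimality

open Block

variable {n : ℕ} {G : SimpleGraph (Fin n)} {T : Finset (Fin n)} {r : Fin n} {s s' : Store}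
  {σ : Fin n → Status}

/-- The vertex `i` is marked in memory `4`. -/
def Marked (s : Store) (i : Fin n) : Prop := s.mem 4 i ≠ 0

theorem marked_denote_relax (h : Env G T r s) (hσ : Holds s σ) {i j : Fin n}
    (hi : s.reg 23 = i) (hj : s.reg 11 = j) (u : Fin n) :
    Marked (relax.denote s) u ↔ Marked s u ∨ u = j ∧ Marked s i ∧ σ j = .done ∧ G.Adj i j := by
  classical
  unfold Marked
  set s₁ := (load 12 4 23).denote s with hs₁
  have h₁ : Env G T r s₁ := h.denote
  have m₁ : s₁.mem = s.mem := rfl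
  have v₁ : s₁.reg 12 = s.mem 4 i := by simp [hs₁, Block.denote, hi]
  have i₁ : s₁.reg 23 = i := by simp [hs₁, Block.denote, hi]
  have j₁ : s₁.reg 11 = j := by simp [hs₁, Block.denote, hj]
  have hσ₁ : Holds s₁ σ := hσ.of_mem_eq (by rw [m₁])
  set s₂ := (hasLabel 11 .done).denote s₁ with hs₂
  have h₂ : Env G T r s₂ := h₁.denote
  have F₂ : Frame _ s₁ s₂ := frame (hasLabel 11 .done) s₁
  have m₂ : s₂.mem 4 = s.mem 4 := by rw [F₂.mem 4 (by decide), m₁]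
  have v₂ := denote_hasLabel h₁ hσ₁ j₁ .done
  rw [← hs₂] at v₂
  have i₂ : s₂.reg 23 = i := by rw [F₂.reg 23 (by decide), i₁]
  have j₂ : s₂.reg 11 = j := by rw [F₂.reg 11 (by decide), j₁]
  set s₃ := (adjTest 23 11).denote s₂ with hs₃
  have h₃ : Env G T r s₃ := h₂.denote
  have F₃ : Frame _ s₂ s₃ := frame (adjTest 23 11) s₂
  have m₃ : s₃.mem 4 = s.mem 4 := by rw [F₃.mem 4 (by decide), m₂]
  have v₃ := denote_adjTest h₂ (v := 23) (u := 11) (by decide) (by decide) i₂ j₂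
  rw [← hs₃] at v₃
  have j₃ : s₃.reg 11 = j := by rw [F₃.reg 11 (by decide), j₂]
  have hrelax : relax.denote s = if s₁.reg 8 < s₁.reg 12 then
      (if s₂.reg 8 < s₂.reg 12 then
        (if s₃.reg 8 < s₃.reg 12 then s₃.setMem 4 (s₃.reg 11) (s₃.reg 1) else s₃) else s₂)
      else s₁ := rfl
  rw [hrelax, h₁.zero, h₂.zero, h₃.zero, v₁, v₂, v₃, j₃, h₃.one]
  by_cases c1 : s.mem 4 i = 0
  · rw [if_neg (by omega), m₁]; simp [c1]
  rw [if_pos (by omega)]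
  by_cases c2 : σ j = .done
  swap
  · simp [c2, m₂]
  rw [if_pos (by simp [c2])]
  by_cases c3 : G.Adj i j
  swap
  · simp [c3, m₃]
  rw [if_pos (by simp [c3]), Store.setMem_mem_self, m₃]
  rcases eq_or_ne u j with rfl | huj
  · simp [c1, c2, c3]
  · rw [Function.update_of_ne (fun e => huj (Fin.ext e))]
    simp [huj]

/-- One round of relaxing all edges. -/
theorem marked_denote_round (h : Env G T r s) (hσ : Holds s σ) :
    (∀ u : Fin n, Marked s u → Marked ((each 23 (each 11 relax)).denote s) u) ∧
    (∀ i j : Fin n, Marked s i → G.Adj i j → σ j = .done →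
      Marked ((each 23 (each 11 relax)).denote s) j) ∧
    ((∀ u : Fin n, Marked s u → Reaches G (fun x => σ x = .done) r u) →
      ∀ u : Fin n, Marked ((each 23 (each 11 relax)).denote s) u →
        Reaches G (fun x => σ x = .done) r u) := by
  have inner : ∀ (s : Store), Env G T r s → Holds s σ → ∀ i : Fin n, s.reg 23 = i →
      (∀ u : Fin n, Marked s u → Marked ((each 11 relax).denote s) u) ∧
      (∀ j : Fin n, Marked s i → G.Adj i j → σ j = .done →
        Marked ((each 11 relax).denote s) j) ∧
      ((∀ u : Fin n, Marked s u → Reaches G (fun x => σ x = .done) r u) →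
        ∀ u : Fin n, Marked ((each 11 relax).denote s) u →
          Reaches G (fun x => σ x = .done) r u) := by
    intro s h hσ i hi
    obtain ⟨s', hF, hI, hEq⟩ := denote_each (p := relax) (x := 11) (s := s)
      (fun k s' => (∀ u : Fin n, Marked s u → Marked s' u) ∧
        (∀ j : Fin n, (j : ℕ) < k → Marked s i → G.Adj i j → σ j = .done → Marked s' j) ∧
        ((∀ u : Fin n, Marked s u → Reaches G (fun x => σ x = .done) r u) →
          ∀ u : Fin n, Marked s' u → Reaches G (fun x => σ x = .done) r u))
      ⟨fun _ => id, by simp, id⟩ (by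
        rintro k hk s' hF ⟨h1, h2, h3⟩
        rw [h.size] at hk
        have hF' : Frame (each 11 relax) s (s'.setReg 11 k) :=
          hF.trans (Frame.setReg s' (by decide))
        have hm := marked_denote_relax (h.of_frame hF') (hσ.of_mem_eq (hF'.mem 3 (by decide)))
          (i := i) (j := ⟨k, hk⟩) (by rw [hF'.reg 23 (by decide), hi]) (by simp)
        have hs' : ∀ u : Fin n, Marked (s'.setReg 11 k) u ↔ Marked s' u := fun u => Iff.rfl
        simp only [hs'] at hm
        refine ⟨fun u hu => (hm u).2 (Or.inl (h1 u hu)), fun j hj hi' hij hjd => ?_,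
          fun hR u hu => ?_⟩
        · rcases Nat.lt_succ_iff_lt_or_eq.1 hj with hj | hj
          · exact (hm j).2 (Or.inl (h2 j hj hi' hij hjd))
          · obtain rfl : j = ⟨k, hk⟩ := Fin.ext hj
            exact (hm _).2 (Or.inr ⟨rfl, h1 i hi', hjd, hij⟩)
        · rcases (hm u).1 hu with hu | ⟨rfl, hi', hd, hij⟩
          · exact h3 hR u hu
          · exact (h3 hR i hi').tail hij hd)
    have hM : ∀ u : Fin n, Marked ((each 11 relax).denote s) u ↔ Marked s' u := by
      intro u; rw [hEq]; rfl
    simp only [hM]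
    rw [h.size] at hI
    exact ⟨hI.1, fun j => hI.2.1 j j.2, hI.2.2⟩
  obtain ⟨s', hF, hI, hEq⟩ := denote_each (p := each 11 relax) (x := 23) (s := s)
    (fun k s' => (∀ u : Fin n, Marked s u → Marked s' u) ∧
      (∀ i j : Fin n, (i : ℕ) < k → Marked s i → G.Adj i j → σ j = .done → Marked s' j) ∧
      ((∀ u : Fin n, Marked s u → Reaches G (fun x => σ x = .done) r u) →
        ∀ u : Fin n, Marked s' u → Reaches G (fun x => σ x = .done) r u))
    ⟨fun _ => id, by simp, id⟩ (by
      rintro k hk s' hF ⟨h1, h2, h3⟩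
      rw [h.size] at hk
      have hF' : Frame (each 23 (each 11 relax)) s (s'.setReg 23 k) :=
        hF.trans (Frame.setReg s' (by decide))
      obtain ⟨m1, m2, m3⟩ := inner _ (h.of_frame hF') (hσ.of_mem_eq (hF'.mem 3 (by decide)))
        ⟨k, hk⟩ (by simp)
      have hs' : ∀ u : Fin n, Marked (s'.setReg 23 k) u ↔ Marked s' u := fun u => Iff.rfl
      simp only [hs'] at m1 m2 m3
      refine ⟨fun u hu => m1 u (h1 u hu), fun i j hi hiM hij hjd => ?_, fun hR => m3 (h3 hR)⟩
      rcases Nat.lt_succ_iff_lt_or_eq.1 hi with hi | hi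
      · exact m1 j (h2 i j hi hiM hij hjd)
      · obtain rfl : i = ⟨k, hk⟩ := Fin.ext hi
        exact m2 j (h1 _ hiM) hij hjd)
  have hM : ∀ u : Fin n, Marked ((each 23 (each 11 relax)).denote s) u ↔ Marked s' u := by
    intro u; rw [hEq]; rfl
  simp only [hM]
  rw [h.size] at hI
  exact ⟨hI.1, fun i j => hI.2.1 i j i.2, hI.2.2⟩

/-- As long as some reachable vertex has no mark, each round adds a mark. Hence `n` rounds
suffice. -/
theorem marked_denote_spread (h : Env G T r s) (hσ : Holds s σ) (u : Fin n) :
    Marked (spread.denote s) u ↔ Reaches G (fun x => σ x = .done) r u := by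
  classical
  obtain ⟨s₁, hF₁, hI₁, hEq₁⟩ := denote_each (p := store 4 11 8) (x := 11) (s := s)
    (fun k s' => ∀ j < k, s'.mem 4 j = 0) (by simp) (by
      intro k hk s' hF hI j hj
      have h8 : s'.reg 8 = 0 := by rw [hF.reg 8 (by decide), h.zero]
      simp only [denote, Store.setMem_mem_self, Store.setReg_reg, Store.setReg_mem]
      norm_num
      rcases Nat.lt_succ_iff_lt_or_eq.1 hj with hj | rfl
      · rw [Function.update_of_ne (by omega), hI j hj]
      · simp [h8])
  set s₂ := (store 4 9 1).denote ((each 11 (store 4 11 8)).denote s) with hs₂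
  have h₁ : Env G T r ((each 11 (store 4 11 8)).denote s) := h.denote
  have h₂ : Env G T r s₂ := h₁.denote
  have hσ₂ : Holds s₂ σ := hσ.of_mem_eq (by
    rw [hs₂, (frame _ _).mem 3 (by decide), (frame _ _).mem 3 (by decide)])
  have hmark₂ : ∀ u : Fin n, Marked s₂ u ↔ u = r := by
    intro u
    rw [Marked, hs₂, denote, h₁.root, h₁.one, Store.setMem_mem_self, hEq₁]
    rcases eq_or_ne u r with rfl | hur
    · simp
    · rw [Function.update_of_ne (fun e => hur (Fin.ext e)), Store.setReg_mem,
        hI₁ u (by rw [h.size]; exact u.2)]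
      simp [hur]
  obtain ⟨s₃, hF₃, hI₃, hEq₃⟩ := denote_each (p := each 23 (each 11 relax)) (x := 22) (s := s₂)
    (fun k s' => Marked s' r ∧
      (∀ u : Fin n, Marked s' u → Reaches G (fun x => σ x = .done) r u) ∧
      ((∀ u : Fin n, Reaches G (fun x => σ x = .done) r u → Marked s' u) ∨
        k < (Finset.univ.filter fun u : Fin n => Marked s' u).card))
    ⟨(hmark₂ r).2 rfl, fun u hu => by rw [(hmark₂ u).1 hu]; exact Reaches.refl _ _ _,
      Or.inr (Finset.card_pos.2 ⟨r, by simp [(hmark₂ r).2 rfl]⟩)⟩ (by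
      rintro k hk s' hF ⟨h1, h2, h3⟩
      have hF' : Frame (each 22 (each 23 (each 11 relax))) s₂ (s'.setReg 22 k) :=
        hF.trans (Frame.setReg s' (by decide))
      obtain ⟨m1, m2, m3⟩ := marked_denote_round (h₂.of_frame hF')
        (hσ₂.of_mem_eq (hF'.mem 3 (by decide)))
      have hs' : ∀ u : Fin n, Marked (s'.setReg 22 k) u ↔ Marked s' u := fun u => Iff.rfl
      simp only [hs'] at m1 m2 m3
      refine ⟨m1 r h1, m3 h2, ?_⟩
      by_cases hall : ∀ u : Fin n, Reaches G (fun x => σ x = .done) r u → Marked s' u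
      · exact Or.inl fun u hu => m1 u (hall u hu)
      · refine Or.inr ?_
        have h3 := h3.resolve_left hall
        -- an edge that leaves the set of marked vertices
        have hedge : ∃ i j : Fin n, Marked s' i ∧ G.Adj i j ∧ σ j = .done ∧ ¬ Marked s' j := by
          by_contra! hno
          refine hall fun u hu => ?_
          induction hu with
          | refl => exact h1
          | tail _ hbc ih => exact hno _ _ ih hbc.1 hbc.2
        obtain ⟨i, j, hi, hij, hjd, hj⟩ := hedge
        refine Nat.lt_of_le_of_lt h3 (Finset.card_lt_card ?_)
        refine Finset.ssubset_iff_of_subset (fun u hu => ?_) |>.2 ⟨j, ?_, ?_⟩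
        · simp only [Finset.mem_filter, Finset.mem_univ, true_and] at hu ⊢
          exact m1 u hu
        · simpa using m2 i j hi hij hjd
        · simpa using hj)
  have hM : Marked (spread.denote s) u ↔ Marked s₃ u := by
    have : spread.denote s = s₃.setReg 22 (s₂.reg 0) := hEq₃
    rw [this]; rfl
  rw [hM]
  refine ⟨hI₃.2.1 u, ?_⟩
  rcases hI₃.2.2 with hall | hlt
  · exact hall u
  · have hle := Finset.card_filter_le (Finset.univ : Finset (Fin n)) fun u => Marked s₃ u
    rw [h₂.size] at hlt
    rw [Finset.card_fin] at hle
    omega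

theorem denote_missed (h : Env G T r s) {i : Fin n} (hi : s.reg 11 = i) :
    0 < (missed.denote s).reg 12 ↔ i ∈ T ∧ ¬ Marked s i := by
  have h8 := h.zero
  simp only [missed, denote, Store.setReg_reg, Store.setReg_mem, Marked, hi]
  norm_num
  rw [h8]
  by_cases hm : s.mem 4 i = 0
  · simp only [hm, lt_self_iff_false, if_false, h.terminal_apply]
    split_ifs with hT <;> simp [hT]
  · rw [if_pos (by omega)]
    simp [hm]

theorem denote_avoidable (h : Env G T r s) (hσ : Holds s σ) {v : Fin n} (hv : s.reg 21 = v)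
    (hvd : σ v = .done) : (avoidable.denote s).mem 3 = s.mem 3 ∧
      (0 < (avoidable.denote s).reg 12 ↔
        ∀ t ∈ T, Reaches G (fun x => σ x = .done ∧ x ≠ v) r t) := by
  set s₁ := (setLabel 21 .excluded).denote s with hs₁
  have h₁ : Env G T r s₁ := h.denote
  have e₁ := denote_setLabel h hv .excluded
  rw [← hs₁] at e₁
  have hσ₁ : Holds s₁ (Function.update σ v .excluded) := by rw [e₁]; exact hσ.setMem _
  set s₂ := spread.denote s₁ with hs₂
  have h₂ : Env G T r s₂ := h₁.denote
  have F₂ : Frame _ s₁ s₂ := frame spread s₁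
  have hmark := marked_denote_spread h₁ hσ₁
  rw [← hs₂] at hmark
  set s₃ := (search 11 24 missed).denote s₂ with hs₃
  have h₃ : Env G T r s₃ := h₂.denote
  have F₃ : Frame _ s₂ s₃ := frame (search 11 24 missed) s₂
  obtain ⟨-, hsearch⟩ := denote_search (x := 11) (f := 24) (test := missed) (s := s₂)
    (P := fun i : Fin n => i ∈ T ∧ ¬ Marked s₂ i) (fun _ => True) h₂.size h₂.zero trivial rfl
    (by decide) (by
      intro i s' hF _ hi
      refine ⟨trivial, ?_⟩
      rw [denote_missed (h₂.of_frame hF) hi, Marked, Marked, hF.mem 4 (by decide)])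
  rw [← hs₃] at hsearch
  set s₄ := (setLabel 21 .done).denote s₃ with hs₄
  have h₄ : Env G T r s₄ := h₃.denote
  have v₃ : s₃.reg 21 = v := by
    rw [F₃.reg 21 (by decide), F₂.reg 21 (by decide), e₁, Store.setMem_reg, hv]
  have e₄ := denote_setLabel h₃ v₃ .done
  rw [← hs₄] at e₄
  have hfin : avoidable.denote s = if s₄.reg 24 < s₄.reg 0 then s₄.setReg 12 0
      else s₄.setReg 12 1 := rfl
  have hm₄ : s₄.mem 3 = s.mem 3 := by
    rw [e₄, Store.setMem_mem_self, F₃.mem 3 (by decide), F₂.mem 3 (by decide), e₁,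
      Store.setMem_mem_self, Function.update_idem, ← hvd, ← hσ v, Function.update_eq_self]
  have hr₄ : s₄.reg 24 = s₃.reg 24 := by rw [e₄]; rfl
  rw [hfin, h₄.size, hr₄]
  have hset : (fun x => Function.update σ v .excluded x = Status.done) =
      fun x => σ x = .done ∧ x ≠ v := by
    funext x
    rcases eq_or_ne x v with rfl | hx
    · simp
    · simp [hx]
  rw [hset] at hmark
  rcases hsearch with ⟨h24, hno⟩ | ⟨i, h24, hiT, hi⟩
  · rw [if_neg (by omega)]
    refine ⟨hm₄, ?_⟩
    simp only [Store.setReg_reg, if_true, true_iff, zero_lt_one]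
    intro t ht
    rw [← hmark]
    by_contra hnot
    exact hno t ⟨ht, hnot⟩
  · rw [if_pos (by have := i.2; omega)]
    refine ⟨hm₄, ?_⟩
    simp only [Store.setReg_reg, if_true, lt_self_iff_false, false_iff]
    exact fun hall => hi ((hmark i).2 (hall i hiT))

theorem denote_superfluous (h : Env G T r s) (hσ : Holds s σ) {v : Fin n} (hv : s.reg 21 = v) :
    (superfluous.denote s).mem 3 = s.mem 3 ∧
      (0 < (superfluous.denote s).reg 12 ↔ σ v = .done ∧ v ∉ T ∧
        ∀ t ∈ T, Reaches G (fun x => σ x = .done ∧ x ≠ v) r t) := by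
  set s₁ := (hasLabel 21 .done).denote s with hs₁
  have h₁ : Env G T r s₁ := h.denote
  have F₁ : Frame _ s s₁ := frame (hasLabel 21 .done) s
  have v₁ := denote_hasLabel h hσ hv .done
  rw [← hs₁] at v₁
  have r₁ : s₁.reg 21 = v := by rw [F₁.reg 21 (by decide), hv]
  have m₁ : s₁.mem 3 = s.mem 3 := F₁.mem 3 (by decide)
  set s₂ := (load 12 1 21).denote s₁ with hs₂
  have h₂ : Env G T r s₂ := h₁.denote
  have v₂ : s₂.reg 12 = if v ∈ T then 1 else 0 := by
    rw [hs₂, denote, r₁, h₁.terminal_apply]; simp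
  have r₂ : s₂.reg 21 = v := by rw [hs₂, (frame _ _).reg 21 (by decide), r₁]
  have m₂ : s₂.mem 3 = s.mem 3 := m₁
  have hfin : superfluous.denote s = if s₁.reg 8 < s₁.reg 12 then
      (if s₂.reg 8 < s₂.reg 12 then s₂.setReg 12 0 else avoidable.denote s₂) else s₁ := rfl
  rw [hfin, h₁.zero, h₂.zero]
  by_cases hd : σ v = .done
  swap
  · rw [if_neg (by simp [v₁, hd]), v₁]; simp [hd, m₁]
  rw [if_pos (by simp [v₁, hd])]
  by_cases hT : v ∈ T
  · rw [if_pos (by simp [v₂, hT])]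
    simp [hT, m₂]
  · rw [if_neg (by simp [v₂, hT])]
    have ha := denote_avoidable h₂ (hσ.of_mem_eq m₂) r₂ hd
    rw [m₂] at ha
    refine ⟨ha.1, ?_⟩
    rw [ha.2]
    simp [hd, hT]

end Minimality

/-! ### Visiting a node of the search tree -/

namespace Block

/-- Write the set of vertices labelled `done` to the output. -/
def writeNode : Block := each 11 (hasLabel 11 .done ;; write 12)

/-- Registers `19` and `20` receive the number of waiting terminals and the number of vertices in
need of a child. -/
def countLabels : Block :=
  const 19 0 ;; count 11 19 (hasLabel 11 .waiting) ;; const 20 0 ;;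
    count 11 20 (hasLabel 11 .pending) ;; count 11 20 (hasLabel 11 .seeking)

/-- Continue the scan of the vertex in register `16`. -/
def scanVertex : Block :=
  search 11 17 (nextWithLabel .waiting) ;;
  cond 17 0 (setLabel 17 .met ;; setLabel 16 .served ;; push)
    (search 11 18 (nextWithLabel .free) ;;
    cond 18 0 (setLabel 18 .excluded ;; push ;; setLabel 18 .pending ;; setLabel 16 .served ;; push)
      (hasLabel 16 .served ;; cond 8 12 (setLabel 16 .done ;; push) skip))

/-- Output the set of found vertices if it is minimal. -/
def finish : Block := search 21 20 superfluous ;; cond 20 0 skip writeNode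

/-- Start the scan of a new vertex, or finish when there is none. -/
def nextVertex : Block :=
  search 11 17 (hasLabel 11 .pending) ;;
  cond 17 0 (setLabel 17 .seeking ;; push)
    (search 11 17 (hasLabel 11 .met) ;;
    cond 17 0 (setLabel 17 .served ;; push)
      (search 11 17 (hasLabel 11 .waiting) ;; cond 17 0 skip finish))

/-- Find the vertex being scanned. -/
def findActive : Block :=
  search 11 16 (hasLabel 11 .seeking) ;; cond 16 0 skip (search 11 16 (hasLabel 11 .served))

/-- Replace the node on top of the stack by its children, and write its output. -/
def visit : Block :=
  pop ;; countLabels ;; cond 19 20 skip (findActive ;; cond 16 0 scanVertex nextVertex)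

/-- The block changes neither the stack nor the current node nor the output. -/
def Quiet (p : Block) : Bool :=
  p.Local && !p.writes.contains 10 && !p.memWrites.contains 2 && !p.memWrites.contains 3 && p.Silent

end Block

/-- The machine holds the current node `σ` and the stack `l`, and has written `o`. -/
structure AtNode {n : ℕ} (G : SimpleGraph (Fin n)) (T : Finset (Fin n)) (r : Fin n)
    (σ : Fin n → Status) (l : List (Fin n → Status)) (o : List ℕ) (s : Store) : Prop where
  env : Env G T r s
  holds : Holds s σ
  stack : OnStack (s.mem 2) (s.reg 10) l
  out : s.out = o

/-- The machine holds a stack and an output that result from visiting the node `σ` above the stack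
`l` when `o` was written before. -/
def Visited {n : ℕ} (G : SimpleGraph (Fin n)) (T : Finset (Fin n)) (r : Fin n)
    (σ : Fin n → Status) (l : List (Fin n → Status)) (o : List ℕ) (s : Store) : Prop :=
  ∃ cs out, SearchStep G T r σ cs out ∧ Env G T r s ∧ OnStack (s.mem 2) (s.reg 10) (cs ++ l) ∧
    s.out = o ++ encodeSets out

section Visit

open Block

variable {n : ℕ} {G : SimpleGraph (Fin n)} {T : Finset (Fin n)} {r : Fin n} {s s' : Store}
  {σ : Fin n → Status} {l : List (Fin n → Status)} {o : List ℕ}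

theorem AtNode.of_frame {p : Block} (h : AtNode G T r σ l o s) (hf : p.Frame s s')
    (hp : p.Quiet = true := by rfl) : AtNode G T r σ l o s' := by
  simp only [Block.Quiet, Bool.and_eq_true, Bool.not_eq_true', List.contains_eq_mem,
    decide_eq_false_iff_not] at hp
  obtain ⟨⟨⟨⟨h1, h2⟩, h3⟩, h4⟩, h5⟩ := hp
  refine ⟨h.env.of_frame hf h1, h.holds.of_mem_eq (hf.mem 3 h4), ?_, (hf.out h5).trans h.out⟩
  rw [hf.mem 2 h3, hf.reg 10 h2]
  exact h.stack

theorem AtNode.denote {p : Block} (h : AtNode G T r σ l o s) (hp : p.Quiet = true := by rfl) :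
    AtNode G T r σ l o (p.denote s) :=
  h.of_frame (frame p s) hp

theorem AtNode.setLabel (h : AtNode G T r σ l o s) {x : ℕ} {u : Fin n} (hu : s.reg x = u)
    (c : Status) : AtNode G T r (Function.update σ u c) l o ((setLabel x c).denote s) := by
  have he := denote_setLabel h.env hu c
  refine ⟨h.env.denote, by rw [he]; exact h.holds.setMem c, ?_, by rw [he]; exact h.out⟩
  rw [he, Store.setMem_reg, Store.setMem_mem_of_ne _ _ _ (by decide)]
  exact h.stack

theorem AtNode.push (h : AtNode G T r σ l o s) : AtNode G T r σ (σ :: l) o (push.denote s) :=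
  ⟨h.env.denote, h.holds.of_mem_eq ((frame _ _).mem 3 (by decide)),
    OnStack.push h.env h.holds h.stack, ((frame Block.push _).out rfl).trans h.out⟩

theorem AtNode.visited {cs : List (Fin n → Status)} {τ : Fin n → Status}
    (h : AtNode G T r τ (cs ++ l) o s) (hs : SearchStep G T r σ cs []) :
    Visited G T r σ l o s :=
  ⟨cs, [], hs, h.env, h.stack, by simp [h.out, encodeSets]⟩

/-- The search for a vertex with the label `c`. -/
theorem AtNode.search (h : AtNode G T r σ l o s) (f : ℕ) (c : Status)
    (hw : ([0, 8, 11, f].all fun y => !(hasLabel 11 c).writes.contains y) = true)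
    (hd : [0, 8, 12, 11, f].Nodup) (hq : (search 11 f (hasLabel 11 c)).Quiet = true) :
    (((search 11 f (hasLabel 11 c)).denote s).reg f = n ∧ ∀ i, σ i ≠ c) ∨
      ∃ i : Fin n, ((search 11 f (hasLabel 11 c)).denote s).reg f = i ∧ σ i = c := by
  refine (denote_search (fun _ => True) h.env.size h.env.zero trivial hw hd ?_).2
  intro i s' hF _ hi
  have h' := h.of_frame hF hq
  rw [denote_hasLabel h'.env h'.holds hi c]
  split_ifs with hc <;> simp [hc]

/-- The search for a neighbour with the label `c` of the vertex being scanned. -/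
theorem AtNode.searchNext (h : AtNode G T r σ l o s) (f : ℕ) (c : Status) {v : Fin n}
    (hv : s.reg 16 = v)
    (hw : ([0, 8, 11, f].all fun y => !(nextWithLabel c).writes.contains y) = true)
    (hd : [0, 8, 12, 11, f].Nodup) (hq : (Block.search 11 f (nextWithLabel c)).Quiet = true)
    (h16 : 16 ∉ (Block.search 11 f (nextWithLabel c)).writes) :
    (((Block.search 11 f (nextWithLabel c)).denote s).reg f = n ∧
        ∀ i, ¬ (G.Adj v i ∧ σ i = c)) ∨
      ∃ i : Fin n, ((Block.search 11 f (nextWithLabel c)).denote s).reg f = i ∧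
        G.Adj v i ∧ σ i = c := by
  refine (denote_search (fun _ => True) h.env.size h.env.zero trivial hw hd ?_).2
  intro i s' hF _ hi
  have h' := h.of_frame hF hq
  exact ⟨trivial, denote_nextWithLabel h'.env h'.holds (by rw [hF.reg 16 h16, hv]) hi c⟩

theorem AtNode.scanVertex (h : AtNode G T r σ l o s) {v : Fin n} (hv : s.reg 16 = v)
    (hle : (needySet σ).card ≤ (waitingSet σ).card)
    (hact : (σ v).Active) : Visited G T r σ l o (scanVertex.denote s) := by
  set s₁ := (Block.search 11 17 (nextWithLabel .waiting)).denote s with hs₁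
  have h₁ : AtNode G T r σ l o s₁ := h.denote
  have v₁ : s₁.reg 16 = v := by rw [hs₁, (frame _ _).reg 16 (by decide), hv]
  set s₂ := (Block.search 11 18 (nextWithLabel .free)).denote s₁ with hs₂
  have h₂ : AtNode G T r σ l o s₂ := h₁.denote
  have v₂ : s₂.reg 16 = v := by rw [hs₂, (frame _ _).reg 16 (by decide), v₁]
  set s₃ := (hasLabel 16 .served).denote s₂ with hs₃
  have h₃ : AtNode G T r σ l o s₃ := h₂.denote
  have v₃ : s₃.reg 16 = v := by rw [hs₃, (frame _ _).reg 16 (by decide), v₂]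
  have hfin : Block.scanVertex.denote s = if s₁.reg 17 < s₁.reg 0 then
      Block.push.denote ((Block.setLabel 16 .served).denote ((Block.setLabel 17 .met).denote s₁))
    else if s₂.reg 18 < s₂.reg 0 then
      Block.push.denote ((Block.setLabel 16 .served).denote ((Block.setLabel 18 .pending).denote
        (Block.push.denote ((Block.setLabel 18 .excluded).denote s₂))))
    else if s₃.reg 8 < s₃.reg 12 then
      Block.push.denote ((Block.setLabel 16 .done).denote s₃) else s₃ := rfl
  rw [hfin, h₁.env.size, h₂.env.size, h₃.env.zero]
  rcases h.searchNext 17 .waiting hv rfl (by decide) rfl (by decide) with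
    ⟨f₁, hno₁⟩ | ⟨u, f₁, hvu, hu⟩
  swap
  · rw [← hs₁] at f₁
    rw [if_pos (by rw [f₁]; exact u.2)]
    have e₁ : ((Block.setLabel 17 .met).denote s₁).reg 16 = v := by
      rw [(frame _ _).reg 16 (by decide), v₁]
    exact AtNode.visited (cs := [_]) (((h₁.setLabel f₁ .met).setLabel e₁ .served).push)
      (.meet v u hle hact hvu hu)
  rw [← hs₁] at f₁
  rw [if_neg (by omega)]
  have hno₁' : ∀ w, G.Adj v w → σ w ≠ .waiting := fun w hw e => hno₁ w ⟨hw, e⟩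
  rcases h₁.searchNext 18 .free v₁ rfl (by decide) rfl (by decide) with
    ⟨f₂, hno₂⟩ | ⟨u, f₂, hvu, hu⟩
  swap
  · rw [← hs₂] at f₂
    rw [if_pos (by rw [f₂]; exact u.2)]
    have a₁ := (h₂.setLabel f₂ .excluded).push
    set s₄ := Block.push.denote ((Block.setLabel 18 .excluded).denote s₂) with hs₄
    have e₁ : s₄.reg 18 = u := by
      rw [hs₄, (frame _ _).reg 18 (by decide), (frame _ _).reg 18 (by decide), f₂]
    have e₂ : ((Block.setLabel 18 .pending).denote s₄).reg 16 = v := by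
      rw [(frame _ _).reg 16 (by decide), hs₄, (frame _ _).reg 16 (by decide),
        (frame _ _).reg 16 (by decide), v₂]
    have a₂ := ((a₁.setLabel e₁ .pending).setLabel e₂ .served).push
    rw [Function.update_idem] at a₂
    exact AtNode.visited (cs := [_, _]) a₂ (.branch v u hle hact hno₁' hvu hu)
  rw [← hs₂] at f₂
  rw [if_neg (by omega)]
  have hno : ∀ w, G.Adj v w → σ w ≠ .waiting ∧ σ w ≠ .free := fun w hw =>
    ⟨hno₁' w hw, fun e => hno₂ w ⟨hw, e⟩⟩
  rw [hs₃, denote_hasLabel h₂.env h₂.holds v₂ .served, ← hs₃]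
  by_cases hd : σ v = .served
  · rw [if_pos (by simp [hd])]
    exact AtNode.visited (cs := [_]) (h₃.setLabel v₃ .done).push (.close v hle hd hno)
  · rw [if_neg (by simp [hd])]
    have hsk : σ v = .seeking := by
      revert hact hd
      cases σ v <;> simp [Status.Active]
    exact AtNode.visited (cs := []) h₃ (.stuck v hsk hno)

theorem out_denote_writeNode (h : AtNode G T r σ l o s) :
    (writeNode.denote s).out = o ++ List.ofFn fun i => if σ i = .done then 1 else 0 := by
  obtain ⟨s', hF, hI, hEq⟩ := denote_each (p := hasLabel 11 .done ;; write 12) (x := 11) (s := s)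
    (fun k s' => s'.out = o ++ (List.ofFn fun i : Fin n => if σ i = .done then 1 else 0).take k)
    (by simp [h.out]) (by
      intro k hk s' hF hI
      rw [h.env.size] at hk
      have hF' : Frame (each 11 (hasLabel 11 .done ;; write 12)) s (s'.setReg 11 k) :=
        hF.trans (Frame.setReg s' (by decide))
      have hl := denote_hasLabel (h.env.of_frame hF')
        (h.holds.of_mem_eq (hF'.mem 3 (by decide))) (x := 11) (i := ⟨k, hk⟩) (by simp) .done
      rw [Block.denote, Block.denote, Store.emit_out, hl, (frame (hasLabel 11 .done) _).out rfl,
        Store.setReg_out, hI, List.append_assoc,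
        List.take_succ_eq_append_getElem (by simpa using hk), List.getElem_ofFn])
  have hEq' : writeNode.denote s = s'.setReg 11 (s.reg 0) := hEq
  rw [hEq', Store.setReg_out, hI, h.env.size, List.take_of_length_le (by simp)]

theorem AtNode.finish (h : AtNode G T r σ l o s) (hd : ∀ w, (σ w).Found → σ w = .done)
    (hw : ∀ w, σ w ≠ .waiting) : Visited G T r σ l o (finish.denote s) := by
  have hset : ∀ x, x ∈ foundSet σ ↔ σ x = .done := fun x => by
    rw [mem_foundSet]
    exact ⟨hd x, fun e => by rw [e]; trivial⟩
  have hq : ∀ {s'}, Frame (Block.search 21 20 superfluous) s s' → s'.mem 3 = s.mem 3 →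
      AtNode G T r σ l o s' := fun {s'} hF hm =>
    ⟨h.env.of_frame hF, h.holds.of_mem_eq hm, by
      rw [hF.mem 2 (by decide), hF.reg 10 (by decide)]; exact h.stack, (hF.out rfl).trans h.out⟩
  obtain ⟨hm, hsearch⟩ := denote_search (x := 21) (f := 20) (test := superfluous) (s := s)
    (P := fun v : Fin n => σ v = .done ∧ v ∉ T ∧
        ∀ t ∈ T, Reaches G (fun x => σ x = .done ∧ x ≠ v) r t)
    (fun m => m 3 = s.mem 3) h.env.size h.env.zero rfl rfl (by decide) (by
      intro i s' hF hK hi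
      have h' := hq hF hK
      have := denote_superfluous h'.env h'.holds hi
      rwa [hK] at this)
  set s₁ := (Block.search 21 20 superfluous).denote s with hs₁
  have h₁ : AtNode G T r σ l o s₁ := hq (frame _ _) hm
  have hfin : Block.finish.denote s = if s₁.reg 20 < s₁.reg 0 then s₁ else writeNode.denote s₁ :=
    rfl
  rw [hfin, h₁.env.size]
  rcases hsearch with ⟨hf, hno⟩ | ⟨v, hf, hv, hvT, hreach⟩
  · rw [if_neg (by omega)]
    refine ⟨[], [foundSet σ], .accept hd hw fun v hv hvT hreach => ?_, h₁.env.denote, ?_, ?_⟩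
    · simp only [hset] at hreach
      exact hno v ⟨hv, hvT, hreach⟩
    · rw [(frame writeNode s₁).mem 2 (by decide), (frame writeNode s₁).reg 10 (by decide)]
      exact h₁.stack
    · rw [out_denote_writeNode h₁]
      simp [encodeSets, hset]
  · rw [if_pos (by rw [hf]; exact v.2)]
    refine AtNode.visited (cs := []) h₁ (.reject v hd hw hv hvT ?_)
    simpa only [hset] using hreach

theorem AtNode.nextVertex (h : AtNode G T r σ l o s)
    (hle : (needySet σ).card ≤ (waitingSet σ).card)
    (hact : ∀ w, ¬ (σ w).Active) : Visited G T r σ l o (nextVertex.denote s) := by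
  set s₁ := (Block.search 11 17 (hasLabel 11 .pending)).denote s with hs₁
  have h₁ : AtNode G T r σ l o s₁ := h.denote
  set s₂ := (Block.search 11 17 (hasLabel 11 .met)).denote s₁ with hs₂
  have h₂ : AtNode G T r σ l o s₂ := h₁.denote
  set s₃ := (Block.search 11 17 (hasLabel 11 .waiting)).denote s₂ with hs₃
  have h₃ : AtNode G T r σ l o s₃ := h₂.denote
  have hfin : Block.nextVertex.denote s = if s₁.reg 17 < s₁.reg 0 then
      Block.push.denote ((Block.setLabel 17 .seeking).denote s₁)
    else if s₂.reg 17 < s₂.reg 0 then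
      Block.push.denote ((Block.setLabel 17 .served).denote s₂)
    else if s₃.reg 17 < s₃.reg 0 then s₃ else Block.finish.denote s₃ := rfl
  rw [hfin, h₁.env.size, h₂.env.size, h₃.env.size]
  rcases h.search 17 .pending rfl (by decide) rfl with ⟨f₁, hno₁⟩ | ⟨v, f₁, hv⟩
  swap
  · rw [← hs₁] at f₁
    rw [if_pos (by rw [f₁]; exact v.2)]
    exact AtNode.visited (cs := [_]) (h₁.setLabel f₁ .seeking).push (.scanPending v hle hact hv)
  rw [← hs₁] at f₁
  rw [if_neg (by omega)]
  rcases h₁.search 17 .met rfl (by decide) rfl with ⟨f₂, hno₂⟩ | ⟨v, f₂, hv⟩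
  swap
  · rw [← hs₂] at f₂
    rw [if_pos (by rw [f₂]; exact v.2)]
    exact AtNode.visited (cs := [_]) (h₂.setLabel f₂ .served).push (.scanMet v hle hact hv)
  rw [← hs₂] at f₂
  rw [if_neg (by omega)]
  have hd : ∀ w, (σ w).Found → σ w = .done := by
    intro w
    have h1 := hact w
    have h2 := hno₁ w
    have h3 := hno₂ w
    revert h1 h2 h3
    cases σ w <;> simp [Status.Found, Status.Active]
  rcases h₂.search 17 .waiting rfl (by decide) rfl with ⟨f₃, hno₃⟩ | ⟨v, f₃, hv⟩
  · rw [← hs₃] at f₃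
    rw [if_neg (by omega)]
    exact h₃.finish hd hno₃
  · rw [← hs₃] at f₃
    rw [if_pos (by rw [f₃]; exact v.2)]
    exact AtNode.visited (cs := []) h₃ (.unreachable v hd hv)

theorem AtNode.count (h : AtNode G T r σ l o s) (f : ℕ) (c : Status)
    (hw : ([0, 8, 11, f].all fun y => !(hasLabel 11 c).writes.contains y) = true)
    (hd : [0, 8, 12, 11, f].Nodup) (hq : (count 11 f (hasLabel 11 c)).Quiet = true) :
    ((count 11 f (hasLabel 11 c)).denote s).reg f =
      s.reg f + (Finset.univ.filter fun v => σ v = c).card := by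
  refine denote_count h.env.size h.env.zero hw hd ?_
  intro i s' hF hi
  have h' := h.of_frame hF hq
  rw [denote_hasLabel h'.env h'.holds hi c]
  split_ifs with hc <;> simp [hc]

theorem AtNode.countLabels (h : AtNode G T r σ l o s) :
    (countLabels.denote s).reg 19 = (waitingSet σ).card ∧
      (countLabels.denote s).reg 20 = (needySet σ).card := by
  have h₁ : AtNode G T r σ l o ((const 19 0).denote s) := h.denote
  set s₁ := (const 19 0).denote s with hs₁
  have c₂ := h₁.count 19 .waiting rfl (by decide) rfl
  set s₂ := (Block.count 11 19 (hasLabel 11 .waiting)).denote s₁ with hs₂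
  have h₂ : AtNode G T r σ l o s₂ := h₁.denote
  set s₃ := (const 20 0).denote s₂ with hs₃
  have h₃ : AtNode G T r σ l o s₃ := h₂.denote
  have c₄ := h₃.count 20 .pending rfl (by decide) rfl
  set s₄ := (Block.count 11 20 (hasLabel 11 .pending)).denote s₃ with hs₄
  have h₄ : AtNode G T r σ l o s₄ := h₃.denote
  have c₅ := h₄.count 20 .seeking rfl (by decide) rfl
  set s₅ := (Block.count 11 20 (hasLabel 11 .seeking)).denote s₄ with hs₅
  have hfin : Block.countLabels.denote s = s₅ := rfl
  rw [hfin]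
  constructor
  · rw [hs₅, (frame _ _).reg 19 (by decide), hs₄, (frame _ _).reg 19 (by decide), hs₃,
      (frame _ _).reg 19 (by decide), c₂]
    simp [hs₁, Block.denote]
  · have : s₃.reg 20 = 0 := by simp [hs₃, Block.denote]
    rw [c₅, c₄, this, zero_add, ← Finset.card_union_of_disjoint]
    · congr 1
      ext v
      simp only [Finset.mem_union, Finset.mem_filter, Finset.mem_univ, true_and]
      cases σ v <;> simp [Status.Needy]
    · rw [Finset.disjoint_left]
      intro v h1 h2
      simp only [Finset.mem_filter, Finset.mem_univ, true_and] at h1 h2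
      rw [h1] at h2; cases h2

theorem AtNode.findActive (h : AtNode G T r σ l o s) :
    ((findActive.denote s).reg 16 = n ∧ ∀ i, ¬ (σ i).Active) ∨
      ∃ i : Fin n, (findActive.denote s).reg 16 = i ∧ (σ i).Active := by
  have c₁ := h.search 16 .seeking rfl (by decide) rfl
  set s₁ := (Block.search 11 16 (hasLabel 11 .seeking)).denote s with hs₁
  have h₁ : AtNode G T r σ l o s₁ := h.denote
  have c₂ := h₁.search 16 .served rfl (by decide) rfl
  set s₂ := (Block.search 11 16 (hasLabel 11 .served)).denote s₁ with hs₂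
  have hfin : Block.findActive.denote s = if s₁.reg 16 < s₁.reg 0 then s₁ else s₂ := rfl
  rw [hfin, h₁.env.size]
  rcases c₁ with ⟨f₁, hno₁⟩ | ⟨i, f₁, hi⟩
  · rw [if_neg (by omega)]
    rcases c₂ with ⟨f₂, hno₂⟩ | ⟨i, f₂, hi⟩
    · refine Or.inl ⟨f₂, fun i => ?_⟩
      have h1 := hno₁ i
      have h2 := hno₂ i
      revert h1 h2
      cases σ i <;> simp [Status.Active]
    · exact Or.inr ⟨i, f₂, by rw [hi]; trivial⟩
  · rw [if_pos (by rw [f₁]; exact i.2)]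
    exact Or.inr ⟨i, f₁, by rw [hi]; trivial⟩

theorem visited_visit (h : Env G T r s) (hl : OnStack (s.mem 2) (s.reg 10) (σ :: l)) :
    Visited G T r σ l s.out (visit.denote s) := by
  have hpop := denote_pop h hl
  set s₁ := pop.denote s with hs₁
  have h₁ : AtNode G T r σ l s.out s₁ := ⟨h.denote, hpop.1, hpop.2, (frame pop s).out rfl⟩
  obtain ⟨c19, c20⟩ := h₁.countLabels
  set s₂ := Block.countLabels.denote s₁ with hs₂
  have h₂ : AtNode G T r σ l s.out s₂ := h₁.denote
  have hact := h₂.findActive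
  set s₃ := Block.findActive.denote s₂ with hs₃
  have h₃ : AtNode G T r σ l s.out s₃ := h₂.denote
  have hfin : visit.denote s = if s₂.reg 19 < s₂.reg 20 then s₂
    else if s₃.reg 16 < s₃.reg 0 then Block.scanVertex.denote s₃
    else Block.nextVertex.denote s₃ := by
    simp only [visit, Block.denote, hs₁, hs₂, hs₃]
  rw [hfin, c19, c20, h₃.env.size]
  split_ifs with hlt h16
  · exact AtNode.visited (cs := []) h₂ (.hopeless hlt)
  · rcases hact with ⟨hf, -⟩ | ⟨v, hf, hv⟩
    · omega
    · exact h₃.scanVertex hf (not_lt.1 hlt) hv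
  · rcases hact with ⟨-, hno⟩ | ⟨v, hf, -⟩
    · exact h₃.nextVertex (not_lt.1 hlt) hno
    · rw [hf] at h16
      exact absurd v.2 h16

end Visit

/-! ### The whole program -/

namespace Block

/-- Load the codes of the labels. -/
def loadLabels : Block :=
  const 1 1 ;; const 2 2 ;; const 3 3 ;; const 4 4 ;; const 5 5 ;; const 6 6 ;; const 7 7

/-- Choose a root and put the root of the search tree on the stack. -/
def prepare : Block :=
  loadLabels ;; search 11 9 (load 12 1 11) ;;
    each 11 (load 12 1 11 ;; cond 8 12 (store 3 11 2) skip) ;; store 3 9 5 ;; push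

end Block

/-- The enumeration of all minimal sets. -/
def enumerate : Program :=
  .seq Block.prepare.compile (.loop 8 10 Block.visit.compile)

section Main

open Block

variable {n : ℕ} {G : SimpleGraph (Fin n)} {T : Finset (Fin n)} {r : Fin n} {s s' : Store}

theorem denote_prepare (hT : T.Nonempty) :
    ∃ r ∈ T, Env G T r (prepare.denote (inputStore G T)) ∧
      OnStack ((prepare.denote (inputStore G T)).mem 2)
        ((prepare.denote (inputStore G T)).reg 10) [initialStatus T r] ∧
      (prepare.denote (inputStore G T)).out = [] := by
  set s := inputStore G T with hs
  set s₁ := loadLabels.denote s with hs₁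
  have n₁ : s₁.reg 0 = n := by
    rw [hs₁, (frame _ _).reg 0 (by decide)]; rfl
  have z₁ : s₁.reg 8 = 0 := by
    rw [hs₁, (frame _ _).reg 8 (by decide)]; rfl
  have t₁ : ∀ i : Fin n, s₁.mem 1 i = if i ∈ T then 1 else 0 := by
    intro i
    have : s₁.mem 1 = s.mem 1 := (frame _ _).mem 1 (by decide)
    rw [this, hs, inputStore_terminal]
  have hsearch := (denote_search (x := 11) (f := 9) (test := load 12 1 11) (s := s₁)
    (P := fun i : Fin n => i ∈ T) (fun _ => True) n₁ z₁ trivial rfl (by decide) (by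
      intro i s' hF _ hi
      refine ⟨trivial, ?_⟩
      rw [denote, Store.setReg_reg, if_pos rfl, hi, hF.mem 1 (by decide), t₁]
      split_ifs with h <;> simp [h])).2
  set s₂ := (search 11 9 (load 12 1 11)).denote s₁ with hs₂
  obtain ⟨r, r₂, hr⟩ : ∃ r : Fin n, s₂.reg 9 = r ∧ r ∈ T := by
    rcases hsearch with ⟨-, hno⟩ | h
    · obtain ⟨t, ht⟩ := hT
      exact absurd ht (hno t)
    · exact h
  have h₂ : Env G T r s₂ := by
    have F₁ : Frame _ s s₁ := frame loadLabels s
    have F₂ : Frame _ s₁ s₂ := frame (search 11 9 (load 12 1 11)) s₁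
    refine ⟨by rw [F₂.reg 0 (by decide), n₁], fun c => ?_, r₂, ?_, ?_⟩
    · rw [F₂.reg _ (by cases c <;> decide)]
      cases c with
      | free => exact z₁
      | _ => rfl
    · rw [F₂.mem 0 (by decide), F₁.mem 0 (by decide)]
    · rw [F₂.mem 1 (by decide), F₁.mem 1 (by decide)]
  have m₂ : s₂.mem 3 = fun _ => 0 := by
    rw [hs₂, (frame _ _).mem 3 (by decide), hs₁, (frame _ _).mem 3 (by decide)]
    funext k
    simp [hs, inputStore]
  have e₂ : s₂.reg 10 = 0 := by
    rw [hs₂, (frame _ _).reg 10 (by decide), hs₁, (frame _ _).reg 10 (by decide)]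
    simp [hs, inputStore]
  have o₂ : s₂.out = [] := by
    rw [hs₂, (frame _ _).out rfl, hs₁, (frame _ _).out rfl]; rfl
  obtain ⟨s', hF, hI, hEq⟩ := denote_each (p := load 12 1 11 ;; cond 8 12 (store 3 11 2) skip)
    (x := 11) (s := s₂) (fun k s' => (∀ j : Fin n, s'.mem 3 j =
      if (j : ℕ) < k ∧ j ∈ T then 2 else 0)) (by simp [m₂]) (by
      intro k hk s' hF hI j
      have hE : Env G T r s' := h₂.of_frame hF
      rw [h₂.size] at hk
      have ht := hE.terminal_apply ⟨k, hk⟩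
      have h2 : s'.reg 2 = 2 := hE.label .waiting
      simp only [denote, Store.setReg_reg, Store.setReg_mem, if_true]
      norm_num
      rw [hE.zero, ht]
      by_cases hkT : (⟨k, hk⟩ : Fin n) ∈ T
      · rw [if_pos (by simp [hkT]), Store.setMem_mem_self]
        simp only [Store.setReg_mem]
        by_cases hjk : j = ⟨k, hk⟩
        · subst hjk
          simp [hkT, h2]
        · have hjk' : (j : ℕ) ≠ k := fun e => hjk (Fin.ext e)
          rw [Function.update_of_ne hjk', hI j]
          congr 1
          rw [eq_iff_iff]
          constructor
          · rintro ⟨h1, h2⟩; exact ⟨by omega, h2⟩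
          · rintro ⟨h1, h2⟩; exact ⟨by omega, h2⟩
      · rw [if_neg (by simp [hkT]), Store.setReg_mem, Store.setReg_mem, hI j]
        congr 1
        rw [eq_iff_iff]
        constructor
        · rintro ⟨h1, h2⟩; exact ⟨by omega, h2⟩
        · rintro ⟨h1, h2⟩
          refine ⟨?_, h2⟩
          rcases Nat.lt_or_eq_of_le h1 with h1 | h1
          · omega
          · have : j = ⟨k, hk⟩ := Fin.ext (by simpa using h1)
            exact absurd (this ▸ h2) hkT)
  set s₃ := (each 11 (load 12 1 11 ;; cond 8 12 (store 3 11 2) skip)).denote s₂ with hs₃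
  have h₃ : Env G T r s₃ := h₂.denote
  set s₄ := (store 3 9 5).denote s₃ with hs₄
  have h₄ : Env G T r s₄ := h₃.denote
  have hσ : Holds s₄ (initialStatus T r) := by
    intro i
    have h5 : s₃.reg 5 = 5 := h₃.label .seeking
    rw [hs₄, denote, Store.setMem_mem_self, h₃.root, h5]
    unfold initialStatus
    rcases eq_or_ne i r with rfl | hir
    · simp [Status.code]
    · rw [Function.update_of_ne (fun e => hir (Fin.ext e)), hEq, Store.setReg_mem, hI i, h₂.size]
      by_cases hiT : i ∈ T <;> simp [hiT, hir, Status.code]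
  have h10 : s₄.reg 10 = 0 := by
    rw [hs₄, (frame _ _).reg 10 (by decide), hs₃, (frame _ _).reg 10 (by decide), e₂]
  have o₄ : s₄.out = [] := by
    rw [hs₄, (frame _ _).out rfl, hs₃, (frame _ _).out rfl, o₂]
  have hfin : prepare.denote s = push.denote s₄ := rfl
  rw [hfin]
  refine ⟨r, hr, h₄.denote, OnStack.push h₄ hσ (l := []) h10, ?_⟩
  rw [(frame push _).out rfl, o₄]

open Classical in
/-- The main loop, started with the stack `l`. Every round visits one node, so that the number of
rounds is at most the total size of the trees below the nodes on the stack. -/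
theorem runs_loop (hr : r ∈ T) (hT : 2 ≤ T.card) (N : ℕ) :
    ∀ (l : List (Fin n → Status)) (s : Store), (∀ σ ∈ l, SearchInv G T r σ) →
      (l.map (treeSize G)).sum ≤ N → Env G T r s → OnStack (s.mem 2) (s.reg 10) l →
      ∃ (s' : Store) (t : ℕ) (L : List (Finset (Fin n))),
        Runs (.loop 8 10 visit.compile) s s' t ∧
        (t : ℝ) ≤ (l.map (treeSize G)).sum * (visit.cost n + 1) + 1 ∧
        s'.out = s.out ++ encodeSets L ∧
        ∀ S, L.count S =
          if IsMinimalTConnecting G T S then l.countP (fun σ => Agrees σ S) else 0 := by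
  induction N with
  | zero =>
    intro l s hinv hN h hl
    cases l with
    | nil =>
      have h10 : s.reg 10 = 0 := hl
      refine ⟨s, 1, [], .loop_false (by rw [h10]; omega), by simp, by simp [encodeSets], ?_⟩
      simp
    | cons σ l =>
      have h1 := one_le_treeSize (G := G) (σ := σ)
      have h2 : 0 ≤ (l.map (treeSize G)).sum := List.sum_nonneg (by
        simp only [List.mem_map]
        rintro _ ⟨τ, -, rfl⟩
        exact zero_le_one.trans one_le_treeSize)
      simp only [List.map_cons, List.sum_cons, Nat.cast_zero] at hN
      linarith
  | succ N ih =>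
    intro l s hinv hN h hl
    cases l with
    | nil =>
      have h10 : s.reg 10 = 0 := hl
      refine ⟨s, 1, [], .loop_false (by rw [h10]; omega), by simp, by simp [encodeSets], ?_⟩
      simp
    | cons σ l =>
      have hσ := hinv σ List.mem_cons_self
      have hlt : s.reg 8 < s.reg 10 := by
        obtain ⟨top, htop, -, -⟩ := hl
        have := r.pos
        rw [h.zero, htop]
        omega
      obtain ⟨t₁, ht₁, hrun₁⟩ := runs_compile (p := visit) (by decide) (by decide) s
      rw [h.size] at ht₁
      obtain ⟨cs, out, hstep, h₁, hl₁, ho₁⟩ := visited_visit h hl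
      set s₁ := visit.denote s with hs₁
      have hsize := hstep.sum_treeSize_le hσ
      simp only [List.map_cons, List.sum_cons] at hN
      push_cast at hN
      obtain ⟨s', t₂, L, hrun₂, ht₂, ho₂, hcount⟩ := ih (cs ++ l) s₁ (by
        intro τ hτ
        rcases List.mem_append.1 hτ with hτ | hτ
        · exact hstep.searchInv hσ τ hτ
        · exact hinv τ (List.mem_cons_of_mem _ hτ))
        (by rw [List.map_append, List.sum_append]; linarith) h₁ hl₁
      refine ⟨s', t₁ + t₂ + 1, out ++ L, .loop_true hlt hrun₁ hrun₂, ?_, ?_, ?_⟩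
      · rw [List.map_append, List.sum_append] at ht₂
        rw [List.map_cons, List.sum_cons]
        have hc : (t₁ : ℝ) ≤ visit.cost n := by exact_mod_cast ht₁
        have hK : (0 : ℝ) ≤ (visit.cost n : ℝ) + 1 := by positivity
        have h3 := mul_le_mul_of_nonneg_right hsize hK
        push_cast
        linarith
      · rw [ho₂, ho₁, encodeSets, encodeSets, encodeSets, List.flatMap_append, List.append_assoc]
      · intro S
        rw [List.count_append, hcount S]
        by_cases hS : IsMinimalTConnecting G T S
        · have h4 := hstep.count_eq hσ hr hT hS
          rw [if_pos hS, if_pos hS, List.countP_append, List.countP_cons]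
          simp only [decide_eq_true_eq]
          have h5 : List.count S out = @List.count _ instBEqOfDecidableEq S out := rfl
          omega
        · rw [if_neg hS, if_neg hS, Nat.add_zero, List.count_eq_zero]
          exact fun hmem => hS (hstep.isMinimal_of_mem hσ hr hmem)

theorem depthBound_le (σ : Fin n → Status) : depthBound σ ≤ 4 * n := by
  calc depthBound σ ≤ ∑ _v : Fin n, 4 := Finset.sum_le_sum fun v _ => by
        cases σ v <;> simp [Status.rank]
    _ = 4 * n := by simp [mul_comm]

/-- The running time, in terms of the cost of the two parts of the program. -/
theorem enumerates (G : SimpleGraph (Fin n)) (T : Finset (Fin n)) (hT : 2 ≤ T.card)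
    (hTn : 3 * T.card ≤ n) :
    EnumeratesMinimalTConnecting enumerate G T
      (13 * ((prepare ;; each 11 visit).cost n : ℝ) *
        (((n - T.card).choose (T.card - 2) : ℝ) *
          (3 : ℝ) ^ (((n : ℝ) - (T.card : ℝ)) / 3))) := by
  classical
  obtain ⟨r, hr, hE, hl, ho⟩ := denote_prepare (G := G) (Finset.card_pos.1 (by omega : 0 < T.card))
  obtain ⟨t₁, ht₁, hrun₁⟩ := runs_compile (p := prepare) (by decide) (by decide)
    (inputStore G T)
  have hn0 : (inputStore G T).reg 0 = n := rfl
  rw [hn0] at ht₁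
  obtain ⟨N, hN⟩ := exists_nat_ge (([initialStatus T r].map (treeSize G)).sum)
  obtain ⟨s', t₂, L, hrun₂, ht₂, ho₂, hcount⟩ := runs_loop hr hT N [initialStatus T r] _
    (by simpa using searchInv_initialStatus) hN hE hl
  have hcount' : ∀ S, L.count S = if IsMinimalTConnecting G T S then 1 else 0 := by
    intro S
    rw [hcount S]
    split_ifs with hS
    · simp [agrees_initialStatus hr hS]
    · rfl
  refine ⟨s', t₁ + t₂, L, .seq hrun₁ hrun₂, ?_, by rw [ho₂, ho]; rfl, ?_, fun S => ?_⟩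
  · have hcard : Fintype.card (Fin n) = n := Fintype.card_fin n
    have hpot := potential_initialStatus_le_choose (G := G) hr hT (by rw [hcard]; exact hTn)
    rw [hcard] at hpot
    set B : ℝ := ((n - T.card).choose (T.card - 2) : ℝ) *
      (3 : ℝ) ^ (((n : ℝ) - (T.card : ℝ)) / 3) with hB
    have hB1 : 1 ≤ B := by
      have h1 : (1 : ℝ) ≤ ((n - T.card).choose (T.card - 2) : ℝ) := by
        exact_mod_cast Nat.choose_pos (by omega)
      have h2 : (1 : ℝ) ≤ (3 : ℝ) ^ (((n : ℝ) - (T.card : ℝ)) / 3) := by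
        refine Real.one_le_rpow (by norm_num) (div_nonneg (sub_nonneg.2 ?_) (by norm_num))
        exact_mod_cast (by omega : T.card ≤ n)
      nlinarith
    have hd : (depthBound (initialStatus T r) : ℝ) ≤ 4 * n := by
      exact_mod_cast depthBound_le (initialStatus T r)
    have hn : (1 : ℝ) ≤ n := by exact_mod_cast (by omega : 1 ≤ n)
    have hsize : treeSize G (initialStatus T r) ≤ 13 * n * B := by
      have h1 : (depthBound (initialStatus T r) : ℝ) * potential G (initialStatus T r) ≤
          4 * n * B := mul_le_mul hd hpot potential_nonneg (by positivity)
      have h2 : 1 * 1 ≤ (n : ℝ) * B := mul_le_mul hn hB1 zero_le_one (by positivity)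
      rw [treeSize]
      linarith
    have hcost : ((prepare ;; each 11 visit).cost n : ℝ) =
        prepare.cost n + (2 + n * (visit.cost n + 2)) := by
      simp only [Block.cost]; push_cast; ring
    rw [hcost]
    simp only [List.map_cons, List.map_nil, List.sum_cons, List.sum_nil, add_zero] at ht₂
    have ht₁' : (t₁ : ℝ) ≤ prepare.cost n := by exact_mod_cast ht₁
    have hi : (0 : ℝ) ≤ prepare.cost n := Nat.cast_nonneg _
    have hv : (0 : ℝ) ≤ visit.cost n := Nat.cast_nonneg _
    have h3 : treeSize G (initialStatus T r) * (visit.cost n + 1) ≤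
        13 * n * B * (visit.cost n + 1) := mul_le_mul_of_nonneg_right hsize (by linarith)
    have h4 : (prepare.cost n : ℝ) * 1 ≤ prepare.cost n * B :=
      mul_le_mul_of_nonneg_left hB1 hi
    have h5 : (0 : ℝ) ≤ n * B := by positivity
    have h6 : (0 : ℝ) ≤ prepare.cost n * B := by positivity
    push_cast
    nlinarith
  · refine List.nodup_iff_count_le_one.2 fun S => ?_
    have := hcount' S
    split_ifs at this <;> omega
  · rw [← List.count_pos_iff, hcount' S]
    split_ifs with hS <;> simp [hS]

end Main

end RAM

theorem theorem2 :
    (∀ (V : Type*) [Fintype V] (G : SimpleGraph V) (T : Finset V),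
      2 ≤ T.card → 3 * T.card ≤ Fintype.card V →
        (({S : Finset V | IsMinimalTConnecting G T S}.ncard : ℕ) : ℝ) ≤
          ((Fintype.card V - T.card).choose (T.card - 2) : ℝ) *
            (3 : ℝ) ^ (((Fintype.card V : ℝ) - (T.card : ℝ)) / 3)) ∧
    (∃ (P : RAM.Program) (c d : ℕ),
      ∀ (n : ℕ) (G : SimpleGraph (Fin n)) (T : Finset (Fin n)),
        2 ≤ T.card → 3 * T.card ≤ n →
          EnumeratesMinimalTConnecting P G T
            ((c : ℝ) * (n : ℝ) ^ d *
              (((n - T.card).choose (T.card - 2) : ℝ) *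
                (3 : ℝ) ^ (((n : ℝ) - (T.card : ℝ)) / 3)))) := by
  refine ⟨fun V _ G T hT hTn => ?_, ?_⟩
  · classical exact ncard_isMinimalTConnecting_le G T hT hTn
  · obtain ⟨c, d, h⟩ := (RAM.Block.prepare.seq (RAM.Block.visit.each 11)).cost_le
    refine ⟨RAM.enumerate, 13 * (c * 2 ^ d), d, fun n G T hT hTn => ?_⟩
    obtain ⟨s, t, L, hrun, ht, hrest⟩ := RAM.enumerates G T hT hTn
    refine ⟨s, t, L, hrun, ht.trans (mul_le_mul_of_nonneg_right ?_ (by positivity)), hrest⟩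
    have h1 : c * (n + 1) ^ d ≤ c * 2 ^ d * n ^ d := by
      rw [Nat.mul_assoc, ← Nat.mul_pow]
      exact Nat.mul_le_mul_left c (Nat.pow_le_pow_left (by omega) d)
    have h2 := (h n).trans h1
    have h3 : ((RAM.Block.prepare.seq (RAM.Block.visit.each 11)).cost n : ℝ) ≤
        c * 2 ^ d * n ^ d := by exact_mod_cast h2
    push_cast
    linarith
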